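/- **Shifts.** Let $\mathcal F$ be the set of functions $\gamma$ for which there are $T_0,T_1>0$ such that: (F1) $\gamma:[T_0,\infty)\to[T_1,\infty)$ is a strictly increasing bijection, and $\gamma(T)\to\infty$ as $T\to\infty$; (F2) $\gamma$ is of class $C^2$ and $\gamma'$ is monotonic on $[T_0,\infty)$; (F3) there is $\alpha>0$ with $\alpha\gamma(T)\le\gamma'(T)$ for all $T\ge T_0$ and $\alpha T_0\le\log\gamma(T_0)$. A tuple $(\gamma_1,\dots,\gamma_r)$ of elements of $\mathcal F$ is called admissible if for every $(c_1,\dots,c_r)\in\mathbb R^r\setminus\{0\}$ there are $m>0$ and $T>0$ such that $c_1\gamma_1'+\dots+c_r\gamma_r'$ is monotonic on $(T,\infty)$ and is either $>m$ on all of $(T,\infty)$ or $<-m$ on all of $(T,\infty)$. **Region.** Let $\mathcal K$ be a non-empty compact subset of the strip $1/2<\operatorname{Re}s<1$ with connected complement. Put $\sigma_0=\frac12\left(\frac12+\min_{\mathcal K}\operatorname{Re}\right)$, $\sigma_1=\frac12\left(\sigma_0+\min_{\mathcal K}\operatorname{Re}\right)$, $\sigma_2=\frac12\left(1+\max_{\mathcal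 K}\operatorname{Re}\right)$, and $$\mathcal R=\left\{s\in\mathbb C:\ \sigma_1<\operatorname{Re}s<\sigma_2,\ \min_{\mathcal K}\operatorname{Im}-\tfrac12<\operatorname{Im}s<\max_{\mathcal K}\operatorname{Im}+\tfrac12\right\}.$$ Let $\mathcal H(\mathcal R)$ be the space of holomorphic functions on $\mathcal R$ with the topology of uniform convergence on compact sets, and give $\mathcal H^r(\mathcal R)=\mathcal H(\mathcal R)^r$ the product topology and its Borel $\sigma$-algebra. **Measures.** Let $\Omega=\prod_p\{z\in\mathbb C:|z|=1\}$, the product being over all primes $p$, and let $\mathbf m^r$ be the probability Haar measure on the compact group $\Omega^r$. For $\omega=(\omega_1,\dots,\omega_r)\in\Omega^r$ let $$\zeta(s,\omega_j)=\lim_{N\to\infty}\prod_{p<N}\left(1-\frac{\omega_j(p)}{p^s}\right)^{-1}$$ be the limit in $\mathcal H(\mathcal R)$. For Borel sets $A\subset\mathcal H^r(\mathcal R)$ put $$\mathcal Q_T(A)=\frac1T\operatorname{meas}\left\{\tau\in[T,2T]:\ \left(\zeta(s+i\gamma_1(\tau)),\dots,\zeta(s+i\gamma_r(\tau))\right)\in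 A\right\},$$ $$\mathcal Q(A)=\mathbf m^r\left\{\omega\in\Omega^r:\ \left(\zeta(s,\omega_1),\dots,\zeta(s,\omega_r)\right)\in A\right\}.$$ **Proposition.** Let $(\gamma_1,\dots,\gamma_r)$ be admissible. Then the limits defining $\zeta(s,\omega_1),\dots,\zeta(s,\omega_r)$ exist for $\mathbf m^r$-almost every $\omega$, $\mathcal Q$ is a probability measure, $\mathcal Q_T$ is a probability measure for all sufficiently large $T$, and $\mathcal Q_T$ converges weakly to $\mathcal Q$ as $T\to\infty$. -/

import Mathlib

open Filter Topology MeasureTheory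

noncomputable section

namespace JointZeta

/-! ### The shifts -/

/-- The class `F` of shifts, for a real function `γ` of which only the values on some half-line
`[T₀, ∞)` matter. The derivative on `[T₀, ∞)` is the derivative within that half-line, so it is the
right derivative at `T₀`. -/
def IsShift (γ : ℝ → ℝ) : Prop :=
  ∃ T₀ T₁ : ℝ, 0 < T₀ ∧ 0 < T₁ ∧
    StrictMonoOn γ (Set.Ici T₀) ∧
    Set.BijOn γ (Set.Ici T₀) (Set.Ici T₁) ∧
    Tendsto γ atTop atTop ∧
    ContDiffOn ℝ 2 γ (Set.Ici T₀) ∧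
    (MonotoneOn (derivWithin γ (Set.Ici T₀)) (Set.Ici T₀) ∨
      AntitoneOn (derivWithin γ (Set.Ici T₀)) (Set.Ici T₀)) ∧
    ∃ α : ℝ, 0 < α ∧
      (∀ T : ℝ, T₀ ≤ T → α * γ T ≤ derivWithin γ (Set.Ici T₀) T) ∧
      α * T₀ ≤ Real.log (γ T₀)

/-- Admissible tuples of shifts: every nontrivial real linear combination of the derivatives is
eventually monotonic and eventually bounded away from `0` on one side. -/
def IsAdmissible {r : ℕ} (γ : Fin r → ℝ → ℝ) : Prop :=
  (∀ j, IsShift (γ j)) ∧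
    ∀ c : Fin r → ℝ, c ≠ 0 →
      ∃ m T : ℝ, 0 < m ∧ 0 < T ∧
        (MonotoneOn (fun τ => ∑ j, c j * deriv (γ j) τ) (Set.Ioi T) ∨
          AntitoneOn (fun τ => ∑ j, c j * deriv (γ j) τ) (Set.Ioi T)) ∧
        ((∀ τ, T < τ → m < ∑ j, c j * deriv (γ j) τ) ∨
          (∀ τ, T < τ → ∑ j, c j * deriv (γ j) τ < -m))

/-! ### The strip and the rectangle attached to a compact set -/

/-- The strip `1/2 < Re s < 1`. -/
def strip : Set ℂ := {s | 1 / 2 < s.re ∧ s.re < 1}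

/-- `σ₀ = (1/2 + min Re) / 2`, the minimum being over `K`. -/
def sigma0 (K : Set ℂ) : ℝ := (1 / 2 + sInf (Complex.re '' K)) / 2

/-- `σ₁ = (σ₀ + min Re) / 2`. -/
def sigma1 (K : Set ℂ) : ℝ := (sigma0 K + sInf (Complex.re '' K)) / 2

/-- `σ₂ = (1 + max Re) / 2`. -/
def sigma2 (K : Set ℂ) : ℝ := (1 + sSup (Complex.re '' K)) / 2

/-- The open rectangle `(σ₁, σ₂) × i (min Im - 1/2, max Im + 1/2)`. -/
def rectangle (K : Set ℂ) : TopologicalSpace.Opens ℂ where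
  carrier := {s | (sigma1 K < s.re ∧ s.re < sigma2 K) ∧
    (sInf (Complex.im '' K) - 1 / 2 < s.im ∧ s.im < sSup (Complex.im '' K) + 1 / 2)}
  is_open' := by
    have h1 := Complex.continuous_re
    have h2 := Complex.continuous_im
    exact ((isOpen_lt continuous_const h1).inter (isOpen_lt h1 continuous_const)).inter
      ((isOpen_lt continuous_const h2).inter (isOpen_lt h2 continuous_const))

theorem rectangle_subset_strip {K : Set ℂ} (hK : IsCompact K) (hne : K.Nonempty)
    (hs : K ⊆ strip) : (rectangle K : Set ℂ) ⊆ strip := by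
  have hc : IsCompact (Complex.re '' K) := hK.image Complex.continuous_re
  have hn : (Complex.re '' K).Nonempty := hne.image _
  obtain ⟨a, ha, ha'⟩ := hc.sInf_mem hn
  obtain ⟨b, hb, hb'⟩ := hc.sSup_mem hn
  have h1 := (hs ha).1
  have h2 := (hs hb).2
  rintro s ⟨⟨h3, h4⟩, -⟩
  simp only [sigma0, sigma1, sigma2] at h3 h4
  rw [← ha'] at h3
  rw [← hb'] at h4
  exact ⟨by linarith, by linarith⟩

/-! ### The space of holomorphic functions -/

/-- The holomorphic functions on an open set `U`, as a subspace of the space `C(U, ℂ)` with the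
topology of compact convergence. -/
abbrev Hol (U : TopologicalSpace.Opens ℂ) : Type :=
  {f : C(U, ℂ) // ∃ g : ℂ → ℂ, DifferentiableOn ℂ g U ∧ ∀ s : U, f s = g s}

/-- The restriction to `U` of a function that is holomorphic on `U`. -/
def Hol.of {U : TopologicalSpace.Opens ℂ} (g : ℂ → ℂ) (hg : DifferentiableOn ℂ g U) : Hol U :=
  ⟨⟨fun s => g s, hg.continuousOn.domRestrict⟩, g, hg, fun _ => rfl⟩

instance (U : TopologicalSpace.Opens ℂ) : Inhabited (Hol U) :=
  ⟨Hol.of (fun _ => 0) (differentiableOn_const 0)⟩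

instance (U : TopologicalSpace.Opens ℂ) : LocallyCompactSpace U :=
  U.isOpen.locallyCompactSpace

instance (U : TopologicalSpace.Opens ℂ) : MeasurableSpace (Hol U) := borel _

instance (U : TopologicalSpace.Opens ℂ) : BorelSpace (Hol U) := ⟨rfl⟩

instance (U : TopologicalSpace.Opens ℂ) : SecondCountableTopology (Hol U) :=
  Topology.IsInducing.subtypeVal.secondCountableTopology

/-- The product σ-algebra on the tuples of holomorphic functions is the Borel σ-algebra. -/
theorem borelSpace_hol_pi (r : ℕ) (U : TopologicalSpace.Opens ℂ) : BorelSpace (Fin r → Hol U) :=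
  inferInstance

/-! ### The distribution of the shifted zeta-functions -/

/-- The function `s ↦ ζ(s + i t)` on `U`. -/
def shiftedZeta (U : TopologicalSpace.Opens ℂ) (hU : (U : Set ℂ) ⊆ strip) (t : ℝ) : Hol U :=
  Hol.of (fun s => riemannZeta (s + Complex.I * t)) (by
    intro s hs
    have h1 : s + Complex.I * t ≠ 1 := by
      intro h
      have h2 := congrArg Complex.re h
      have h3 := (hU hs).2
      simp at h2
      linarith
    have h4 : DifferentiableAt ℂ (fun z : ℂ => z + Complex.I * t) s := by fun_prop
    exact (DifferentiableAt.comp s (differentiableAt_riemannZeta h1) h4).differentiableWithinAt)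

/-- The measure `A ↦ (1 / T) meas {τ ∈ [T, 2T] : (ζ(s + i γ₁(τ)), …, ζ(s + i γᵣ(τ))) ∈ A}`. -/
def shiftedLaw {r : ℕ} (U : TopologicalSpace.Opens ℂ) (hU : (U : Set ℂ) ⊆ strip)
    (γ : Fin r → ℝ → ℝ) (T : ℝ) : Measure (Fin r → Hol U) :=
  (ENNReal.ofReal T)⁻¹ •
    (volume.restrict (Set.Icc T (2 * T))).map (fun τ j => shiftedZeta U hU (γ j τ))

/-! ### The random Euler products -/

/-- The infinite torus, with one circle for every prime. -/
abbrev Torus : Type := Nat.Primes → Circle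

instance : MeasurableSpace Circle := borel _

instance : BorelSpace Circle := ⟨rfl⟩

/-- The probability Haar measure on the product of `r` copies of the infinite torus. -/
def haar (r : ℕ) : Measure (Fin r → Torus) := Measure.haarMeasure ⊤

instance (r : ℕ) : IsProbabilityMeasure (haar r) :=
  ⟨by simpa [haar] using Measure.haarMeasure_self (K₀ := (⊤ : TopologicalSpace.PositiveCompacts
    (Fin r → Torus)))⟩

/-- The finite Euler product over the primes `p < N` of `(1 - ω(p) / p ^ s)⁻¹`. -/
def eulerFun (ω : Torus) (N : ℕ) (s : ℂ) : ℂ :=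
  ∏ n ∈ Finset.range N,
    if h : n.Prime then (1 - (ω ⟨n, h⟩ : ℂ) / (n : ℂ) ^ s)⁻¹ else 1

theorem euler_factor_ne_zero (z : Circle) {n : ℕ} (hn : n.Prime) {s : ℂ} (hs : 0 < s.re) :
    1 - (z : ℂ) / (n : ℂ) ^ s ≠ 0 := by
  intro h
  have h1 : ‖(z : ℂ) / (n : ℂ) ^ s‖ = 1 := by rw [← sub_eq_zero.1 h]; simp
  have h2 : (1 : ℝ) < (n : ℝ) ^ s.re :=
    Real.one_lt_rpow (by exact_mod_cast hn.one_lt) hs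
  rw [norm_div, Circle.norm_coe, Complex.norm_natCast_cpow_of_pos hn.pos] at h1
  rw [div_eq_one_iff_eq (by linarith)] at h1
  linarith

/-- The finite Euler product, as a holomorphic function on `U`. -/
def euler (U : TopologicalSpace.Opens ℂ) (hU : (U : Set ℂ) ⊆ strip) (ω : Torus) (N : ℕ) : Hol U :=
  Hol.of (eulerFun ω N) (by
    unfold eulerFun
    refine DifferentiableOn.fun_finsetProd fun n _ => ?_
    by_cases h : n.Prime
    · simp only [h, dif_pos]
      have h0 : (n : ℂ) ≠ 0 := by exact_mod_cast h.ne_zero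
      refine DifferentiableOn.inv (fun s hs => ?_) fun s hs =>
        euler_factor_ne_zero _ h (by have := (hU hs).1; linarith)
      have h1 : DifferentiableAt ℂ (fun z : ℂ => (n : ℂ) ^ z) s :=
        differentiableAt_id.const_cpow (Or.inl h0)
      exact (((differentiableAt_const _).div h1 (by simp [Complex.cpow_eq_zero_iff, h0])).const_sub
        1).differentiableWithinAt
    · simp only [h, dif_neg, not_false_iff]
      exact differentiableOn_const 1)

/-- The random Euler product `ζ(s, ω) = ∏ₚ (1 - ω(p) / p ^ s)⁻¹`: the limit of the finite Euler
products, uniformly on compact subsets of `U`. Where this limit does not exist, the value is some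
unspecified element. -/
def randomZeta (U : TopologicalSpace.Opens ℂ) (hU : (U : Set ℂ) ⊆ strip) (ω : Torus) : Hol U :=
  limUnder atTop (euler U hU ω)

/-- The distribution of `(ζ(s, ω₁), …, ζ(s, ωᵣ))` under the Haar measure. -/
def randomLaw (r : ℕ) (U : TopologicalSpace.Opens ℂ) (hU : (U : Set ℂ) ⊆ strip) :
    Measure (Fin r → Hol U) :=
  (haar r).map (fun ω j => randomZeta U hU (ω j))

end JointZeta

end

/-! Cut off at the primes `p < M`, the Euler product of `ζ(s + iγ_j(τ))` is a continuous function of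
the point `(p^(-iγ_j(τ)))` of the product of tori, and the same function at a Haar-random point is
the truncated random product. The theorem therefore rests on three facts: the curve `orbit γ` is
equidistributed, truncation costs little on average over `τ`, and the random products converge
almost surely.

Equidistribution (`tendsto_mean_orbit`) is Weyl's criterion. Along the curve a nontrivial character
is `exp(i ∑ c_j γ_j(τ))`, where `c ≠ 0` because the logarithms of the primes are linearly
independent over the integers. Admissibility is then what the first derivative test
`norm_integral_cexp_le` asks for: the integral over `[T, 2T]` stays bounded, so its mean tends to
`0`.

Truncation (`exists_integral_norm_sq_zetaDiff_le`) works in mean square on vertical lines to the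
right of `1/2`. Up to terms of smaller order, `ζ` minus the truncated product is a Dirichlet
polynomial over integers `n ≥ M`, with mean square of order `∑_{n ≥ M} n^(-2σ)`; a Gaussian weight
and Schur's test prove this. Since `γ'` is increasing and at least `αγ`,
`ShiftBounds.integral_comp_le` carries the estimate from heights `t` to heights `γ(τ)`. Cauchy's
formula on finitely many circles makes it uniform on compact sets.

On the random side the coordinates of a Haar point are independent, so the partial sums of `∑ ω(p)
p^(-β)` form an `L²`-bounded martingale for each `β > 1/2`. Summation by parts spreads convergence
at `β` over the half-plane to its right, locally uniformly, and exponentiation gives the Euler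
products.

In `tendsto_mean_shiftedZeta` the parameter `M` is fixed first, good for all large `T`, and then `T
→ ∞`. Lipschitz test functions suffice for weak convergence. -/

noncomputable section

namespace JointZeta

/-! ### The Riemann zeta-function to the right of the imaginary axis -/

/-- The tail integral in the approximation of `ζ` by partial sums of its Dirichlet series. -/
def zetaTail (N : ℕ) (s : ℂ) : ℂ :=
  ∫ v in Set.Ioi (N : ℝ), (((⌊v⌋₊ : ℝ) + 1 - v : ℝ) : ℂ) * (v : ℂ) ^ (-(s + 1))

theorem measurable_floor_add_one_sub : Measurable fun v : ℝ => (⌊v⌋₊ : ℝ) + 1 - v :=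
  ((measurable_from_nat.comp Nat.measurable_floor).add_const 1).sub measurable_id

theorem abs_floor_add_one_sub_le {v : ℝ} (hv : 0 ≤ v) : |(⌊v⌋₊ : ℝ) + 1 - v| ≤ 1 := by
  rw [abs_le]
  have h1 := Nat.floor_le hv
  have h2 := Nat.lt_floor_add_one v
  constructor <;> linarith

theorem integrableOn_zetaTail {a : ℝ} (ha : 0 < a) {s : ℂ} (hs : 0 < s.re) :
    IntegrableOn (fun v : ℝ => (((⌊v⌋₊ : ℝ) + 1 - v : ℝ) : ℂ) * (v : ℂ) ^ (-(s + 1)))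
      (Set.Ioi a) := by
  have h1 : IntegrableOn (fun v : ℝ => (v : ℂ) ^ (-(s + 1))) (Set.Ioi a) :=
    integrableOn_Ioi_cpow_of_lt (by simp [hs]) ha
  refine Integrable.bdd_mul (c := 1) h1
    (Complex.measurable_ofReal.comp measurable_floor_add_one_sub).aestronglyMeasurable ?_
  filter_upwards [ae_restrict_mem measurableSet_Ioi] with v hv
  rw [Complex.norm_real, Real.norm_eq_abs]
  exact abs_floor_add_one_sub_le (ha.trans hv).le

/-- Abel summation gives `ζ(s) = s ∫ ⌊v⌋ v^(-s-1) dv`; write `⌊v⌋ = (⌊v⌋ + 1 - v) + v - 1` and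
integrate the two powers explicitly. -/
theorem riemannZeta_eq_of_one_lt_re {s : ℂ} (hs : 1 < s.re) :
    riemannZeta s = 1 / (s - 1) + s * zetaTail 1 s := by
  have h0 : 0 < s.re := by linarith
  have hs0 : s ≠ 0 := fun h => by simp [h] at h0
  have hs1 : s - 1 ≠ 0 := fun h => by
    have := congrArg Complex.re h
    simp at this; linarith
  have h1 := LSeries_eq_mul_integral 1 zero_le_one (s := s) hs
    (by rwa [LSeriesSummable_one_iff]) (by
      simp only [Pi.one_apply, Finset.sum_const, Nat.card_Icc, Nat.add_sub_cancel, nsmul_eq_mul,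
        mul_one, Real.rpow_one]
      exact Asymptotics.isBigO_of_le _ fun n => by simp)
  rw [LSeries_one_eq_riemannZeta hs] at h1
  have i1 : IntegrableOn (fun v : ℝ => (v : ℂ) ^ (-s)) (Set.Ioi 1) :=
    integrableOn_Ioi_cpow_of_lt (by simpa using hs) one_pos
  have i2 : IntegrableOn (fun v : ℝ => (v : ℂ) ^ (-(s + 1))) (Set.Ioi 1) :=
    integrableOn_Ioi_cpow_of_lt (by simpa using h0) one_pos
  have h2 : ∫ t in Set.Ioi (1 : ℝ), (∑ k ∈ Finset.Icc 1 ⌊t⌋₊, (1 : ℕ → ℂ) k) * (t : ℂ) ^ (-(s + 1))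
      = zetaTail 1 s + ((∫ v in Set.Ioi (1 : ℝ), (v : ℂ) ^ (-s)) -
        ∫ v in Set.Ioi (1 : ℝ), (v : ℂ) ^ (-(s + 1))) := by
    have h3 := integral_add (integrableOn_zetaTail one_pos h0) (i1.sub i2)
    simp only [Pi.sub_apply] at h3
    rw [← integral_sub i1 i2, zetaTail, Nat.cast_one, ← h3]
    refine setIntegral_congr_fun measurableSet_Ioi fun v (hv : 1 < v) => ?_
    have hv0 : (v : ℂ) ≠ 0 := by exact_mod_cast (by linarith : v ≠ 0)
    have h3 : (v : ℂ) ^ (-s) = v * (v : ℂ) ^ (-(s + 1)) := by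
      rw [show -s = -(s + 1) + 1 by ring, Complex.cpow_add _ _ hv0, Complex.cpow_one, mul_comm]
    simp only [Pi.one_apply, Finset.sum_const, Nat.card_Icc, Nat.add_sub_cancel, nsmul_eq_mul,
      mul_one, Complex.ofReal_sub, Complex.ofReal_add, Complex.ofReal_natCast, Complex.ofReal_one]
    rw [h3]
    ring
  rw [h1, h2, integral_Ioi_cpow_of_lt (by simpa using hs) one_pos,
    integral_Ioi_cpow_of_lt (by simpa using h0) one_pos]
  simp only [Complex.ofReal_one, Complex.one_cpow]
  have e1 : -s + 1 = -(s - 1) := by ring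
  have e2 : -(s + 1) + 1 = -s := by ring
  rw [e1, e2]
  field_simp
  ring

/-- The tail integral is the Mellin transform, at `-s`, of a bounded function supported in `(1, ∞)`.
-/
theorem differentiableAt_zetaTail_one {s : ℂ} (hs : 0 < s.re) :
    DifferentiableAt ℂ (zetaTail 1) s := by
  set f : ℝ → ℂ := (Set.Ioi (1 : ℝ)).indicator fun v => (((⌊v⌋₊ : ℝ) + 1 - v : ℝ) : ℂ) with hf
  have hmeas : Measurable f :=
    (Complex.measurable_ofReal.comp measurable_floor_add_one_sub).indicator measurableSet_Ioi
  have hb : ∀ v, ‖f v‖ ≤ 1 := by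
    intro v
    by_cases hv : v ∈ Set.Ioi (1 : ℝ)
    · rw [hf, Set.indicator_of_mem hv, Complex.norm_real, Real.norm_eq_abs]
      exact abs_floor_add_one_sub_le (zero_le_one.trans (le_of_lt hv))
    · rw [hf, Set.indicator_of_notMem hv]; simp
  have h1 : zetaTail 1 = fun z => mellin f (-z) := by
    funext z
    rw [zetaTail, mellin, hf, Nat.cast_one]
    have : (fun t : ℝ => (t : ℂ) ^ (-z - 1) • (Set.Ioi (1 : ℝ)).indicator
        (fun v => (((⌊v⌋₊ : ℝ) + 1 - v : ℝ) : ℂ)) t) = (Set.Ioi (1 : ℝ)).indicator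
        (fun v : ℝ => (((⌊v⌋₊ : ℝ) + 1 - v : ℝ) : ℂ) * (v : ℂ) ^ (-(z + 1))) := by
      funext t
      by_cases ht : t ∈ Set.Ioi (1 : ℝ)
      · rw [Set.indicator_of_mem ht, Set.indicator_of_mem ht, smul_eq_mul, mul_comm]
        congr 2; ring
      · rw [Set.indicator_of_notMem ht, Set.indicator_of_notMem ht, smul_zero]
    rw [this, setIntegral_indicator measurableSet_Ioi]
    congr 2
    ext t; simp
  rw [h1]
  have h2 : DifferentiableAt ℂ (mellin f) (-s) := by
    -- Exponent `a = 0` expresses boundedness at infinity. The function vanishes near `0`, so any `b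
    -- < -Re s` would do.
    refine mellin_differentiableAt_of_isBigO_rpow (a := 0) (b := -s.re - 1) ?_ ?_ ?_ ?_ ?_
    · intro x _
      refine ⟨Set.Icc (x - 1) (x + 1) ∩ Set.Ioi 0, ?_, ?_⟩
      · rw [Set.inter_comm]
        exact inter_mem self_mem_nhdsWithin
          (mem_nhdsWithin_of_mem_nhds (Icc_mem_nhds (by linarith) (by linarith)))
      · refine Measure.integrableOn_of_bounded (M := 1) ?_ hmeas.aestronglyMeasurable
          (Eventually.of_forall hb)
        exact ((measure_mono Set.inter_subset_left).trans_lt measure_Icc_lt_top).ne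
    · refine Asymptotics.IsBigO.of_bound 1 (Eventually.of_forall fun v => ?_)
      simpa using hb v
    · simpa using hs
    · refine Asymptotics.IsBigO.of_bound 1 ?_
      filter_upwards [mem_nhdsWithin_of_mem_nhds (Iio_mem_nhds one_pos)] with v hv
      rw [hf, Set.indicator_of_notMem (by simpa using le_of_lt hv)]
      simp
    · simp
  exact DifferentiableAt.comp (g := mellin f) s h2 differentiableAt_id.neg

/-- Analytic continuation from `Re s > 1`: after multiplication by `s - 1` both sides are
holomorphic on `Re s > 0`, the left one having its residue as value at `1`. -/
theorem riemannZeta_eq_zetaTail_one {s : ℂ} (hs : 0 < s.re) (hs1 : s ≠ 1) :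
    riemannZeta s = 1 / (s - 1) + s * zetaTail 1 s := by
  set F : ℂ → ℂ := Function.update (fun s ↦ (s - 1) * riemannZeta s) 1 1 with hF
  have hFd : Differentiable ℂ F := by
    rw [← differentiableOn_univ,
      ← Complex.differentiableOn_compl_singleton_and_continuousAt_iff (c := 1) Filter.univ_mem]
    constructor
    · intro z hz
      have hz1 : z ≠ 1 := hz.2
      have h1 : DifferentiableAt ℂ (fun s ↦ (s - 1) * riemannZeta s) z :=
        (differentiableAt_id.sub_const 1).mul (differentiableAt_riemannZeta hz1)
      refine (h1.congr_of_eventuallyEq ?_).differentiableWithinAt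
      filter_upwards [isOpen_ne.mem_nhds hz1] with w hw
      rw [hF, Function.update_of_ne hw]
    · simpa only [hF, continuousAt_update_same] using riemannZeta_residue_one
  have hd : DifferentiableOn ℂ (fun s => 1 + (s - 1) * (s * zetaTail 1 s)) {s | 0 < s.re} :=
    fun z hz => (((differentiableAt_id.sub_const 1).mul
      (differentiableAt_id.mul (differentiableAt_zetaTail_one hz))).const_add 1).differentiableWithinAt
  have hopen : IsOpen {s : ℂ | 0 < s.re} := isOpen_lt continuous_const Complex.continuous_re
  have hpre : IsPreconnected {s : ℂ | 0 < s.re} := (convex_halfSpace_re_gt 0).isPreconnected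
  have key := (hFd.differentiableOn.analyticOnNhd hopen).eqOn_of_preconnected_of_eventuallyEq
    (hd.analyticOnNhd hopen) hpre (z₀ := 2) (by simp) (by
      have h2 : {s : ℂ | 1 < s.re} ∈ 𝓝 (2 : ℂ) :=
        (isOpen_lt continuous_const Complex.continuous_re).mem_nhds (by simp)
      filter_upwards [h2] with z (hz : 1 < z.re)
      have hz1 : z ≠ 1 := fun h => by simp [h] at hz
      have := sub_ne_zero.2 hz1
      rw [hF, Function.update_of_ne hz1, riemannZeta_eq_of_one_lt_re hz]
      field_simp) hs
  have h3 := sub_ne_zero.2 hs1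
  simp only [hF, Function.update_of_ne hs1] at key
  field_simp
  rw [mul_comm, key]
  ring

theorem hasDerivAt_ofReal_cpow {v : ℝ} (hv : 0 < v) (z : ℂ) :
    HasDerivAt (fun v : ℝ => (v : ℂ) ^ z) (z * (v : ℂ) ^ (z - 1)) v := by
  have := (HasDerivAt.cpow_const (c := z) (hasDerivAt_id (v : ℂ))
    (Complex.ofReal_mem_slitPlane.2 hv)).comp_ofReal
  simpa using this

/-- Between `N` and `N + 1` the kernel is the linear function `N + 1 - v`, so this piece of the tail
has an elementary primitive. This is the induction step for the approximation by partial sums. -/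
theorem zetaTail_step {N : ℕ} (hN : 1 ≤ N) {s : ℂ} (hs : 0 < s.re) (hs1 : s ≠ 1) :
    (N : ℂ) ^ (1 - s) / (s - 1) + s * zetaTail N s =
      (N : ℂ) ^ (-s) + ((N + 1 : ℕ) : ℂ) ^ (1 - s) / (s - 1) + s * zetaTail (N + 1) s := by
  have hN0 : (0 : ℝ) < N := by exact_mod_cast hN
  have hs0 : s ≠ 0 := fun h => by simp [h] at hs
  have hs1' := sub_ne_zero.2 hs1
  have h1s : 1 - s ≠ 0 := sub_ne_zero.2 hs1.symm
  have h1 : zetaTail N s = (∫ v in (N : ℝ)..(N + 1 : ℕ), ((((N : ℝ) + 1 - v : ℝ)) : ℂ) *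
      (v : ℂ) ^ (-(s + 1))) + zetaTail (N + 1) s := by
    have hle : (N : ℝ) ≤ ((N + 1 : ℕ) : ℝ) := by push_cast; linarith
    rw [zetaTail, zetaTail, ← Set.Ioc_union_Ioi_eq_Ioi hle,
      setIntegral_union (Set.Ioc_disjoint_Ioi le_rfl) measurableSet_Ioi
        ((integrableOn_zetaTail hN0 hs).mono_set Set.Ioc_subset_Ioi_self)
        ((integrableOn_zetaTail hN0 hs).mono_set (Set.Ioi_subset_Ioi hle)),
      intervalIntegral.integral_of_le hle, integral_Ioc_eq_integral_Ioo,
      integral_Ioc_eq_integral_Ioo]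
    congr 1
    refine setIntegral_congr_fun measurableSet_Ioo fun v hv => ?_
    have : ⌊v⌋₊ = N := (Nat.floor_eq_iff (hN0.trans hv.1).le).2 ⟨hv.1.le, by simpa using hv.2⟩
    simp only [this]
  have h2 : ∫ v in (N : ℝ)..(N + 1 : ℕ), ((((N : ℝ) + 1 - v : ℝ)) : ℂ) * (v : ℂ) ^ (-(s + 1)) =
      (-((N : ℂ) + 1) * ((N + 1 : ℕ) : ℂ) ^ (-s) / s - ((N + 1 : ℕ) : ℂ) ^ (1 - s) / (1 - s)) -
      (-((N : ℂ) + 1) * (N : ℂ) ^ (-s) / s - (N : ℂ) ^ (1 - s) / (1 - s)) := by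
    have hle : (N : ℝ) ≤ ((N + 1 : ℕ) : ℝ) := by push_cast; linarith
    have := intervalIntegral.integral_eq_sub_of_hasDerivAt
      (f := fun v : ℝ => -((N : ℂ) + 1) * (v : ℂ) ^ (-s) / s - (v : ℂ) ^ (1 - s) / (1 - s))
      (f' := fun v : ℝ => ((((N : ℝ) + 1 - v : ℝ)) : ℂ) * (v : ℂ) ^ (-(s + 1)))
      (a := (N : ℝ)) (b := ((N + 1 : ℕ) : ℝ)) ?_ ?_
    · rw [this]; norm_cast
    · intro v hv
      rw [Set.uIcc_of_le hle] at hv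
      have hv0 : 0 < v := hN0.trans_le hv.1
      have hvc : (v : ℂ) ≠ 0 := by exact_mod_cast hv0.ne'
      have d1 : HasDerivAt (fun v : ℝ => (v : ℂ) ^ (-s)) (-s * (v : ℂ) ^ (-s - 1)) v :=
        hasDerivAt_ofReal_cpow hv0 _
      have d2 : HasDerivAt (fun v : ℝ => (v : ℂ) ^ (1 - s)) ((1 - s) * (v : ℂ) ^ (1 - s - 1)) v :=
        hasDerivAt_ofReal_cpow hv0 _
      refine (((d1.const_mul (-((N : ℂ) + 1))).div_const s).sub (d2.div_const (1 - s))).congr_deriv ?_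
      have e1 : (v : ℂ) ^ (1 - s - 1) = v * (v : ℂ) ^ (-(s + 1)) := by
        rw [show 1 - s - 1 = -(s + 1) + 1 by ring, Complex.cpow_add _ _ hvc, Complex.cpow_one,
          mul_comm]
      rw [e1, show -s - 1 = -(s + 1) by ring]
      push_cast
      field_simp
    · refine ContinuousOn.intervalIntegrable fun v hv => ?_
      rw [Set.uIcc_of_le hle] at hv
      have hv0 : 0 < v := hN0.trans_le hv.1
      refine ContinuousAt.continuousWithinAt (ContinuousAt.mul (by fun_prop) ?_)
      exact (Complex.continuousAt_ofReal_cpow_const _ _ (Or.inr hv0.ne'))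
  have e3 : (N : ℂ) ^ (1 - s) = N * (N : ℂ) ^ (-s) := by
    rw [show 1 - s = -s + 1 by ring, Complex.cpow_add _ _ (by exact_mod_cast hN0.ne'),
      Complex.cpow_one, mul_comm]
  have e4 : ((N + 1 : ℕ) : ℂ) ^ (1 - s) = (N + 1) * ((N + 1 : ℕ) : ℂ) ^ (-s) := by
    rw [show 1 - s = -s + 1 by ring, Complex.cpow_add _ _ (by exact_mod_cast N.succ_ne_zero),
      Complex.cpow_one, mul_comm]
    push_cast; ring
  rw [h1, h2, e3, e4, show 1 - s = -(s - 1) by ring]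
  field_simp
  ring

/-- Approximation of `ζ` by partial sums of its Dirichlet series, for `Re s > 0`. -/
theorem riemannZeta_eq_sum_add {N : ℕ} (hN : 1 ≤ N) {s : ℂ} (hs : 0 < s.re) (hs1 : s ≠ 1) :
    riemannZeta s = ∑ n ∈ Finset.Ico 1 N, (n : ℂ) ^ (-s) +
      ((N : ℂ) ^ (1 - s) / (s - 1) + s * zetaTail N s) := by
  induction N, hN using Nat.le_induction with
  | base => simp [riemannZeta_eq_zetaTail_one hs hs1]
  | succ N hN ih =>
    rw [ih, zetaTail_step hN hs hs1, Finset.sum_Ico_succ_top hN]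
    ring

/-! ### Mean squares of exponential sums and integrals -/

theorem integral_gaussian_mul_cexp {V : ℝ} (hV : 0 < V) (u : ℝ) :
    ∫ t : ℝ, (Real.exp (-t ^ 2 / V ^ 2) : ℂ) * Complex.exp (Complex.I * u * t) =
      ((V * √Real.pi * Real.exp (-V ^ 2 * u ^ 2 / 4) : ℝ) : ℂ) := by
  have h := fourierIntegral_gaussian (b := ((1 / V ^ 2 : ℝ) : ℂ))
    (by rw [Complex.ofReal_re]; positivity) u
  have hV2 : (V : ℂ) ≠ 0 := by exact_mod_cast hV.ne'
  have e1 : ((Real.pi : ℂ) / ((1 / V ^ 2 : ℝ) : ℂ)) ^ (1 / 2 : ℂ) = ((V * √Real.pi : ℝ) : ℂ) := by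
    rw [show ((Real.pi : ℂ) / ((1 / V ^ 2 : ℝ) : ℂ)) = ((V ^ 2 * Real.pi : ℝ) : ℂ) by
      push_cast; field_simp, show (1 / 2 : ℂ) = ((1 / 2 : ℝ) : ℂ) by push_cast; rfl,
      ← Complex.ofReal_cpow (by positivity), ← Real.sqrt_eq_rpow, Real.sqrt_mul (by positivity),
      Real.sqrt_sq hV.le]
  rw [e1] at h
  rw [Complex.ofReal_mul, Complex.ofReal_exp]
  convert h using 2
  · funext t
    rw [mul_comm, Complex.ofReal_exp]
    congr 2
    push_cast
    field_simp
  · congr 1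
    push_cast
    field_simp

section MeanSquare

variable {α : Type*} [MeasurableSpace α] {μ : Measure α}

theorem continuous_integral_mul_cexp {a : α → ℂ} {l : α → ℝ} (ha : Integrable a μ)
    (hl : Measurable l) :
    Continuous fun t : ℝ => ∫ x, a x * Complex.exp (-(Complex.I * t * l x)) ∂μ := by
  refine continuous_of_dominated (bound := fun x => ‖a x‖) (fun t => ?_) (fun t => ?_) ha.norm ?_
  · exact ha.aestronglyMeasurable.mul (by fun_prop)
  · refine Eventually.of_forall fun x => ?_
    rw [norm_mul, Complex.norm_exp]
    simp
  · refine Eventually.of_forall fun x => ?_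
    fun_prop

theorem two_mul_mul_le_add_sq (x y : ENNReal) : 2 * (x * y) ≤ x ^ 2 + y ^ 2 := by
  rcases eq_or_ne x ⊤ with rfl | hx
  · simp
  rcases eq_or_ne y ⊤ with rfl | hy
  · simp
  lift x to NNReal using hx
  lift y to NNReal using hy
  rw [← mul_assoc]
  exact_mod_cast two_mul_le_add_sq x y

/-- Schur's test for a symmetric kernel: bound `a(x)a(y)` by half the sum of the squares, and
integrate out the other variable in each half. -/
theorem lintegral_mul_kernel_le [SFinite μ] {a : α → ENNReal} (ha : AEMeasurable a μ) {k : α → α → ENNReal}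
    (hk : Measurable fun z : α × α => k z.1 z.2) (hsymm : ∀ x y, k x y = k y x) {B : ENNReal}
    (hB : ∀ x, ∫⁻ y, k x y ∂μ ≤ B) :
    ∫⁻ z, a z.1 * a z.2 * k z.1 z.2 ∂(μ.prod μ) ≤ B * ∫⁻ x, a x ^ 2 ∂μ := by
  have m1 : AEMeasurable (fun z : α × α => a z.1 ^ 2 * k z.1 z.2) (μ.prod μ) :=
    ((ha.comp_fst).pow_const 2).mul hk.aemeasurable
  have i1 : ∫⁻ z, a z.1 ^ 2 * k z.1 z.2 ∂(μ.prod μ) ≤ B * ∫⁻ x, a x ^ 2 ∂μ := by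
    rw [lintegral_prod _ m1, ← lintegral_const_mul'' B (ha.pow_const 2)]
    refine lintegral_mono fun x => ?_
    dsimp only
    have hkx : Measurable (k x) := hk.comp measurable_prodMk_left
    rw [lintegral_const_mul _ hkx, mul_comm]
    gcongr
    exact hB x
  have i2 : ∫⁻ z, a z.2 ^ 2 * k z.1 z.2 ∂(μ.prod μ) ≤ B * ∫⁻ x, a x ^ 2 ∂μ := by
    rw [← lintegral_prod_swap]
    simpa only [Prod.fst_swap, Prod.snd_swap, hsymm] using i1
  have i3 : ∀ z : α × α, a z.1 * a z.2 * k z.1 z.2 ≤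
      2⁻¹ * (a z.1 ^ 2 * k z.1 z.2 + a z.2 ^ 2 * k z.1 z.2) := by
    intro z
    rw [← add_mul, ← mul_assoc]
    refine mul_le_mul_left ?_ _
    have h2 := two_mul_mul_le_add_sq (a z.1) (a z.2)
    calc a z.1 * a z.2 = 2⁻¹ * (2 * (a z.1 * a z.2)) := by
          rw [← mul_assoc, ENNReal.inv_mul_cancel (by simp) (by simp), one_mul]
      _ ≤ _ := by gcongr
  calc ∫⁻ z, a z.1 * a z.2 * k z.1 z.2 ∂(μ.prod μ)
      ≤ ∫⁻ z, 2⁻¹ * (a z.1 ^ 2 * k z.1 z.2 + a z.2 ^ 2 * k z.1 z.2) ∂(μ.prod μ) :=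
        lintegral_mono i3
    _ = 2⁻¹ * (∫⁻ z, a z.1 ^ 2 * k z.1 z.2 ∂(μ.prod μ) +
        ∫⁻ z, a z.2 ^ 2 * k z.1 z.2 ∂(μ.prod μ)) := by
        rw [lintegral_const_mul' _ _ (by simp), lintegral_add_left' m1]
    _ ≤ 2⁻¹ * (B * ∫⁻ x, a x ^ 2 ∂μ + B * ∫⁻ x, a x ^ 2 ∂μ) := by gcongr
    _ = B * ∫⁻ x, a x ^ 2 ∂μ := by
        rw [← two_mul, ← mul_assoc, ENNReal.inv_mul_cancel (by simp) (by simp), one_mul]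

/-- Opening the square and integrating in `t` first produces the Fourier transform of the Gaussian,
a positive kernel concentrated where `l x` and `l y` are within about `1 / V`; Schur's test
finishes. A general measure `μ` covers both Dirichlet polynomials and the tail integral. -/
theorem integral_gaussian_mul_norm_sq_le [SFinite μ] {a : α → ℂ} {l : α → ℝ} (ha : Integrable a μ)
    (ha2 : Integrable (fun x => ‖a x‖ ^ 2) μ) (hl : Measurable l) {V B : ℝ} (hV : 0 < V)
    (hB0 : 0 ≤ B)
    (hB : ∀ x, ∫⁻ y, ENNReal.ofReal (Real.exp (-V ^ 2 * (l x - l y) ^ 2 / 4)) ∂μ ≤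
      ENNReal.ofReal B) :
    ∫ t : ℝ, Real.exp (-t ^ 2 / V ^ 2) *
      ‖∫ x, a x * Complex.exp (-(Complex.I * t * l x)) ∂μ‖ ^ 2 ≤
      V * √Real.pi * B * ∫ x, ‖a x‖ ^ 2 ∂μ := by
  set g : ℝ → ℝ := fun t => Real.exp (-t ^ 2 / V ^ 2) with hg
  set A : ℝ → ℂ := fun t => ∫ x, a x * Complex.exp (-(Complex.I * t * l x)) ∂μ with hA
  have hgi : Integrable g := by
    have := integrable_exp_neg_mul_sq (b := 1 / V ^ 2) (by positivity)
    refine this.congr (Eventually.of_forall fun t => ?_)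
    simp only [hg]; congr 1; field_simp
  have hgn : ∀ t, 0 ≤ g t := fun t => (Real.exp_pos _).le
  set G : α × α → ℂ := fun z => a z.1 * (starRingEnd ℂ) (a z.2) with hG
  have haS : Integrable (fun x => (starRingEnd ℂ) (a x)) μ :=
    ha.congr' (by exact (Complex.continuous_conj.comp_aestronglyMeasurable ha.1))
      (Eventually.of_forall fun x => by simp) |>.congr (Eventually.of_forall fun x => rfl)
  have hGi : Integrable G (μ.prod μ) := ha.mul_prod haS
  set e : ℝ → α × α → ℂ := fun t z => Complex.exp (Complex.I * ((l z.2 - l z.1 : ℝ) : ℂ) * t)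
    with he
  have hsq : ∀ t, ((g t * ‖A t‖ ^ 2 : ℝ) : ℂ) = ∫ z, (g t : ℂ) * (G z * e t z) ∂(μ.prod μ) := by
    intro t
    rw [integral_const_mul, Complex.ofReal_mul, Complex.ofReal_pow, ← Complex.mul_conj']
    congr 1
    rw [hA]
    simp only
    rw [← integral_conj, ← integral_prod_mul]
    refine integral_congr_ae (Eventually.of_forall fun z => ?_)
    simp only [hG, he, map_mul]
    rw [← Complex.exp_conj, mul_mul_mul_comm, ← Complex.exp_add]
    congr 2
    simp
    ring
  have hswap : ∫ t, ((g t * ‖A t‖ ^ 2 : ℝ) : ℂ) = ∫ z, G z *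
      ((V * √Real.pi * Real.exp (-V ^ 2 * (l z.1 - l z.2) ^ 2 / 4) : ℝ) : ℂ) ∂(μ.prod μ) := by
    simp_rw [hsq]
    rw [integral_integral_swap]
    · refine integral_congr_ae (Eventually.of_forall fun z => ?_)
      simp only
      rw [show (l z.1 - l z.2) ^ 2 = (l z.2 - l z.1) ^ 2 by ring,
        ← integral_gaussian_mul_cexp hV, ← integral_const_mul]
      refine integral_congr_ae (Eventually.of_forall fun t => ?_)
      simp only [hg, he]
      ring
    · have h1 : Integrable (fun w : ℝ × (α × α) => (g w.1 : ℂ) * G w.2)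
          (volume.prod (μ.prod μ)) := hgi.ofReal.mul_prod hGi
      have h2 : Measurable fun w : ℝ × (α × α) => e w.1 w.2 := by
        simp only [he]
        fun_prop
      refine (h1.mul_bdd (c := 1) h2.aestronglyMeasurable
        (Eventually.of_forall fun w => ?_)).congr (Eventually.of_forall fun w => ?_)
      · simp only [he]
        rw [Complex.norm_exp]
        simp
      · simp only [Function.uncurry]
        ring
  have hint : ((∫ t, g t * ‖A t‖ ^ 2 : ℝ) : ℂ) = _ := (integral_complex_ofReal).symm.trans hswap
  have hnn : 0 ≤ ∫ t, g t * ‖A t‖ ^ 2 := integral_nonneg fun t => mul_nonneg (hgn t) (sq_nonneg _)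
  have hk : Measurable fun z : α × α =>
      ENNReal.ofReal (Real.exp (-V ^ 2 * (l z.1 - l z.2) ^ 2 / 4)) := by fun_prop
  have hfin : ENNReal.ofReal (∫ t, g t * ‖A t‖ ^ 2) ≤
      ENNReal.ofReal (V * √Real.pi * B * ∫ x, ‖a x‖ ^ 2 ∂μ) := by
    calc ENNReal.ofReal (∫ t, g t * ‖A t‖ ^ 2)
        = ‖((∫ t, g t * ‖A t‖ ^ 2 : ℝ) : ℂ)‖ₑ := by
          rw [← ofReal_norm, Complex.norm_real, Real.norm_of_nonneg hnn]
      _ ≤ ∫⁻ z, ‖G z * ((V * √Real.pi * Real.exp (-V ^ 2 * (l z.1 - l z.2) ^ 2 / 4) : ℝ) : ℂ)‖ₑ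
          ∂(μ.prod μ) := by rw [hint]; exact enorm_integral_le_lintegral_enorm _
      _ = ∫⁻ z, ENNReal.ofReal (V * √Real.pi) * (‖a z.1‖ₑ * ‖a z.2‖ₑ *
            ENNReal.ofReal (Real.exp (-V ^ 2 * (l z.1 - l z.2) ^ 2 / 4))) ∂(μ.prod μ) := by
          refine lintegral_congr fun z => ?_
          rw [enorm_mul, ← ofReal_norm (((_ : ℝ) : ℂ)), Complex.norm_real,
            Real.norm_of_nonneg (by positivity), ENNReal.ofReal_mul (by positivity)]
          simp only [hG, enorm_mul, RCLike.enorm_conj]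
          ring
      _ = ENNReal.ofReal (V * √Real.pi) * ∫⁻ z, ‖a z.1‖ₑ * ‖a z.2‖ₑ *
            ENNReal.ofReal (Real.exp (-V ^ 2 * (l z.1 - l z.2) ^ 2 / 4)) ∂(μ.prod μ) :=
          lintegral_const_mul' _ _ ENNReal.ofReal_ne_top
      _ ≤ ENNReal.ofReal (V * √Real.pi) * (ENNReal.ofReal B * ∫⁻ x, ‖a x‖ₑ ^ 2 ∂μ) := by
          gcongr
          exact lintegral_mul_kernel_le ha.1.enorm hk
            (fun x y => by rw [show (l x - l y) ^ 2 = (l y - l x) ^ 2 by ring]) hB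
      _ = ENNReal.ofReal (V * √Real.pi * B * ∫ x, ‖a x‖ ^ 2 ∂μ) := by
          rw [mul_assoc (V * √Real.pi), ENNReal.ofReal_mul (by positivity : 0 ≤ V * √Real.pi),
            ENNReal.ofReal_mul hB0,
            ofReal_integral_eq_lintegral_ofReal ha2 (Eventually.of_forall fun x => sq_nonneg _)]
          congr 3
          funext x
          rw [← ofReal_norm, ENNReal.ofReal_pow (norm_nonneg _)]
  exact (ENNReal.ofReal_le_ofReal_iff (by positivity)).1 hfin

/-- Mean-square estimate for `t ↦ ∫ a(x) e^{-i t l(x)} dμ(x)` on `[-V, V]`. -/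
theorem integral_norm_sq_le [SFinite μ] {a : α → ℂ} {l : α → ℝ} (ha : Integrable a μ)
    (ha2 : Integrable (fun x => ‖a x‖ ^ 2) μ) (hl : Measurable l) {V B : ℝ} (hV : 0 < V)
    (hB0 : 0 ≤ B)
    (hB : ∀ x, ∫⁻ y, ENNReal.ofReal (Real.exp (-V ^ 2 * (l x - l y) ^ 2 / 4)) ∂μ ≤
      ENNReal.ofReal B) :
    ∫ t in -V..V, ‖∫ x, a x * Complex.exp (-(Complex.I * t * l x)) ∂μ‖ ^ 2 ≤
      Real.exp 1 * (V * √Real.pi * B * ∫ x, ‖a x‖ ^ 2 ∂μ) := by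
  have hc := continuous_integral_mul_cexp ha hl
  set A : ℝ → ℂ := fun t => ∫ x, a x * Complex.exp (-(Complex.I * t * l x)) ∂μ with hA
  have hgi : Integrable fun t : ℝ => Real.exp (-t ^ 2 / V ^ 2) := by
    have := integrable_exp_neg_mul_sq (b := 1 / V ^ 2) (by positivity)
    refine this.congr (Eventually.of_forall fun t => ?_)
    simp only; congr 1; field_simp
  have hbd : ∀ t, ‖A t‖ ^ 2 ≤ (∫ x, ‖a x‖ ∂μ) ^ 2 := fun t => by
    gcongr
    refine (norm_integral_le_integral_norm _).trans (le_of_eq ?_)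
    congr 1; funext x
    rw [norm_mul, Complex.norm_exp]
    simp
  have hi : Integrable fun t : ℝ => Real.exp (-t ^ 2 / V ^ 2) * ‖A t‖ ^ 2 :=
    hgi.mul_bdd (c := (∫ x, ‖a x‖ ∂μ) ^ 2) (hc.norm.pow 2).aestronglyMeasurable
      (Eventually.of_forall fun t => by
        rw [Real.norm_of_nonneg (sq_nonneg _)]; exact hbd t)
  calc ∫ t in -V..V, ‖A t‖ ^ 2
      ≤ ∫ t in -V..V, Real.exp 1 * (Real.exp (-t ^ 2 / V ^ 2) * ‖A t‖ ^ 2) := by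
        refine intervalIntegral.integral_mono_on (by linarith)
          ((hc.norm.pow 2).intervalIntegrable _ _)
          ((hi.const_mul _).intervalIntegrable) fun t ht => ?_
        -- On `[-V, V]` the weight `exp(1 - t² / V²)` is at least `1`; this is the origin of the
        -- factor `e`.
        rw [← mul_assoc, ← Real.exp_add]
        refine le_mul_of_one_le_left (sq_nonneg _) (Real.one_le_exp ?_)
        have h1 : t ^ 2 ≤ V ^ 2 := sq_le_sq' ht.1 ht.2
        have h2 : t ^ 2 / V ^ 2 ≤ 1 := by rw [div_le_one (by positivity)]; exact h1
        rw [neg_div]; linarith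
    _ = Real.exp 1 * ∫ t in -V..V, Real.exp (-t ^ 2 / V ^ 2) * ‖A t‖ ^ 2 :=
        intervalIntegral.integral_const_mul _ _
    _ ≤ Real.exp 1 * ∫ t, Real.exp (-t ^ 2 / V ^ 2) * ‖A t‖ ^ 2 := by
        gcongr
        rw [intervalIntegral.integral_of_le (by linarith)]
        exact setIntegral_le_integral hi
          (Eventually.of_forall fun t => mul_nonneg (Real.exp_pos _).le (sq_nonneg _))
    _ ≤ _ := by
        gcongr
        exact integral_gaussian_mul_norm_sq_le ha ha2 hl hV hB0 hB

end MeanSquare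

/-! ### Mean squares of Dirichlet polynomials and of the tail integral -/

theorem summable_exp_neg_sq_div_four : Summable fun k : ℤ => Real.exp (-(k : ℝ) ^ 2 / 4) := by
  have h : Summable fun n : ℕ => Real.exp (-(n : ℝ) ^ 2 / 4) := by
    have h1 : Summable fun n : ℕ => Real.exp 1 * Real.exp (-(n : ℝ)) :=
      Real.summable_exp_neg_nat.mul_left _
    refine Summable.of_nonneg_of_le (fun n => (Real.exp_pos _).le) (fun n => ?_) h1
    rw [← Real.exp_add]
    refine Real.exp_le_exp.2 ?_
    -- The inequality `1 - n ≥ -n² / 4` is `(n - 2)² ≥ 0`.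
    nlinarith [sq_nonneg ((n : ℝ) - 2)]
  refine Summable.of_nat_of_neg ?_ ?_
  · simpa using h
  · simpa using h

/-- The logarithm has slope at least `1 / N` on `(0, N]`, so logarithms of distinct integers up to
`N` are at least `1 / N` apart. -/
theorem abs_sub_le_mul_abs_log_sub {N m n : ℕ} (hm : 1 ≤ m) (hn : 1 ≤ n) (hmN : m ≤ N)
    (hnN : n ≤ N) : |(m : ℝ) - n| ≤ N * |Real.log m - Real.log n| := by
  wlog h : n ≤ m generalizing m n
  · rw [abs_sub_comm, abs_sub_comm (Real.log m)]
    exact this hn hm hnN hmN (le_of_not_ge h)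
  have hm0 : (0 : ℝ) < m := by exact_mod_cast hm
  have hn0 : (0 : ℝ) < n := by exact_mod_cast hn
  have h' : (n : ℝ) ≤ m := by exact_mod_cast h
  have hN : (m : ℝ) ≤ N := by exact_mod_cast hmN
  have hl : Real.log n ≤ Real.log m := Real.log_le_log hn0 h'
  rw [abs_of_nonneg (by linarith), abs_of_nonneg (by linarith)]
  have h1 := Real.log_le_sub_one_of_pos (div_pos hn0 hm0)
  rw [Real.log_div hn0.ne' hm0.ne'] at h1
  have h2 : (m : ℝ) - n ≤ m * (Real.log m - Real.log n) := by
    have : (m : ℝ) * (Real.log n - Real.log m) ≤ m * ((n : ℝ) / m - 1) := by gcongr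
    rw [mul_sub (m : ℝ) ((n : ℝ) / m), mul_div_cancel₀ _ hm0.ne'] at this
    linarith
  exact h2.trans (by gcongr)

/-- The constant in the mean-square estimate for Dirichlet polynomials. -/
def meanSquareConst : ℝ :=
  Real.exp 1 * (√Real.pi * ∑' k : ℤ, Real.exp (-(k : ℝ) ^ 2 / 4))

theorem meanSquareConst_nonneg : 0 ≤ meanSquareConst :=
  mul_nonneg (Real.exp_pos _).le (mul_nonneg (Real.sqrt_nonneg _)
    (tsum_nonneg fun _ => (Real.exp_pos _).le))

/-- The choice `V = N` matches the spacing of the frequencies: the kernel is at most `exp(-(m - n)²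
/ 4)`, whose row sums are bounded independently of `N`. -/
theorem integral_norm_sq_dirichlet_le {N : ℕ} (hN : 1 ≤ N) (s : Finset ℕ)
    (hs : ∀ n ∈ s, 1 ≤ n ∧ n ≤ N) (c : ℕ → ℂ) :
    ∫ t in -(N : ℝ)..N, ‖∑ n ∈ s, c n * Complex.exp (-(Complex.I * t * Real.log n))‖ ^ 2 ≤
      meanSquareConst * (N * ∑ n ∈ s, ‖c n‖ ^ 2) := by
  have hN0 : (0 : ℝ) < N := by exact_mod_cast hN
  set B : ℝ := ∑' k : ℤ, Real.exp (-(k : ℝ) ^ 2 / 4) with hB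
  have hB0 : 0 ≤ B := tsum_nonneg fun _ => (Real.exp_pos _).le
  have := integral_norm_sq_le (μ := (Measure.count : Measure s)) (a := fun n => c n)
    (l := fun n => Real.log (n : ℕ)) Integrable.of_finite Integrable.of_finite
    (measurable_of_finite _) hN0 hB0 (fun x => by
      rw [lintegral_count, tsum_fintype, ← ENNReal.ofReal_sum_of_nonneg
        (fun _ _ => (Real.exp_pos _).le)]
      refine ENNReal.ofReal_le_ofReal ?_
      have hinj : Function.Injective fun y : s => ((x : ℕ) : ℤ) - ((y : ℕ) : ℤ) := by
        intro y z hyz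
        simp only at hyz
        exact Subtype.ext (by omega)
      have h1 : ∑ y : s, Real.exp (-((((x : ℕ) : ℤ) - ((y : ℕ) : ℤ) : ℤ) : ℝ) ^ 2 / 4) ≤ B := by
        rw [← tsum_fintype (L := .unconditional s)]
        exact (Summable.of_finite).tsum_le_tsum_of_inj (fun y : s => ((x : ℕ) : ℤ) - ((y : ℕ) : ℤ))
          hinj (fun _ _ => (Real.exp_pos _).le) (fun _ => le_rfl) summable_exp_neg_sq_div_four
      refine le_trans (Finset.sum_le_sum fun y _ => Real.exp_le_exp.2 ?_) h1
      have h2 := abs_sub_le_mul_abs_log_sub (hs x x.2).1 (hs y y.2).1 (hs x x.2).2 (hs y y.2).2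
      have h3 : ((x : ℕ) - (y : ℕ) : ℝ) ^ 2 ≤ (N * |Real.log (x : ℕ) - Real.log (y : ℕ)|) ^ 2 := by
        rw [← sq_abs ((x : ℕ) - (y : ℕ) : ℝ)]
        gcongr
      rw [mul_pow, sq_abs] at h3
      push_cast
      linarith)
  simp only [integral_count] at this
  simp only [meanSquareConst]
  rw [← Finset.sum_coe_sort s (fun n => ‖c n‖ ^ 2)]
  simp_rw [← Finset.sum_coe_sort s (fun n => c n * Complex.exp (-(Complex.I * _ * Real.log n)))]
  refine this.trans (le_of_eq ?_)
  ring

/-- The substitution `v = e^y` turns `v^(-it)` into `e^(-ity)`, so that the mean-square estimate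
applies with `l(y) = y`. -/
theorem zetaTail_eq_integral_exp {N : ℕ} (hN : 1 ≤ N) (s t : ℝ) :
    zetaTail N (s + Complex.I * t) = ∫ y in Set.Ioi (Real.log N),
      ((((⌊Real.exp y⌋₊ : ℝ) + 1 - Real.exp y) * Real.exp (-s * y) : ℝ) : ℂ) *
        Complex.exp (-(Complex.I * t * y)) := by
  have hN0 : (0 : ℝ) < N := by exact_mod_cast hN
  have himg : Real.exp '' Set.Ioi (Real.log N) = Set.Ioi (N : ℝ) := by
    ext v
    constructor
    · rintro ⟨y, hy, rfl⟩
      exact (Real.log_lt_iff_lt_exp hN0).1 hy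
    · intro hv
      exact ⟨Real.log v, Real.log_lt_log hN0 hv, Real.exp_log (hN0.trans hv)⟩
  rw [zetaTail, ← himg, integral_image_eq_integral_abs_deriv_smul measurableSet_Ioi
    (fun y _ => (Real.hasDerivAt_exp y).hasDerivWithinAt) Real.exp_injective.injOn]
  refine setIntegral_congr_fun measurableSet_Ioi fun y _ => ?_
  rw [abs_of_pos (Real.exp_pos y), Complex.real_smul, mul_left_comm,
    Complex.cpow_def_of_ne_zero (by exact_mod_cast (Real.exp_pos y).ne'),
    ← Complex.ofReal_log (Real.exp_pos y).le, Real.log_exp, Complex.ofReal_exp y, ← Complex.exp_add,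
    Complex.ofReal_mul, mul_assoc, Complex.ofReal_exp (-s * y), ← Complex.exp_add]
  congr 2
  push_cast
  ring

/-- A Plancherel-type bound: the Gaussian kernel has row integral `2√π / V`, which cancels the
factor `V` and leaves a bound free of `V`. -/
theorem integral_norm_sq_zetaTail_le {N : ℕ} (hN : 1 ≤ N) {s : ℝ} (hs : 0 < s) {V : ℝ}
    (hV : 0 < V) :
    ∫ t in -V..V, ‖zetaTail N (s + Complex.I * t)‖ ^ 2 ≤
      Real.exp 1 * (Real.pi / s * (N : ℝ) ^ (-(2 * s))) := by
  have hN0 : (0 : ℝ) < N := by exact_mod_cast hN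
  set a : ℝ → ℂ := fun y =>
    ((((⌊Real.exp y⌋₊ : ℝ) + 1 - Real.exp y) * Real.exp (-s * y) : ℝ) : ℂ) with ha
  have hna : ∀ y, ‖a y‖ ≤ Real.exp (-s * y) := fun y => by
    rw [ha, Complex.norm_real, norm_mul, Real.norm_of_nonneg (Real.exp_pos (-s * y)).le]
    exact mul_le_of_le_one_left (Real.exp_pos _).le (abs_floor_add_one_sub_le (Real.exp_pos y).le)
  have hna2 : ∀ y, ‖a y‖ ^ 2 ≤ Real.exp (-(2 * s) * y) := fun y => by
    refine (pow_le_pow_left₀ (norm_nonneg _) (hna y) 2).trans (le_of_eq ?_)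
    rw [← Real.exp_nat_mul]; congr 1; push_cast; ring
  have ham : Measurable a := by
    have := measurable_floor_add_one_sub.comp Real.measurable_exp
    exact Complex.measurable_ofReal.comp (this.mul (by fun_prop))
  have i1 : IntegrableOn (fun y => Real.exp (-s * y)) (Set.Ioi (Real.log N)) :=
    integrableOn_exp_mul_Ioi (by linarith) _
  have i2 : IntegrableOn (fun y => Real.exp (-(2 * s) * y)) (Set.Ioi (Real.log N)) :=
    integrableOn_exp_mul_Ioi (by linarith) _
  have hai : IntegrableOn a (Set.Ioi (Real.log N)) :=
    i1.mono' ham.aestronglyMeasurable (Eventually.of_forall hna)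
  have hai2 : IntegrableOn (fun y => ‖a y‖ ^ 2) (Set.Ioi (Real.log N)) :=
    i2.mono' (ham.norm.pow_const 2).aestronglyMeasurable (Eventually.of_forall fun y => by
      rw [Real.norm_of_nonneg (sq_nonneg _)]; exact hna2 y)
  have key := integral_norm_sq_le (μ := volume.restrict (Set.Ioi (Real.log N))) (l := fun y => y)
    hai hai2 measurable_id hV (B := 2 * √Real.pi / V) (by positivity) (fun x => by
      refine (lintegral_mono' Measure.restrict_le_self le_rfl).trans ?_
      have hgi : Integrable fun y : ℝ => Real.exp (-(V ^ 2 / 4) * y ^ 2) :=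
        integrable_exp_neg_mul_sq (by positivity)
      have e1 : ∀ y : ℝ, ENNReal.ofReal (Real.exp (-V ^ 2 * (x - y) ^ 2 / 4)) =
          ENNReal.ofReal (Real.exp (-(V ^ 2 / 4) * (x - y) ^ 2)) := fun y => by
        congr 2; ring
      simp_rw [e1]
      rw [lintegral_sub_left_eq_self (fun y => ENNReal.ofReal (Real.exp (-(V ^ 2 / 4) * y ^ 2))),
        ← ofReal_integral_eq_lintegral_ofReal hgi (Eventually.of_forall fun y => (Real.exp_pos _).le),
        integral_gaussian]
      refine ENNReal.ofReal_le_ofReal (le_of_eq ?_)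
      rw [show Real.pi / (V ^ 2 / 4) = Real.pi * (2 / V) ^ 2 by field_simp; norm_num,
        Real.sqrt_mul Real.pi_pos.le, Real.sqrt_sq (by positivity)]
      ring)
  simp_rw [zetaTail_eq_integral_exp hN]
  refine key.trans ?_
  have e2 : V * √Real.pi * (2 * √Real.pi / V) = 2 * Real.pi := by
    field_simp
    rw [Real.sq_sqrt Real.pi_pos.le]
  rw [e2]
  refine mul_le_mul_of_nonneg_left ?_ (Real.exp_pos 1).le
  calc 2 * Real.pi * ∫ y in Set.Ioi (Real.log N), ‖a y‖ ^ 2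
      ≤ 2 * Real.pi * ∫ y in Set.Ioi (Real.log N), Real.exp (-(2 * s) * y) := by
        exact mul_le_mul_of_nonneg_left (setIntegral_mono hai2 i2 hna2) (by positivity)
    _ = Real.pi / s * (N : ℝ) ^ (-(2 * s)) := by
        rw [integral_exp_mul_Ioi (by linarith), Real.rpow_def_of_pos hN0,
          mul_comm (Real.log N)]
        field_simp

/-! ### Mean-square approximation of `ζ` by finite Euler products -/

/-- The product over `p < M` expands into the series over integers with all prime factors below `M`,
which converges absolutely already for `Re s > 0`. -/
theorem hasSum_eulerFun_one (M : ℕ) {s : ℂ} (hs : 0 < s.re) :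
    HasSum ((M.smoothNumbers : Set ℕ).indicator fun n : ℕ => (n : ℂ) ^ (-s)) (eulerFun 1 M s) := by
  have hs0 : s ≠ 0 := fun h => by simp [h] at hs
  have h := (EulerProduct.summable_and_hasSum_smoothNumbers_prod_primesBelow_geometric
    (f := (riemannZetaSummandHom hs0 : ℕ →* ℂ)) (fun {p} hp => by
      change ‖(p : ℂ) ^ (-s)‖ < 1
      rw [Complex.norm_natCast_cpow_of_pos hp.pos]
      exact Real.rpow_lt_one_of_one_lt_of_neg (by exact_mod_cast hp.one_lt) (by simpa using hs))
    M).2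
  have e : eulerFun 1 M s = ∏ p ∈ M.primesBelow, (1 - (riemannZetaSummandHom hs0 : ℕ →* ℂ) p)⁻¹ := by
    rw [eulerFun, Nat.primesBelow, Finset.prod_filter]
    refine Finset.prod_congr rfl fun n _ => ?_
    split_ifs with hn
    · change _ = (1 - (n : ℂ) ^ (-s))⁻¹
      rw [Complex.cpow_neg, show (1 : Torus) ⟨n, hn⟩ = 1 from rfl, Circle.coe_one, one_div]
    · rfl
  rw [← hasSum_subtype_iff_indicator, e]
  exact h

/-- The tail of the Dirichlet series of a finite Euler product, at a real point. -/
def smoothTail (M : ℕ) (a : ℝ) (N : ℕ) : ℝ :=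
  ∑' i : ℕ, (M.smoothNumbers : Set ℕ).indicator (fun n : ℕ => (n : ℝ) ^ (-a)) (i + N)

theorem summable_smooth (M : ℕ) {a : ℝ} (ha : 0 < a) :
    Summable ((M.smoothNumbers : Set ℕ).indicator fun n : ℕ => (n : ℝ) ^ (-a)) := by
  have h := (hasSum_eulerFun_one M (s := a) (by simpa using ha)).summable.norm
  refine h.congr fun n => ?_
  by_cases hn : n ∈ M.smoothNumbers
  · rw [Set.indicator_of_mem hn, Set.indicator_of_mem hn,
      Complex.norm_natCast_cpow_of_pos (Nat.pos_of_ne_zero (Nat.ne_zero_of_mem_smoothNumbers hn))]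
    simp
  · rw [Set.indicator_of_notMem hn, Set.indicator_of_notMem hn, norm_zero]

theorem tendsto_smoothTail (M : ℕ) (a : ℝ) : Tendsto (smoothTail M a) atTop (𝓝 0) :=
  tendsto_sum_nat_add _

theorem norm_eulerFun_one_sub_sum_le (M N : ℕ) {a : ℝ} (ha : 0 < a) {s : ℂ} (hs : a ≤ s.re) :
    ‖eulerFun 1 M s -
      ∑ n ∈ Finset.range N, (M.smoothNumbers : Set ℕ).indicator (fun n : ℕ => (n : ℂ) ^ (-s)) n‖ ≤
      smoothTail M a N := by
  have h := hasSum_eulerFun_one M (ha.trans_le hs)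
  rw [← h.tsum_eq, ← h.summable.sum_add_tsum_nat_add N, add_sub_cancel_left]
  refine tsum_of_norm_bounded ((summable_nat_add_iff N).2 (summable_smooth M ha)).hasSum fun i => ?_
  by_cases hn : i + N ∈ M.smoothNumbers
  · have hpos := Nat.pos_of_ne_zero (Nat.ne_zero_of_mem_smoothNumbers hn)
    rw [Set.indicator_of_mem hn, Set.indicator_of_mem hn, Complex.norm_natCast_cpow_of_pos hpos]
    exact Real.rpow_le_rpow_of_exponent_le (by exact_mod_cast hpos) (by simpa using hs)
  · rw [Set.indicator_of_notMem hn, Set.indicator_of_notMem hn, norm_zero]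

/-- The tail of the series `∑ n ^ (-2a)`. -/
def sqTail (a : ℝ) (M : ℕ) : ℝ := ∑' i : ℕ, ((i + M : ℕ) : ℝ) ^ (-(2 * a))

theorem summable_sq {a : ℝ} (ha : 1 / 2 < a) : Summable fun n : ℕ => (n : ℝ) ^ (-(2 * a)) :=
  Real.summable_nat_rpow.2 (by linarith)

theorem tendsto_sqTail (a : ℝ) : Tendsto (sqTail a) atTop (𝓝 0) :=
  tendsto_sum_nat_add fun n : ℕ => (n : ℝ) ^ (-(2 * a))

/-- A positive integer with a prime factor at least `M` is itself at least `M`. -/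
theorem sum_rough_le {a : ℝ} (ha : 1 / 2 < a) (M N : ℕ) :
    ∑ n ∈ (Finset.Ico 1 N).filter (fun n => n ∉ M.smoothNumbers), (n : ℝ) ^ (-(2 * a)) ≤
      sqTail a M := by
  rw [sqTail, ← Finset.sum_coe_sort, ← tsum_fintype (L := .unconditional _)]
  have hM : ∀ n ∈ (Finset.Ico 1 N).filter (fun n => n ∉ M.smoothNumbers), M ≤ n := by
    intro n hn
    rw [Finset.mem_filter, Finset.mem_Ico] at hn
    by_contra h
    exact hn.2 (Nat.mem_smoothNumbers_of_lt hn.1.1 (not_le.1 h))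
  refine (Summable.of_finite).tsum_le_tsum_of_inj
    (fun n : (Finset.Ico 1 N).filter (fun n => n ∉ M.smoothNumbers) => (n : ℕ) - M) ?_ ?_ ?_
    ((summable_nat_add_iff M).2 (summable_sq ha))
  · intro m n hmn
    have h1 := hM m m.2
    have h2 := hM n n.2
    simp only at hmn
    exact Subtype.ext (by omega)
  · intro i _
    positivity
  · intro n
    rw [Nat.sub_add_cancel (hM n n.2)]

/-- The error in the approximation of `ζ` by a finite Euler product. -/
def zetaDiff (M : ℕ) (s : ℂ) : ℂ := riemannZeta s - eulerFun 1 M s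

theorem differentiableAt_eulerFun (ω : Torus) (M : ℕ) {s : ℂ} (hs : 0 < s.re) :
    DifferentiableAt ℂ (eulerFun ω M) s := by
  unfold eulerFun
  refine DifferentiableAt.fun_finsetProd fun n _ => ?_
  by_cases h : n.Prime
  · simp only [h, dif_pos]
    have h0 : (n : ℂ) ≠ 0 := by exact_mod_cast h.ne_zero
    have h1 : DifferentiableAt ℂ (fun z : ℂ => (n : ℂ) ^ z) s :=
      differentiableAt_id.const_cpow (Or.inl h0)
    exact (((differentiableAt_const _).div h1 (by simp [Complex.cpow_eq_zero_iff, h0])).const_sub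
      1).inv (euler_factor_ne_zero _ h hs)
  · simp only [h, dif_neg, not_false_iff]
    exact differentiableAt_const 1

theorem differentiableAt_zetaDiff (M : ℕ) {s : ℂ} (hs : 0 < s.re) (hs1 : s ≠ 1) :
    DifferentiableAt ℂ (zetaDiff M) s :=
  (differentiableAt_riemannZeta hs1).sub (differentiableAt_eulerFun 1 M hs)

theorem continuous_zetaDiff_line (M : ℕ) {σ : ℝ} (h0 : 0 < σ) (h1 : σ < 1) :
    Continuous fun t : ℝ => zetaDiff M (σ + Complex.I * t) := by
  rw [continuous_iff_continuousAt]
  intro t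
  have : ContinuousAt (zetaDiff M) (σ + Complex.I * t) :=
    (differentiableAt_zetaDiff M (by simpa using h0) (fun h => by
      have := congrArg Complex.re h
      simp at this; linarith)).continuousAt
  exact ContinuousAt.comp (f := fun t : ℝ => (σ : ℂ) + Complex.I * t) this (by fun_prop)

theorem norm_add_four_sq_le (x y z w : ℂ) :
    ‖x + y + z + w‖ ^ 2 ≤ 4 * (‖x‖ ^ 2 + ‖y‖ ^ 2 + ‖z‖ ^ 2 + ‖w‖ ^ 2) := by
  have h : ‖x + y + z + w‖ ≤ ‖x‖ + ‖y‖ + ‖z‖ + ‖w‖ :=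
    (norm_add_le _ _).trans (add_le_add_left ((norm_add_le _ _).trans
      (add_le_add_left (norm_add_le _ _) _)) _)
  refine (pow_le_pow_left₀ (norm_nonneg _) h 2).trans ?_
  nlinarith [sq_nonneg (‖x‖ - ‖y‖), sq_nonneg (‖x‖ - ‖z‖), sq_nonneg (‖x‖ - ‖w‖),
    sq_nonneg (‖y‖ - ‖z‖), sq_nonneg (‖y‖ - ‖w‖), sq_nonneg (‖z‖ - ‖w‖)]

theorem natCast_cpow_neg_eq {n : ℕ} (hn : 1 ≤ n) (σ t : ℝ) :
    (n : ℂ) ^ (-((σ : ℂ) + Complex.I * t)) =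
      ((n : ℝ) ^ (-σ) : ℝ) * Complex.exp (-(Complex.I * t * Real.log n)) := by
  have hn0 : (n : ℂ) ≠ 0 := by exact_mod_cast (by omega : n ≠ 0)
  rw [neg_add, Complex.cpow_add _ _ hn0, Complex.ofReal_cpow (by positivity),
    Complex.cpow_def_of_ne_zero hn0 (-(Complex.I * t))]
  push_cast
  congr 2
  ring

/-- The smooth `n < N` cancel between the partial sum of `ζ` and the expanded Euler product. What
remains is the non-smooth `n < N`, the tail of the smooth series, the pole term and the tail
integral. -/
theorem zetaDiff_eq {M N : ℕ} (hN : 1 ≤ N) {σ : ℝ} (h0 : 0 < σ) (h1 : σ < 1) (t : ℝ) :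
    zetaDiff M (σ + Complex.I * t) =
      ∑ n ∈ (Finset.Ico 1 N).filter (fun n => n ∉ M.smoothNumbers),
        (((n : ℝ) ^ (-σ) : ℝ) : ℂ) * Complex.exp (-(Complex.I * t * Real.log n)) +
      (-(eulerFun 1 M (σ + Complex.I * t) - ∑ n ∈ Finset.range N,
        (M.smoothNumbers : Set ℕ).indicator
          (fun n : ℕ => (n : ℂ) ^ (-((σ : ℂ) + Complex.I * t))) n)) +
      (N : ℂ) ^ (1 - ((σ : ℂ) + Complex.I * t)) / ((σ : ℂ) + Complex.I * t - 1) +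
      ((σ : ℂ) + Complex.I * t) * zetaTail N (σ + Complex.I * t) := by
  set s : ℂ := (σ : ℂ) + Complex.I * t with hs
  have hre : s.re = σ := by simp [hs]
  have hz := riemannZeta_eq_sum_add hN (s := s) (by rw [hre]; exact h0) (fun h => by
      have := congrArg Complex.re h
      rw [hre] at this; simp at this; linarith)
  have hsplit : ∑ n ∈ Finset.Ico 1 N, (n : ℂ) ^ (-s) =
      ∑ n ∈ (Finset.Ico 1 N).filter (fun n => n ∉ M.smoothNumbers), (n : ℂ) ^ (-s) +
      ∑ n ∈ Finset.range N, (M.smoothNumbers : Set ℕ).indicator (fun n : ℕ => (n : ℂ) ^ (-s)) n := by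
    rw [Finset.range_eq_Ico, Finset.sum_eq_sum_Ico_succ_bot (by omega : 0 < N)]
    rw [Set.indicator_of_notMem (fun h => Nat.ne_zero_of_mem_smoothNumbers h rfl), zero_add, zero_add,
      Finset.sum_filter, ← Finset.sum_add_distrib]
    refine Finset.sum_congr rfl fun n _ => ?_
    by_cases hn : n ∈ M.smoothNumbers
    · simp [hn]
    · simp [hn]
  have hconv : ∑ n ∈ (Finset.Ico 1 N).filter (fun n => n ∉ M.smoothNumbers), (n : ℂ) ^ (-s) =
      ∑ n ∈ (Finset.Ico 1 N).filter (fun n => n ∉ M.smoothNumbers),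
        (((n : ℝ) ^ (-σ) : ℝ) : ℂ) * Complex.exp (-(Complex.I * t * Real.log n)) := by
    refine Finset.sum_congr rfl fun n hn => ?_
    rw [Finset.mem_filter, Finset.mem_Ico] at hn
    exact natCast_cpow_neg_eq hn.1.1 σ t
  rw [zetaDiff, hz, hsplit, hconv]
  ring

theorem continuous_pole_term {N : ℕ} (hN : 1 ≤ N) {σ : ℝ} (h1 : σ < 1) :
    Continuous fun t : ℝ =>
      (N : ℂ) ^ (1 - ((σ : ℂ) + Complex.I * t)) / ((σ : ℂ) + Complex.I * t - 1) := by
  have hN0 : (N : ℂ) ≠ 0 := by exact_mod_cast (by omega : N ≠ 0)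
  refine Continuous.div ?_ (by fun_prop) fun t h => ?_
  · exact Continuous.const_cpow (by fun_prop) (Or.inl hN0)
  · have := congrArg Complex.re h
    simp at this; linarith

/-- Here `|s - 1|² = (1 - σ)² + t² ≥ (1 - b)² (1 + t²)`, and `1 / (1 + t²)` has integral `π` over
the line. -/
theorem integral_norm_sq_pole_term_le {N : ℕ} (hN : 1 ≤ N) {a b σ : ℝ} (h0 : 0 < a) (ha : a ≤ σ)
    (hb : σ ≤ b) (hb1 : b < 1) {V : ℝ} (hV : 0 ≤ V) :
    ∫ t in -V..V, ‖(N : ℂ) ^ (1 - ((σ : ℂ) + Complex.I * t)) /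
      ((σ : ℂ) + Complex.I * t - 1)‖ ^ 2 ≤
      Real.pi / (1 - b) ^ 2 * (N : ℝ) ^ (2 - 2 * a) := by
  have hN0 : (1 : ℝ) ≤ N := by exact_mod_cast hN
  have hb0 : 0 < 1 - b := by linarith
  calc _ ≤ ∫ t in -V..V, (N : ℝ) ^ (2 - 2 * a) / (1 - b) ^ 2 * (1 + t ^ 2)⁻¹ := by
        refine intervalIntegral.integral_mono_on (by linarith)
          (((continuous_pole_term hN (by linarith)).norm.pow 2).intervalIntegrable _ _)
          (Continuous.intervalIntegrable (Continuous.mul continuous_const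
            (Continuous.inv₀ (by fun_prop) fun t => by positivity)) _ _) fun t _ => ?_
        rw [norm_div, div_pow, Complex.norm_natCast_cpow_of_pos (by omega), ← Complex.normSq_eq_norm_sq,
          Complex.normSq_apply, div_mul_eq_mul_div, ← div_eq_mul_inv, div_div]
        simp only [Complex.sub_re, Complex.one_re, Complex.add_re, Complex.ofReal_re, Complex.mul_re,
          Complex.I_re, zero_mul, Complex.I_im, Complex.ofReal_im, mul_zero, sub_zero, add_zero,
          Complex.sub_im, Complex.add_im, Complex.mul_im, one_mul, zero_add, Complex.one_im]
        gcongr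
        · rw [← Real.rpow_natCast, ← Real.rpow_mul (by positivity)]
          refine Real.rpow_le_rpow_of_exponent_le hN0 ?_
          push_cast; linarith
        · nlinarith [sq_nonneg t, mul_nonneg (sq_nonneg t) (by nlinarith : 0 ≤ 1 - (1 - b) ^ 2)]
    _ = (N : ℝ) ^ (2 - 2 * a) / (1 - b) ^ 2 * ∫ t in -V..V, (1 + t ^ 2)⁻¹ :=
        intervalIntegral.integral_const_mul _ _
    _ ≤ (N : ℝ) ^ (2 - 2 * a) / (1 - b) ^ 2 * Real.pi := by
        gcongr
        rw [intervalIntegral.integral_of_le (by linarith), ← integral_univ_inv_one_add_sq]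
        exact setIntegral_le_integral integrable_inv_one_add_sq
          (Eventually.of_forall fun t => by positivity)
    _ = _ := by ring

/-- Continuity is read off by solving the approximation formula for the tail. The sum `zetaDiff 0 +
eulerFun 1 0` is just `ζ`. -/
theorem continuous_zetaTail_line {N : ℕ} (hN : 1 ≤ N) {σ : ℝ} (h0 : 0 < σ) (h1 : σ < 1) :
    Continuous fun t : ℝ => ((σ : ℂ) + Complex.I * t) * zetaTail N (σ + Complex.I * t) := by
  have hN0 : (N : ℂ) ≠ 0 := by exact_mod_cast (by omega : N ≠ 0)
  have h : ∀ t : ℝ, ((σ : ℂ) + Complex.I * t) * zetaTail N (σ + Complex.I * t) =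
      zetaDiff 0 (σ + Complex.I * t) + eulerFun 1 0 (σ + Complex.I * t) -
      ∑ n ∈ Finset.Ico 1 N, (n : ℂ) ^ (-((σ : ℂ) + Complex.I * t)) -
      (N : ℂ) ^ (1 - ((σ : ℂ) + Complex.I * t)) / ((σ : ℂ) + Complex.I * t - 1) := by
    intro t
    rw [zetaDiff, riemannZeta_eq_sum_add hN (s := (σ : ℂ) + Complex.I * t) (by simpa using h0)
      (fun h => by
        have := congrArg Complex.re h
        simp at this; linarith)]
    ring
  simp_rw [h]
  have h2 : Continuous fun t : ℝ => eulerFun 1 0 ((σ : ℂ) + Complex.I * t) := by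
    unfold eulerFun
    simpa using continuous_const
  refine ((((continuous_zetaDiff_line 0 h0 h1).add h2).sub ?_).sub (continuous_pole_term hN h1))
  refine continuous_finsetSum _ fun n hn => ?_
  have hn0 : (n : ℂ) ≠ 0 := by
    have := (Finset.mem_Ico.1 hn).1
    exact_mod_cast (by omega : n ≠ 0)
  exact Continuous.const_cpow (by fun_prop) (Or.inl hn0)

/-- Only the first term is of exact order `N`, with a coefficient that is small for large `M`. For
fixed `M` the others are `o(N)`, because `smoothTail M a N` tends to `0` and `2 - 2a < 1`. -/
theorem integral_norm_sq_zetaDiff_natCast_le {a b : ℝ} (ha : 1 / 2 < a) (hb : b < 1) {M N : ℕ}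
    (hN : 1 ≤ N) {σ : ℝ} (h1 : a ≤ σ) (h2 : σ ≤ b) :
    ∫ t in -(N : ℝ)..N, ‖zetaDiff M (σ + Complex.I * t)‖ ^ 2 ≤
      4 * (meanSquareConst * (N * sqTail a M) + 2 * N * smoothTail M a N ^ 2 +
        Real.pi / (1 - b) ^ 2 * (N : ℝ) ^ (2 - 2 * a) +
        4 * Real.exp 1 * Real.pi * (N : ℝ) ^ (2 - 2 * a)) := by
  have hN0 : (1 : ℝ) ≤ N := by exact_mod_cast hN
  have hσ0 : 0 < σ := by linarith
  have hσ1 : σ < 1 := by linarith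
  set F := (Finset.Ico 1 N).filter (fun n => n ∉ M.smoothNumbers) with hF
  set f1 : ℝ → ℂ := fun t => ∑ n ∈ F,
    (((n : ℝ) ^ (-σ) : ℝ) : ℂ) * Complex.exp (-(Complex.I * t * Real.log n)) with hf1
  set f2 : ℝ → ℂ := fun t => -(eulerFun 1 M (σ + Complex.I * t) - ∑ n ∈ Finset.range N,
        (M.smoothNumbers : Set ℕ).indicator
          (fun n : ℕ => (n : ℂ) ^ (-((σ : ℂ) + Complex.I * t))) n) with hf2
  set f3 : ℝ → ℂ := fun t =>
    (N : ℂ) ^ (1 - ((σ : ℂ) + Complex.I * t)) / ((σ : ℂ) + Complex.I * t - 1) with hf3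
  set f4 : ℝ → ℂ := fun t => ((σ : ℂ) + Complex.I * t) * zetaTail N (σ + Complex.I * t) with hf4
  have heq : ∀ t : ℝ, zetaDiff M (σ + Complex.I * t) = f1 t + f2 t + f3 t + f4 t :=
    fun t => zetaDiff_eq hN hσ0 hσ1 t
  have c1 : Continuous f1 := by simp only [hf1]; fun_prop
  have c3 : Continuous f3 := continuous_pole_term hN hσ1
  have c4 : Continuous f4 := continuous_zetaTail_line hN hσ0 hσ1
  have c2 : Continuous f2 := by
    have : f2 = fun t : ℝ => zetaDiff M (σ + Complex.I * t) - f1 t - f3 t - f4 t := by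
      funext t; rw [heq]; ring
    rw [this]
    exact (((continuous_zetaDiff_line M hσ0 hσ1).sub c1).sub c3).sub c4
  have ii : ∀ f : ℝ → ℂ, Continuous f →
      IntervalIntegrable (fun t => ‖f t‖ ^ 2) volume (-(N : ℝ)) N :=
    fun f hf => (hf.norm.pow 2).intervalIntegrable _ _
  have b1 : ∫ t in -(N : ℝ)..N, ‖f1 t‖ ^ 2 ≤ meanSquareConst * (N * sqTail a M) := by
    refine (integral_norm_sq_dirichlet_le hN F (fun n hn => ?_)
      (fun n => (((n : ℝ) ^ (-σ) : ℝ) : ℂ))).trans ?_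
    · rw [hF, Finset.mem_filter, Finset.mem_Ico] at hn
      exact ⟨hn.1.1, hn.1.2.le⟩
    · refine mul_le_mul_of_nonneg_left ?_ meanSquareConst_nonneg
      refine mul_le_mul_of_nonneg_left ?_ (by linarith)
      refine (Finset.sum_le_sum fun n hn => ?_).trans (sum_rough_le ha M N)
      rw [Finset.mem_filter, Finset.mem_Ico] at hn
      have hn1 : (1 : ℝ) ≤ n := by exact_mod_cast hn.1.1
      rw [Complex.norm_real, Real.norm_of_nonneg (by positivity), ← Real.rpow_natCast,
        ← Real.rpow_mul (by positivity)]
      refine Real.rpow_le_rpow_of_exponent_le hn1 ?_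
      push_cast; linarith
  have b2 : ∫ t in -(N : ℝ)..N, ‖f2 t‖ ^ 2 ≤ 2 * N * smoothTail M a N ^ 2 := by
    calc ∫ t in -(N : ℝ)..N, ‖f2 t‖ ^ 2 ≤ ∫ _ in -(N : ℝ)..N, smoothTail M a N ^ 2 := by
          refine intervalIntegral.integral_mono_on (by linarith) (ii _ c2)
            intervalIntegrable_const fun t _ => ?_
          refine pow_le_pow_left₀ (norm_nonneg _) ?_ 2
          rw [hf2, norm_neg]
          exact norm_eulerFun_one_sub_sum_le M N (by linarith) (by simpa using h1)
      _ = _ := by rw [intervalIntegral.integral_const, smul_eq_mul]; ring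
  have b3 := integral_norm_sq_pole_term_le hN (by linarith) h1 h2 hb (V := N) (by linarith)
  have b4 : ∫ t in -(N : ℝ)..N, ‖f4 t‖ ^ 2 ≤
      4 * Real.exp 1 * Real.pi * (N : ℝ) ^ (2 - 2 * a) := by
    have cT : Continuous fun t : ℝ => zetaTail N (σ + Complex.I * t) := by
      have : (fun t : ℝ => zetaTail N (σ + Complex.I * t)) =
          fun t : ℝ => f4 t / ((σ : ℂ) + Complex.I * t) := by
        funext t
        have : (σ : ℂ) + Complex.I * t ≠ 0 := fun h => by
          have := congrArg Complex.re h
          simp at this; linarith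
        simp only [hf4]
        field_simp
      rw [this]
      refine c4.div (by fun_prop) fun t h => ?_
      have := congrArg Complex.re h
      simp at this; linarith
    calc ∫ t in -(N : ℝ)..N, ‖f4 t‖ ^ 2
        ≤ ∫ t in -(N : ℝ)..N, 2 * (N : ℝ) ^ 2 * ‖zetaTail N (σ + Complex.I * t)‖ ^ 2 := by
          refine intervalIntegral.integral_mono_on (by linarith) (ii _ c4)
            ((ii _ cT).const_mul _) fun t ht => ?_
          rw [hf4, norm_mul, mul_pow]
          gcongr
          rw [← Complex.normSq_eq_norm_sq, Complex.normSq_apply]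
          simp only [Complex.add_re, Complex.ofReal_re, Complex.mul_re, Complex.I_re, zero_mul,
            Complex.I_im, Complex.ofReal_im, mul_zero, sub_zero, add_zero, Complex.add_im,
            Complex.mul_im, one_mul, zero_add]
          -- The factor `2N²` is a bound for `|s|² = σ² + t² ≤ 1 + N²`.
          have h3 : t ^ 2 ≤ (N : ℝ) ^ 2 := sq_le_sq' ht.1 ht.2
          nlinarith
      _ = 2 * (N : ℝ) ^ 2 * ∫ t in -(N : ℝ)..N, ‖zetaTail N (σ + Complex.I * t)‖ ^ 2 :=
          intervalIntegral.integral_const_mul _ _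
      _ ≤ 2 * (N : ℝ) ^ 2 * (Real.exp 1 * (Real.pi / σ * (N : ℝ) ^ (-(2 * σ)))) := by
          gcongr
          exact integral_norm_sq_zetaTail_le hN hσ0 (by linarith)
      _ ≤ 2 * (N : ℝ) ^ 2 * (Real.exp 1 * (2 * Real.pi * (N : ℝ) ^ (-(2 * a)))) := by
          gcongr
          rw [div_le_iff₀ hσ0]
          nlinarith [Real.pi_pos]
      _ = _ := by
          rw [show 2 - 2 * a = (2 : ℕ) + -(2 * a) by push_cast; ring,
            Real.rpow_add (by linarith), Real.rpow_natCast]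
          ring
  calc ∫ t in -(N : ℝ)..N, ‖zetaDiff M (σ + Complex.I * t)‖ ^ 2
      ≤ ∫ t in -(N : ℝ)..N, 4 * (‖f1 t‖ ^ 2 + ‖f2 t‖ ^ 2 + ‖f3 t‖ ^ 2 + ‖f4 t‖ ^ 2) := by
        refine intervalIntegral.integral_mono_on (by linarith)
          (ii _ (continuous_zetaDiff_line M hσ0 hσ1))
          (((((ii _ c1).add (ii _ c2)).add (ii _ c3)).add (ii _ c4)).const_mul 4) fun t _ => ?_
        rw [heq]
        exact norm_add_four_sq_le _ _ _ _
    _ = 4 * ((∫ t in -(N : ℝ)..N, ‖f1 t‖ ^ 2) + (∫ t in -(N : ℝ)..N, ‖f2 t‖ ^ 2) +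
        (∫ t in -(N : ℝ)..N, ‖f3 t‖ ^ 2) + ∫ t in -(N : ℝ)..N, ‖f4 t‖ ^ 2) := by
        rw [intervalIntegral.integral_const_mul,
          intervalIntegral.integral_add (((ii _ c1).add (ii _ c2)).add (ii _ c3)) (ii _ c4),
          intervalIntegral.integral_add ((ii _ c1).add (ii _ c2)) (ii _ c3),
          intervalIntegral.integral_add (ii _ c1) (ii _ c2)]
    _ ≤ _ := by gcongr

/-- The mean square of `ζ` minus its finite Euler product over the primes below `M` is as small as
we like if `M` is large, uniformly on vertical lines in a closed substrip. -/
theorem exists_integral_norm_sq_zetaDiff_le {a b : ℝ} (ha : 1 / 2 < a) (hb : b < 1) {ε : ℝ}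
    (hε : 0 < ε) : ∀ᶠ M : ℕ in atTop, ∃ C : ℝ, 0 ≤ C ∧ ∀ σ : ℝ, a ≤ σ → σ ≤ b → ∀ V : ℝ, 0 ≤ V →
      ∫ t in -V..V, ‖zetaDiff M (σ + Complex.I * t)‖ ^ 2 ≤ ε * V + C := by
  have h1 : Tendsto (fun M => 4 * (meanSquareConst * sqTail a M)) atTop (𝓝 0) := by
    simpa using ((tendsto_sqTail a).const_mul meanSquareConst).const_mul 4
  filter_upwards [h1.eventually_lt_const (half_pos hε)] with M hM
  set q : ℝ := Real.pi / (1 - b) ^ 2 + 4 * Real.exp 1 * Real.pi with hq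
  have h2 : Tendsto (fun N : ℕ => 4 * (meanSquareConst * sqTail a M) +
      4 * (2 * smoothTail M a N ^ 2 + q * (N : ℝ) ^ (-(2 * a - 1)))) atTop
      (𝓝 (4 * (meanSquareConst * sqTail a M) + 4 * (2 * 0 ^ 2 + q * 0))) := by
    refine ((((tendsto_smoothTail M a).pow 2).const_mul 2).add (Tendsto.const_mul q ?_)).const_mul
      4 |>.const_add _
    exact (tendsto_rpow_neg_atTop (by linarith)).comp tendsto_natCast_atTop_atTop
  obtain ⟨N₀, hN₀⟩ := eventually_atTop.1 (h2.eventually_lt_const (u := ε) (by simp; linarith))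
  -- The integer `N` below exceeds both `N₀` and `V` but is at most `V + N₀ + 2`. Rounding up
  -- therefore costs a constant independent of `V` and `σ`.
  refine ⟨ε * (N₀ + 2), by positivity, fun σ hσa hσb V hV => ?_⟩
  set N : ℕ := N₀ + ⌈V⌉₊ + 1 with hN
  have hVN : V ≤ N := by
    rw [hN]; push_cast
    have := Nat.le_ceil V
    linarith [(Nat.cast_nonneg N₀ : (0 : ℝ) ≤ N₀)]
  have hNV : (N : ℝ) ≤ V + (N₀ + 2) := by
    rw [hN]; push_cast
    have := Nat.ceil_lt_add_one hV
    linarith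
  have hNp : (0 : ℝ) < N := by rw [hN]; positivity
  have hc := (continuous_zetaDiff_line M (σ := σ) (by linarith) (by linarith)).norm.pow 2
  calc ∫ t in -V..V, ‖zetaDiff M (σ + Complex.I * t)‖ ^ 2
      ≤ ∫ t in -(N : ℝ)..N, ‖zetaDiff M (σ + Complex.I * t)‖ ^ 2 :=
        intervalIntegral.integral_mono_interval (by linarith) (by linarith) hVN
          (Eventually.of_forall fun t => sq_nonneg _) (hc.intervalIntegrable _ _)
    _ ≤ _ := integral_norm_sq_zetaDiff_natCast_le (M := M) ha hb (by omega : 1 ≤ N) hσa hσb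
    _ = N * (4 * (meanSquareConst * sqTail a M) +
      4 * (2 * smoothTail M a N ^ 2 + q * (N : ℝ) ^ (-(2 * a - 1)))) := by
        have : (N : ℝ) ^ (2 - 2 * a) = N * (N : ℝ) ^ (-(2 * a - 1)) := by
          rw [show 2 - 2 * a = 1 + -(2 * a - 1) by ring, Real.rpow_add hNp, Real.rpow_one]
        rw [this, hq]
        ring
    _ ≤ N * ε := by
        gcongr
        exact (hN₀ N (by omega)).le
    _ ≤ ε * V + ε * (N₀ + 2) := by nlinarith

/-! ### Properties of the shifts -/

/-- What is used about a shift on the half-line beyond `T₀`. -/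
structure ShiftBounds (γ : ℝ → ℝ) (T₀ α : ℝ) : Prop where
  T₀_pos : 0 < T₀
  α_pos : 0 < α
  continuousOn : ContinuousOn γ (Set.Ici T₀)
  hasDerivAt : ∀ τ, T₀ < τ → HasDerivAt γ (deriv γ τ) τ
  hasDerivAt_deriv : ∀ τ, T₀ < τ → HasDerivAt (deriv γ) (deriv (deriv γ) τ) τ
  continuousOn_deriv2 : ContinuousOn (deriv (deriv γ)) (Set.Ioi T₀)
  deriv2_nonneg : ∀ τ, T₀ < τ → 0 ≤ deriv (deriv γ) τ
  le_deriv : ∀ τ, T₀ < τ → α * γ τ ≤ deriv γ τ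
  pos : ∀ τ, T₀ ≤ τ → 0 < γ τ
  tendsto : Tendsto γ atTop atTop

theorem hasDerivAt_nonneg_of_monotoneOn {f : ℝ → ℝ} {T τ f' : ℝ} (hf : MonotoneOn f (Set.Ioi T))
    (hτ : T < τ) (h : HasDerivAt f f' τ) : 0 ≤ f' := by
  have := hf.derivWithin_nonneg (x := τ)
  rwa [h.hasDerivWithinAt.derivWithin (isOpen_Ioi.uniqueDiffWithinAt hτ)] at this

theorem IsShift.exists_shiftBounds {γ : ℝ → ℝ} (h : IsShift γ) :
    ∃ T₀ α : ℝ, ShiftBounds γ T₀ α := by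
  obtain ⟨T₀, T₁, h0, h1, -, hbij, htop, hC, hmono, α, hα, hle, -⟩ := h
  have hd : ∀ τ, T₀ < τ → derivWithin γ (Set.Ici T₀) τ = deriv γ τ := fun τ hτ =>
    derivWithin_of_mem_nhds (Ici_mem_nhds hτ)
  have hpos : ∀ τ, T₀ ≤ τ → 0 < γ τ := fun τ hτ => h1.trans_le (hbij.mapsTo hτ)
  have hC' : ContDiffOn ℝ 2 γ (Set.Ioi T₀) := hC.mono Set.Ioi_subset_Ici_self
  have e2 : (2 : WithTop ℕ∞) = 1 + 1 := by norm_num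
  rw [e2, contDiffOn_succ_iff_deriv_of_isOpen isOpen_Ioi] at hC'
  obtain ⟨hd1, -, hd2⟩ := hC'
  rw [show (1 : WithTop ℕ∞) = 0 + 1 by norm_num, contDiffOn_succ_iff_deriv_of_isOpen isOpen_Ioi]
    at hd2
  obtain ⟨hd2, -, hd3⟩ := hd2
  -- A decreasing `γ'` would stay below `γ'(T₀)`, whereas `γ' ≥ αγ` and `γ` is unbounded.
  have hm : MonotoneOn (derivWithin γ (Set.Ici T₀)) (Set.Ici T₀) := by
    refine hmono.resolve_right fun hanti => ?_
    obtain ⟨τ, hτ, hτ'⟩ := ((htop.eventually_gt_atTop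
      (derivWithin γ (Set.Ici T₀) T₀ / α)).and (eventually_ge_atTop T₀)).exists
    have h2 := hanti Set.self_mem_Ici (Set.mem_Ici.2 hτ') hτ'
    have h3 := hle τ hτ'
    rw [div_lt_iff₀ hα] at hτ
    linarith
  have hm' : MonotoneOn (deriv γ) (Set.Ioi T₀) := fun x hx y hy hxy => by
    rw [← hd x hx, ← hd y hy]
    exact hm (Set.Ioi_subset_Ici_self hx) (Set.Ioi_subset_Ici_self hy) hxy
  have hdd : ∀ τ, T₀ < τ → HasDerivAt (deriv γ) (deriv (deriv γ) τ) τ := fun τ hτ =>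
    ((hd2 τ hτ).differentiableAt (Ioi_mem_nhds hτ)).hasDerivAt
  exact ⟨T₀, α, h0, hα, hC.continuousOn,
    fun τ hτ => ((hd1 τ hτ).differentiableAt (Ioi_mem_nhds hτ)).hasDerivAt, hdd, hd3.continuousOn,
    fun τ hτ => hasDerivAt_nonneg_of_monotoneOn hm' hτ (hdd τ hτ),
    fun τ hτ => by rw [← hd τ hτ]; exact hle τ hτ.le, hpos, htop⟩

namespace ShiftBounds

variable {γ : ℝ → ℝ} {T₀ α : ℝ}

theorem deriv_pos (h : ShiftBounds γ T₀ α) {τ : ℝ} (hτ : T₀ < τ) : 0 < deriv γ τ :=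
  (mul_pos h.α_pos (h.pos τ hτ.le)).trans_le (h.le_deriv τ hτ)

/-- A linear bound for `∫₀ᵘ g` carries over to the mean of `g ∘ γ` over `[T, 2T]`. -/
theorem integral_comp_le (h : ShiftBounds γ T₀ α) {g : ℝ → ℝ} (hg : Continuous g)
    (hg0 : ∀ u, 0 ≤ g u) {ε C : ℝ} (hε : 0 ≤ ε)
    (hF : ∀ u, 0 ≤ u → ∫ v in (0 : ℝ)..u, g v ≤ ε * u + C) {T : ℝ} (hT : T₀ < T) :
    ∫ τ in T..2 * T, g (γ τ) ≤ ε * T + (ε / α + C / deriv γ T) := by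
  have hTp : 0 < T := h.T₀_pos.trans hT
  have hle : T ≤ 2 * T := by linarith
  set F : ℝ → ℝ := fun u => ∫ v in (0 : ℝ)..u, g v with hFd
  have hF' : ∀ u, HasDerivAt F (g u) u := fun u =>
    intervalIntegral.integral_hasDerivAt_right (hg.intervalIntegrable _ _)
      (hg.stronglyMeasurableAtFilter _ _) hg.continuousAt
  -- Integration by parts against the decreasing weight `1 / γ'`, packed into one primitive. Since
  -- `F(γ) - εγ - C ≤ 0` and `γ'' ≥ 0`, the derivative of `Ψ` is at least `g ∘ γ`.
  set Ψ : ℝ → ℝ := fun τ => (F (γ τ) - ε * γ τ - C) / deriv γ τ + ε * τ with hΨ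
  have hΨ' : ∀ τ, T₀ < τ → HasDerivAt Ψ
      (((g (γ τ) * deriv γ τ - ε * deriv γ τ) * deriv γ τ -
        (F (γ τ) - ε * γ τ - C) * deriv (deriv γ) τ) / deriv γ τ ^ 2 + ε * 1) τ := fun τ hτ => by
    have d1 := h.hasDerivAt τ hτ
    have d2 : HasDerivAt (fun τ => F (γ τ)) (g (γ τ) * deriv γ τ) τ :=
      HasDerivAt.comp τ (hF' (γ τ)) d1
    exact (((d2.sub (d1.const_mul ε)).sub_const C).div (h.hasDerivAt_deriv τ hτ)
      (h.deriv_pos hτ).ne').add ((hasDerivAt_id τ).const_mul ε)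
  have hgγ : ContinuousOn (fun τ => g (γ τ)) (Set.Icc T (2 * T)) :=
    hg.comp_continuousOn (h.continuousOn.mono fun τ hτ => (hT.le.trans hτ.1 : T₀ ≤ τ))
  have key : ∫ τ in T..2 * T, g (γ τ) ≤ Ψ (2 * T) - Ψ T := by
    refine intervalIntegral.integral_le_sub_of_hasDeriv_right_of_le hle
      (fun τ hτ => (hΨ' τ (hT.trans_le hτ.1)).continuousAt.continuousWithinAt)
      (fun τ hτ => (hΨ' τ (hT.trans hτ.1)).hasDerivWithinAt) (hgγ.integrableOn_Icc) fun τ hτ => ?_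
    have hτ0 : T₀ < τ := hT.trans hτ.1
    have p1 := h.deriv_pos hτ0
    have p2 := h.deriv2_nonneg τ hτ0
    have p3 := hF (γ τ) (h.pos τ hτ0.le).le
    have p4 : F (γ τ) - ε * γ τ - C ≤ 0 := by simp only [hFd]; linarith
    have e : ((g (γ τ) * deriv γ τ - ε * deriv γ τ) * deriv γ τ -
        (F (γ τ) - ε * γ τ - C) * deriv (deriv γ) τ) / deriv γ τ ^ 2 + ε * 1 =
        g (γ τ) + (-(F (γ τ) - ε * γ τ - C) * deriv (deriv γ) τ) / deriv γ τ ^ 2 := by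
      field_simp
      ring
    rw [e]
    have : 0 ≤ (-(F (γ τ) - ε * γ τ - C) * deriv (deriv γ) τ) / deriv γ τ ^ 2 :=
      div_nonneg (mul_nonneg (by linarith) p2) (sq_nonneg _)
    linarith
  refine key.trans ?_
  have q1 := h.deriv_pos hT
  -- Boundary terms: the quotient is nonpositive at `2T`; at `T` it is controlled by `F ≥ 0` and `γ
  -- / γ' ≤ 1 / α`.
  have q2 : (F (γ (2 * T)) - ε * γ (2 * T) - C) / deriv γ (2 * T) ≤ 0 := by
    have p3 := hF (γ (2 * T)) (h.pos _ (by linarith)).le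
    refine div_nonpos_of_nonpos_of_nonneg ?_ (h.deriv_pos (by linarith)).le
    simp only [hFd]; linarith
  have q3 : 0 ≤ F (γ T) :=
    intervalIntegral.integral_nonneg (h.pos T hT.le).le fun u _ => hg0 u
  have q4 : -((F (γ T) - ε * γ T - C) / deriv γ T) ≤ ε / α + C / deriv γ T := by
    rw [← neg_div]
    calc -(F (γ T) - ε * γ T - C) / deriv γ T ≤ (ε * γ T + C) / deriv γ T := by
          gcongr; linarith
      _ = ε * (γ T / deriv γ T) + C / deriv γ T := by ring
      _ ≤ ε * (1 / α) + C / deriv γ T := by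
          have : γ T / deriv γ T ≤ 1 / α := by
            rw [div_le_div_iff₀ q1 h.α_pos]
            linarith [h.le_deriv T hT]
          gcongr
      _ = _ := by ring
  simp only [hΨ]
  linarith

end ShiftBounds

/-- Along a shift, the mean square of `ζ` minus its finite Euler product is small, uniformly on
rectangles. -/
theorem IsShift.eventually_integral_norm_sq_zetaDiff_le {γ : ℝ → ℝ} (hγ : IsShift γ) {a b : ℝ}
    (ha : 1 / 2 < a) (hb : b < 1) (Y : ℝ) {ε : ℝ} (hε : 0 < ε) :
    ∀ᶠ M : ℕ in atTop, ∀ᶠ T : ℝ in atTop, ∀ s : ℂ, a ≤ s.re → s.re ≤ b → |s.im| ≤ Y →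
      ∫ τ in T..2 * T, ‖zetaDiff M (s + Complex.I * γ τ)‖ ^ 2 ≤ ε * T := by
  obtain ⟨T₀, α, h⟩ := hγ.exists_shiftBounds
  filter_upwards [exists_integral_norm_sq_zetaDiff_le ha hb (half_pos hε)] with M ⟨C, hC, hM⟩
  -- The extra `ε|Y| / 2` pays for the displacement by `Im s`: an interval of length `u` starting at
  -- `Im s` lies in `[-(u + Y), u + Y]`.
  set C' : ℝ := ε / 2 * |Y| + C with hC'
  have hC'0 : 0 ≤ C' := by positivity
  filter_upwards [eventually_gt_atTop T₀, h.tendsto.eventually_ge_atTop (1 / α),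
    eventually_ge_atTop ((ε / 2 / α + C') / (ε / 2))] with T hT hT1 hT2 s hsa hsb hsY
  have hYn : 0 ≤ Y := (abs_nonneg _).trans hsY
  have hs0 : 0 < s.re := by linarith
  set G : ℝ → ℝ := fun v => ‖zetaDiff M (s.re + Complex.I * v)‖ ^ 2 with hG
  have hGc : Continuous G := (continuous_zetaDiff_line M hs0 (by linarith)).norm.pow 2
  have heq : ∀ v : ℝ, ‖zetaDiff M (s + Complex.I * v)‖ ^ 2 = G (s.im + v) := fun v => by
    simp only [hG]
    congr 3
    conv_lhs => rw [← Complex.re_add_im s]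
    push_cast
    ring
  have key := h.integral_comp_le (g := fun v => G (s.im + v)) (by fun_prop)
    (fun u => sq_nonneg _) (half_pos hε).le (fun u hu => by
      rw [intervalIntegral.integral_comp_add_left, add_zero]
      have h1 := abs_le.1 hsY
      calc ∫ v in s.im..s.im + u, G v ≤ ∫ v in -(u + Y)..u + Y, G v :=
            intervalIntegral.integral_mono_interval (by linarith) (by linarith) (by linarith)
              (Eventually.of_forall fun t => sq_nonneg _) (hGc.intervalIntegrable _ _)
        _ ≤ ε / 2 * (u + Y) + C := hM s.re hsa hsb (u + Y) (by linarith)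
        _ = ε / 2 * u + C' := by rw [hC', abs_of_nonneg hYn]; ring) hT
  simp_rw [heq]
  refine key.trans ?_
  have d1 : 1 ≤ deriv γ T := by
    refine le_trans ?_ (h.le_deriv T hT)
    rw [div_le_iff₀ h.α_pos] at hT1
    linarith
  have d2 : C' / deriv γ T ≤ C' := div_le_self hC'0 d1
  rw [div_le_iff₀ (half_pos hε)] at hT2
  linarith

/-! ### The first derivative test -/

/-- Integrate by parts with the primitive `e^(iφ) / (iφ')`. Its boundary values contribute at most
`2 / m`. The remaining integrand has modulus `|φ''| / φ'²`, and as `φ''` keeps its sign, its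
integral is the variation of `1 / φ'`, again at most `2 / m`. -/
theorem norm_integral_cexp_le {φ φ₁ φ₂ : ℝ → ℝ} {a b m : ℝ} (hab : a ≤ b) (hm : 0 < m)
    (h1 : ∀ x ∈ Set.Icc a b, HasDerivAt φ (φ₁ x) x)
    (h2 : ∀ x ∈ Set.Icc a b, HasDerivAt φ₁ (φ₂ x) x) (hc : ContinuousOn φ₂ (Set.Icc a b))
    (hsign : (∀ x ∈ Set.Icc a b, 0 ≤ φ₂ x) ∨ ∀ x ∈ Set.Icc a b, φ₂ x ≤ 0)
    (hlow : ∀ x ∈ Set.Icc a b, m ≤ |φ₁ x|) :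
    ‖∫ x in a..b, Complex.exp (Complex.I * φ x)‖ ≤ 4 / m := by
  have hne : ∀ x ∈ Set.Icc a b, φ₁ x ≠ 0 := fun x hx h => by
    have := hlow x hx
    rw [h, abs_zero] at this
    linarith
  have hIcc : Set.uIcc a b = Set.Icc a b := Set.uIcc_of_le hab
  have c0 : ContinuousOn φ (Set.Icc a b) := fun x hx => (h1 x hx).continuousAt.continuousWithinAt
  have c1 : ContinuousOn φ₁ (Set.Icc a b) := fun x hx => (h2 x hx).continuousAt.continuousWithinAt
  have ce : ContinuousOn (fun x => Complex.exp (Complex.I * φ x)) (Set.Icc a b) :=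
    Complex.continuous_exp.comp_continuousOn
      (continuousOn_const.mul (Complex.continuous_ofReal.comp_continuousOn c0))
  have cq : ContinuousOn (fun x => φ₂ x / φ₁ x ^ 2) (Set.Icc a b) :=
    hc.div (c1.pow 2) fun x hx => pow_ne_zero 2 (hne x hx)
  have cr : ContinuousOn (fun x => Complex.exp (Complex.I * φ x) *
      (((φ₂ x / φ₁ x ^ 2 : ℝ) : ℂ) / Complex.I)) (Set.Icc a b) :=
    ce.mul ((Complex.continuous_ofReal.comp_continuousOn cq).div_const _)
  have i1 : IntervalIntegrable (fun x => Complex.exp (Complex.I * φ x)) volume a b :=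
    ContinuousOn.intervalIntegrable (by rwa [hIcc])
  have i2 : IntervalIntegrable (fun x => Complex.exp (Complex.I * φ x) *
      (((φ₂ x / φ₁ x ^ 2 : ℝ) : ℂ) / Complex.I)) volume a b :=
    ContinuousOn.intervalIntegrable (by rwa [hIcc])
  have i3 : IntervalIntegrable (fun x => φ₂ x / φ₁ x ^ 2) volume a b :=
    ContinuousOn.intervalIntegrable (by rwa [hIcc])
  set F : ℝ → ℂ := fun x => Complex.exp (Complex.I * φ x) / (Complex.I * φ₁ x) with hF
  have hFd : ∀ x ∈ Set.Icc a b, HasDerivAt F (Complex.exp (Complex.I * φ x) -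
      Complex.exp (Complex.I * φ x) * (((φ₂ x / φ₁ x ^ 2 : ℝ) : ℂ) / Complex.I)) x := by
    intro x hx
    have hn : (φ₁ x : ℂ) ≠ 0 := by exact_mod_cast hne x hx
    have d1 : HasDerivAt (fun x => Complex.exp (Complex.I * φ x))
        (Complex.exp (Complex.I * φ x) * (Complex.I * φ₁ x)) x :=
      (((h1 x hx).ofReal_comp).const_mul Complex.I).cexp
    refine (d1.div (((h2 x hx).ofReal_comp).const_mul Complex.I)
      (mul_ne_zero Complex.I_ne_zero hn)).congr_deriv ?_
    have hI := Complex.I_ne_zero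
    push_cast
    field_simp
  have hFn : ∀ x ∈ Set.Icc a b, ‖F x‖ ≤ 1 / m := fun x hx => by
    rw [hF, norm_div, norm_mul, Complex.norm_I, one_mul, Complex.norm_exp, Complex.norm_real,
      Real.norm_eq_abs]
    simp only [Complex.mul_re, Complex.I_re, zero_mul, Complex.ofReal_im, mul_zero, sub_zero,
      Real.exp_zero]
    exact one_div_le_one_div_of_le hm (hlow x hx)
  have hint : ∫ x in a..b, Complex.exp (Complex.I * φ x) = F b - F a +
      ∫ x in a..b, Complex.exp (Complex.I * φ x) * (((φ₂ x / φ₁ x ^ 2 : ℝ) : ℂ) / Complex.I) := by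
    rw [← intervalIntegral.integral_eq_sub_of_hasDerivAt (fun x hx => hFd x (hIcc ▸ hx))
      (i1.sub i2), intervalIntegral.integral_sub i1 i2]
    ring
  have hq : ∫ x in a..b, φ₂ x / φ₁ x ^ 2 = -(1 / φ₁ b) - -(1 / φ₁ a) := by
    refine intervalIntegral.integral_eq_sub_of_hasDerivAt (f := fun x => -(1 / φ₁ x))
      (fun x hx => ?_) i3
    rw [hIcc] at hx
    have := ((h2 x hx).inv (hne x hx)).neg
    simp only [one_div]
    refine this.congr_deriv ?_
    ring
  have hinv : ∀ x ∈ Set.Icc a b, |1 / φ₁ x| ≤ 1 / m := fun x hx => by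
    rw [abs_div, abs_one]
    exact one_div_le_one_div_of_le hm (hlow x hx)
  have ha := Set.left_mem_Icc.2 hab
  have hb := Set.right_mem_Icc.2 hab
  have hqabs : |∫ x in a..b, φ₂ x / φ₁ x ^ 2| ≤ 2 / m := by
    rw [hq]
    have h3 := abs_le.1 (hinv a ha)
    have h4 := abs_le.1 (hinv b hb)
    have e : 2 / m = 1 / m + 1 / m := by ring
    rw [abs_le, e]
    constructor <;> linarith
  have habs : ∫ x in a..b, |φ₂ x / φ₁ x ^ 2| = |∫ x in a..b, φ₂ x / φ₁ x ^ 2| := by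
    rcases hsign with hs | hs
    · have hnn : ∀ x ∈ Set.Icc a b, 0 ≤ φ₂ x / φ₁ x ^ 2 := fun x hx =>
        div_nonneg (hs x hx) (sq_nonneg _)
      rw [abs_of_nonneg (intervalIntegral.integral_nonneg hab hnn)]
      exact intervalIntegral.integral_congr fun x hx => abs_of_nonneg (hnn x (hIcc ▸ hx))
    · have hnn : ∀ x ∈ Set.Icc a b, φ₂ x / φ₁ x ^ 2 ≤ 0 := fun x hx =>
        div_nonpos_of_nonpos_of_nonneg (hs x hx) (sq_nonneg _)
      rw [abs_of_nonpos (by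
        rw [← neg_nonneg, ← intervalIntegral.integral_neg]
        exact intervalIntegral.integral_nonneg hab fun x hx => neg_nonneg.2 (hnn x hx)),
        ← intervalIntegral.integral_neg]
      exact intervalIntegral.integral_congr fun x hx => abs_of_nonpos (hnn x (hIcc ▸ hx))
  have hrem : ‖∫ x in a..b, Complex.exp (Complex.I * φ x) *
      (((φ₂ x / φ₁ x ^ 2 : ℝ) : ℂ) / Complex.I)‖ ≤ 2 / m := by
    refine (intervalIntegral.norm_integral_le_integral_norm hab).trans ?_
    refine le_trans (le_of_eq ?_) (habs.trans_le hqabs)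
    refine intervalIntegral.integral_congr fun x _ => ?_
    rw [norm_mul, norm_div, Complex.norm_I, div_one, Complex.norm_exp, Complex.norm_real,
      Real.norm_eq_abs]
    simp
  rw [hint]
  calc _ ≤ ‖F b - F a‖ + ‖∫ x in a..b, Complex.exp (Complex.I * φ x) *
      (((φ₂ x / φ₁ x ^ 2 : ℝ) : ℂ) / Complex.I)‖ := norm_add_le _ _
    _ ≤ (‖F b‖ + ‖F a‖) + 2 / m := add_le_add (norm_sub_le _ _) hrem
    _ ≤ (1 / m + 1 / m) + 2 / m := by gcongr; exacts [hFn b hb, hFn a ha]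
    _ = 4 / m := by ring

/-! ### Equidistribution on the torus -/

theorem circle_exp_sum {ι : Type*} (s : Finset ι) (f : ι → ℝ) :
    Circle.exp (∑ i ∈ s, f i) = ∏ i ∈ s, Circle.exp (f i) := by
  classical
  induction s using Finset.induction_on with
  | empty => simp
  | insert i s hi ih => rw [Finset.sum_insert hi, Finset.prod_insert hi, Circle.exp_add, ih]

/-- Unique factorization: moving the negative exponents to the other side yields two equal products
of prime powers, and the positive and negative parts of an integer agree only when it is `0`. -/
theorem eq_zero_of_sum_mul_log_eq_zero (s : Finset Nat.Primes) (k : Nat.Primes → ℤ)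
    (h : ∑ p ∈ s, (k p : ℝ) * Real.log (p : ℕ) = 0) : ∀ p ∈ s, k p = 0 := by
  have hlog : ∀ e : Nat.Primes → ℕ, Real.log ((∏ p ∈ s, (p : ℕ) ^ e p : ℕ) : ℝ) =
      ∑ p ∈ s, (e p : ℝ) * Real.log (p : ℕ) := fun e => by
    push_cast
    rw [Real.log_prod (fun p _ => pow_ne_zero _ (by exact_mod_cast p.2.ne_zero))]
    exact Finset.sum_congr rfl fun p _ => Real.log_pow _ _
  have hpos : ∀ e : Nat.Primes → ℕ, 0 < ∏ p ∈ s, (p : ℕ) ^ e p := fun e =>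
    Finset.prod_pos fun p _ => pow_pos p.2.pos _
  have h1 : ∏ p ∈ s, (p : ℕ) ^ (k p).toNat = ∏ p ∈ s, (p : ℕ) ^ (-k p).toNat := by
    have h2 : Real.log ((∏ p ∈ s, (p : ℕ) ^ (k p).toNat : ℕ) : ℝ) =
        Real.log ((∏ p ∈ s, (p : ℕ) ^ (-k p).toNat : ℕ) : ℝ) := by
      rw [hlog fun p => (k p).toNat, hlog fun p => (-k p).toNat, ← sub_eq_zero,
        ← Finset.sum_sub_distrib, ← h]
      refine Finset.sum_congr rfl fun p _ => ?_
      rw [← sub_mul]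
      congr 1
      have : ((k p).toNat : ℤ) - ((-k p).toNat : ℤ) = k p := by omega
      exact_mod_cast congrArg (Int.cast : ℤ → ℝ) this
    exact_mod_cast Real.log_injOn_pos (Set.mem_Ioi.2 (by exact_mod_cast hpos _))
      (Set.mem_Ioi.2 (by exact_mod_cast hpos _)) h2
  have hfac : ∀ e : Nat.Primes → ℕ, ∀ q ∈ s,
      (∏ p ∈ s, (p : ℕ) ^ e p).factorization q = e q := fun e q hq => by
    rw [Nat.factorization_prod fun p _ => pow_ne_zero _ p.2.ne_zero, Finset.sum_apply',
      Finset.sum_eq_single q]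
    · rw [q.2.factorization_pow, Finsupp.single_eq_same]
    · intro p _ hpq
      rw [p.2.factorization_pow, Finsupp.single_eq_of_ne]
      exact fun h => hpq (Subtype.ext h.symm)
    · exact fun h => absurd hq h
  intro q hq
  have h2 := hfac (fun p => (k p).toNat) q hq
  rw [h1, hfac (fun p => (-k p).toNat) q hq] at h2
  omega

variable {r : ℕ}

/-- The characters of the product of tori. -/
def torusChar (k : (Fin r × Nat.Primes) →₀ ℤ) (ω : Fin r → Torus) : Circle :=
  k.prod fun i n => ω i.1 i.2 ^ n

theorem torusChar_mul (k : (Fin r × Nat.Primes) →₀ ℤ) (ω ω' : Fin r → Torus) :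
    torusChar k (ω * ω') = torusChar k ω * torusChar k ω' := by
  simp only [torusChar, Finsupp.prod, ← Finset.prod_mul_distrib, Pi.mul_apply, mul_zpow]

theorem continuous_torusChar (k : (Fin r × Nat.Primes) →₀ ℤ) : Continuous (torusChar k) := by
  unfold torusChar Finsupp.prod
  fun_prop

/-- The set of characters, as a submonoid of the algebra of continuous functions. -/
def charSubmonoid (r : ℕ) : Submonoid C(Fin r → Torus, ℂ) where
  carrier := {h | ∃ k, ∀ ω, h ω = torusChar k ω}
  mul_mem' := by
    rintro f g ⟨k, hk⟩ ⟨l, hl⟩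
    refine ⟨k + l, fun ω => ?_⟩
    rw [ContinuousMap.mul_apply, hk, hl, ← Circle.coe_mul, torusChar, torusChar, torusChar,
      Finsupp.prod_add_index' (fun _ => zpow_zero _) (fun _ _ _ => zpow_add _ _ _)]
  one_mem' := ⟨0, fun ω => by simp [torusChar]⟩

theorem star_mem_charSubmonoid {h : C(Fin r → Torus, ℂ)} (hh : h ∈ charSubmonoid r) :
    star h ∈ charSubmonoid r := by
  obtain ⟨k, hk⟩ := hh
  refine ⟨-k, fun ω => ?_⟩
  rw [ContinuousMap.star_apply, hk, torusChar, torusChar,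
    Finsupp.prod_neg_index (fun _ => zpow_zero _)]
  simp only [zpow_neg, Finsupp.prod, Finset.prod_inv_distrib]
  rw [Circle.coe_inv_eq_conj]
  rfl

/-- Stone–Weierstrass: the characters separate points and are closed under products and conjugation,
so their linear span is already the star subalgebra they generate. -/
theorem dense_span_charSubmonoid (r : ℕ) :
    (Submodule.span ℂ (charSubmonoid r : Set C(Fin r → Torus, ℂ))).topologicalClosure = ⊤ := by
  have h1 : (StarAlgebra.adjoin ℂ (charSubmonoid r : Set C(Fin r → Torus, ℂ))).SeparatesPoints := by
    intro ω ω' hne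
    obtain ⟨j, hj⟩ := Function.ne_iff.1 hne
    obtain ⟨p, hp⟩ := Function.ne_iff.1 hj
    let f : C(Fin r → Torus, ℂ) := ⟨fun ω => torusChar (Finsupp.single (j, p) 1) ω,
      by have := continuous_torusChar (Finsupp.single (j, p) (1 : ℤ)); fun_prop⟩
    refine ⟨f, ⟨f, StarAlgebra.subset_adjoin ℂ _ ⟨_, fun _ => rfl⟩, rfl⟩, ?_⟩
    simpa [f, torusChar, Finsupp.prod_single_index] using fun h => hp (Circle.ext h)
  have h2 := ContinuousMap.starSubalgebra_topologicalClosure_eq_top_of_separatesPoints _ h1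
  have h3 : Subalgebra.toSubmodule (StarAlgebra.adjoin ℂ
      (charSubmonoid r : Set C(Fin r → Torus, ℂ))).toSubalgebra =
      Submodule.span ℂ (charSubmonoid r : Set C(Fin r → Torus, ℂ)) := by
    rw [StarAlgebra.adjoin_toSubalgebra, Set.union_eq_self_of_subset_right
      (fun h hh => by simpa using star_mem_charSubmonoid (Set.mem_star.1 hh)),
      Algebra.adjoin_eq_span, Submonoid.closure_eq]
  rw [← h3]
  refine SetLike.coe_injective ?_
  have h4 := congrArg (fun S : StarSubalgebra ℂ C(Fin r → Torus, ℂ) => (S : Set C(Fin r → Torus, ℂ))) h2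
  simpa using h4

/-- Translate by a point at which the character is `-1`: the coordinate `e^(iπ / k_i)` at one index
with `k_i ≠ 0`, and `1` elsewhere. -/
theorem integral_torusChar_eq_zero {k : (Fin r × Nat.Primes) →₀ ℤ} (hk : k ≠ 0) :
    ∫ ω, (torusChar k ω : ℂ) ∂(haar r) = 0 := by
  obtain ⟨i, hi⟩ := Finsupp.ne_iff.1 hk
  rw [Finsupp.zero_apply] at hi
  set g : Fin r → Torus := fun j p => if (j, p) = i then Circle.exp (Real.pi / k i) else 1 with hg
  have hgk : (torusChar k g : ℂ) = -1 := by
    rw [torusChar, Finsupp.prod, Finset.prod_eq_single i]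
    · simp only [hg, if_true]
      rw [← Circle.exp_intCast_mul, mul_div_cancel₀ _ (by exact_mod_cast hi)]
      simp
    · intro j _ hj
      simp [hg, hj]
    · intro h
      exact absurd (Finsupp.notMem_support_iff.1 h) hi
  have hinv : ∫ ω, (torusChar k (g * ω) : ℂ) ∂(haar r) = ∫ ω, (torusChar k ω : ℂ) ∂(haar r) := by
    have : (haar r).IsMulLeftInvariant := by unfold haar; infer_instance
    exact integral_mul_left_eq_self (fun ω => (torusChar k ω : ℂ)) g
  simp_rw [torusChar_mul, Circle.coe_mul, hgk] at hinv
  rw [integral_const_mul] at hinv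
  linear_combination (-(1 / 2) : ℂ) * hinv

/-- The point `(p ^ (-i γ_j(τ)))` of the product of tori. -/
def orbit (γ : Fin r → ℝ → ℝ) (τ : ℝ) : Fin r → Torus :=
  fun j p => Circle.exp (-(γ j τ * Real.log (p : ℕ)))

theorem torusChar_orbit (γ : Fin r → ℝ → ℝ) (k : (Fin r × Nat.Primes) →₀ ℤ) (τ : ℝ) :
    (torusChar k (orbit γ τ) : ℂ) = Complex.exp (Complex.I *
      ((∑ j, (∑ p ∈ k.support.image Prod.snd, -((k (j, p) : ℝ) * Real.log (p : ℕ))) * γ j τ : ℝ)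
        : ℂ)) := by
  have h1 : torusChar k (orbit γ τ) = Circle.exp
      (∑ i ∈ k.support, -((k i : ℝ) * Real.log (i.2 : ℕ)) * γ i.1 τ) := by
    rw [torusChar, Finsupp.prod, circle_exp_sum]
    refine Finset.prod_congr rfl fun i _ => ?_
    rw [orbit, ← Circle.exp_intCast_mul]
    congr 1; ring
  have h2 : ∑ i ∈ k.support, -((k i : ℝ) * Real.log (i.2 : ℕ)) * γ i.1 τ =
      ∑ j, (∑ p ∈ k.support.image Prod.snd, -((k (j, p) : ℝ) * Real.log (p : ℕ))) * γ j τ := by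
    simp_rw [Finset.sum_mul]
    rw [← Finset.sum_product' Finset.univ (k.support.image Prod.snd)
      (fun j p => -((k (j, p) : ℝ) * Real.log (p : ℕ)) * γ j τ)]
    -- Enlarging the support to a rectangle lets the sum be grouped by `j`; the added terms have
    -- coefficient `0`.
    refine Finset.sum_subset (fun i hi => ?_) fun i _ hi => ?_
    · exact Finset.mem_product.2 ⟨Finset.mem_univ _, Finset.mem_image_of_mem _ hi⟩
    · rw [Finsupp.notMem_support_iff.1 hi]; simp
  rw [h1, h2, Circle.coe_exp, mul_comm]

theorem exists_continuousOn_orbit {γ : Fin r → ℝ → ℝ} (hγ : ∀ j, IsShift (γ j)) :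
    ∃ T₀ : ℝ, 0 < T₀ ∧ (∀ j, ContinuousOn (γ j) (Set.Ici T₀)) ∧
      ContinuousOn (orbit γ) (Set.Ici T₀) := by
  choose T α h using fun j => (hγ j).exists_shiftBounds
  -- A common threshold for all shifts; the summand `1` keeps it positive also when `r = 0`.
  have hle : ∀ j, T j ≤ 1 + ∑ j, T j := fun j => by
    have := Finset.single_le_sum (f := T) (fun i _ => (h i).T₀_pos.le) (Finset.mem_univ j)
    linarith
  have hc : ∀ j, ContinuousOn (γ j) (Set.Ici (1 + ∑ j, T j)) := fun j =>
    (h j).continuousOn.mono (Set.Ici_subset_Ici.2 (hle j))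
  refine ⟨1 + ∑ j, T j, ?_, hc, ?_⟩
  · have := Finset.sum_nonneg fun j (_ : j ∈ Finset.univ) => (h j).T₀_pos.le
    linarith
  · refine continuousOn_pi.2 fun j => continuousOn_pi.2 fun p => ?_
    exact Circle.exp.continuous.comp_continuousOn ((hc j).mul continuousOn_const).neg

/-- Independence of the logarithms of the primes makes the coefficients of the phase nonzero.
Admissibility then supplies a phase derivative that is monotonic and bounded away from `0`, so the
integral is at most `4 / m` for every large `T`. -/
theorem tendsto_mean_torusChar {γ : Fin r → ℝ → ℝ} (hγ : IsAdmissible γ)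
    {k : (Fin r × Nat.Primes) →₀ ℤ} (hk : k ≠ 0) :
    Tendsto (fun T : ℝ => (T : ℂ)⁻¹ * ∫ τ in T..2 * T, (torusChar k (orbit γ τ) : ℂ)) atTop
      (𝓝 0) := by
  choose T₀ α h using fun j => (hγ.1 j).exists_shiftBounds
  set c : Fin r → ℝ := fun j =>
    ∑ p ∈ k.support.image Prod.snd, -((k (j, p) : ℝ) * Real.log (p : ℕ)) with hc
  have hc0 : c ≠ 0 := by
    intro h0
    refine hk (Finsupp.ext fun i => ?_)
    by_contra hi
    have h1 := congrFun h0 i.1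
    simp only [hc, Finset.sum_neg_distrib, Pi.zero_apply, neg_eq_zero] at h1
    exact hi (eq_zero_of_sum_mul_log_eq_zero _ (fun p => k (i.1, p)) h1 i.2
      (Finset.mem_image_of_mem _ (Finsupp.mem_support_iff.2 hi)))
  obtain ⟨m, T₁, hm, hT₁, hmono, hbd⟩ := hγ.2 c hc0
  set φ : ℝ → ℝ := fun τ => ∑ j, c j * γ j τ with hφ
  set φ₁ : ℝ → ℝ := fun τ => ∑ j, c j * deriv (γ j) τ with hφ₁
  set φ₂ : ℝ → ℝ := fun τ => ∑ j, c j * deriv (deriv (γ j)) τ with hφ₂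
  set A : ℝ := T₁ + ∑ j, T₀ j with hA
  have hAT : ∀ j, T₀ j ≤ A := fun j => by
    have := Finset.single_le_sum (f := T₀) (fun i _ => (h i).T₀_pos.le) (Finset.mem_univ j)
    simp only [hA]; linarith
  have hAT₁ : T₁ ≤ A := by
    have := Finset.sum_nonneg fun j (_ : j ∈ Finset.univ) => (h j).T₀_pos.le
    simp only [hA]; linarith
  have d1 : ∀ τ, A < τ → HasDerivAt φ (φ₁ τ) τ := fun τ hτ =>
    HasDerivAt.fun_sum fun j _ => ((h j).hasDerivAt τ ((hAT j).trans_lt hτ)).const_mul (c j)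
  have d2 : ∀ τ, A < τ → HasDerivAt φ₁ (φ₂ τ) τ := fun τ hτ =>
    HasDerivAt.fun_sum fun j _ => ((h j).hasDerivAt_deriv τ ((hAT j).trans_lt hτ)).const_mul (c j)
  have hbound : ∀ T, A < T → ‖∫ τ in T..2 * T, (torusChar k (orbit γ τ) : ℂ)‖ ≤ 4 / m := by
    intro T hT
    have hT0 : 0 < T := hT₁.trans (hAT₁.trans_lt hT)
    simp_rw [torusChar_orbit]
    refine norm_integral_cexp_le (φ₁ := φ₁) (φ₂ := φ₂) (by linarith) hm
      (fun x hx => d1 x (hT.trans_le hx.1)) (fun x hx => d2 x (hT.trans_le hx.1)) ?_ ?_ ?_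
    · exact continuousOn_finsetSum _ fun j _ => continuousOn_const.mul
        ((h j).continuousOn_deriv2.mono fun x hx => ((hAT j).trans_lt hT).trans_le hx.1)
    · rcases hmono with hmono | hanti
      · left
        exact fun x hx => hasDerivAt_nonneg_of_monotoneOn hmono
          (hAT₁.trans_lt (hT.trans_le hx.1)) (d2 x (hT.trans_le hx.1))
      · right
        intro x hx
        have := hasDerivAt_nonneg_of_monotoneOn hanti.neg
          (hAT₁.trans_lt (hT.trans_le hx.1)) (d2 x (hT.trans_le hx.1)).neg
        linarith
    · intro x hx
      have hx1 : T₁ < x := hAT₁.trans_lt (hT.trans_le hx.1)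
      rcases hbd with hb | hb
      · exact (hb x hx1).le.trans (le_abs_self _)
      · have := hb x hx1
        exact (by linarith : m ≤ -φ₁ x).trans (neg_le_abs _)
  have hlim : Tendsto (fun T : ℝ => T⁻¹ * (4 / m)) atTop (𝓝 0) := by
    simpa using tendsto_inv_atTop_zero.mul_const (4 / m)
  refine squeeze_zero_norm' ?_ hlim
  filter_upwards [eventually_gt_atTop A] with T hT
  have hT0 : 0 < T := hT₁.trans (hAT₁.trans_lt hT)
  rw [norm_mul, norm_inv, Complex.norm_real, Real.norm_of_nonneg hT0.le]
  gcongr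
  exact hbound T hT

/-- The curve `orbit γ` is equidistributed in the product of tori. -/
theorem tendsto_mean_orbit {γ : Fin r → ℝ → ℝ} (hγ : IsAdmissible γ) (h : C(Fin r → Torus, ℂ)) :
    Tendsto (fun T : ℝ => (T : ℂ)⁻¹ * ∫ τ in T..2 * T, h (orbit γ τ)) atTop
      (𝓝 (∫ ω, h ω ∂(haar r))) := by
  obtain ⟨T₀, hT₀, -, hcont⟩ := exists_continuousOn_orbit hγ.1
  have hii : ∀ f : C(Fin r → Torus, ℂ), ∀ T, T₀ ≤ T →
      IntervalIntegrable (fun τ => f (orbit γ τ)) volume T (2 * T) := fun f T hT => by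
    refine ContinuousOn.intervalIntegrable ?_
    rw [Set.uIcc_of_le (by linarith)]
    exact f.continuous.comp_continuousOn (hcont.mono fun x hx => hT.trans hx.1)
  have hint : ∀ f : C(Fin r → Torus, ℂ), Integrable (fun ω => f ω) (haar r) := fun f =>
    f.continuous.integrable_of_hasCompactSupport (HasCompactSupport.of_compactSpace _)
  have hspan : ∀ f ∈ Submodule.span ℂ (charSubmonoid r : Set C(Fin r → Torus, ℂ)),
      Tendsto (fun T : ℝ => (T : ℂ)⁻¹ * ∫ τ in T..2 * T, f (orbit γ τ)) atTop
      (𝓝 (∫ ω, f ω ∂(haar r))) := by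
    intro f hf
    induction hf using Submodule.span_induction with
    | mem f hf =>
      obtain ⟨k, hk⟩ := hf
      simp_rw [hk]
      by_cases h0 : k = 0
      · subst h0
        simp only [torusChar, Finsupp.prod_zero_index, Circle.coe_one, integral_const, probReal_univ,
          one_smul, intervalIntegral.integral_const]
        refine tendsto_const_nhds.congr' ?_
        filter_upwards [eventually_gt_atTop 0] with T hT
        have : (T : ℂ) ≠ 0 := by exact_mod_cast hT.ne'
        rw [show 2 * T - T = T by ring, Complex.real_smul, mul_one, inv_mul_cancel₀ this]
      · rw [integral_torusChar_eq_zero h0]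
        exact tendsto_mean_torusChar hγ h0
    | zero => simp
    | add f g _ _ ihf ihg =>
      simp only [ContinuousMap.add_apply]
      rw [integral_add (hint f) (hint g)]
      refine (ihf.add ihg).congr' ?_
      filter_upwards [eventually_ge_atTop T₀] with T hT
      rw [intervalIntegral.integral_add (hii f T hT) (hii g T hT), mul_add]
    | smul c f _ ih =>
      simp only [ContinuousMap.smul_apply, smul_eq_mul]
      rw [integral_const_mul]
      simp_rw [intervalIntegral.integral_const_mul]
      simpa only [mul_left_comm] using ih.const_mul c
  rw [Metric.tendsto_atTop]
  intro ε hε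
  have hmem : h ∈ (Submodule.span ℂ
      (charSubmonoid r : Set C(Fin r → Torus, ℂ))).topologicalClosure := by
    rw [dense_span_charSubmonoid]; trivial
  rw [← SetLike.mem_coe, Submodule.topologicalClosure_coe, Metric.mem_closure_iff] at hmem
  -- Replacing `h` by a combination of characters within `ε / 3` in the uniform norm changes the
  -- mean along the curve and the Haar integral by at most `ε / 3` each.
  obtain ⟨g, hg, hd⟩ := hmem (ε / 3) (by positivity)
  have hdp : ∀ ω, ‖h ω - g ω‖ ≤ ε / 3 := fun ω => by
    rw [← dist_eq_norm]
    exact (ContinuousMap.dist_apply_le_dist ω).trans hd.le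
  obtain ⟨T₁, hT₁⟩ := Metric.tendsto_atTop.1 (hspan g hg) (ε / 3) (by positivity)
  refine ⟨max T₀ T₁, fun T hT => ?_⟩
  have hT0 : T₀ ≤ T := (le_max_left _ _).trans hT
  have hTp : 0 < T := hT₀.trans_le hT0
  have b1 : ‖(T : ℂ)⁻¹ * (∫ τ in T..2 * T, h (orbit γ τ)) -
      (T : ℂ)⁻¹ * ∫ τ in T..2 * T, g (orbit γ τ)‖ ≤ ε / 3 := by
    rw [← mul_sub, ← intervalIntegral.integral_sub (hii h T hT0) (hii g T hT0), norm_mul, norm_inv,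
      Complex.norm_real, Real.norm_of_nonneg hTp.le]
    have := intervalIntegral.norm_integral_le_of_norm_le_const (a := T) (b := 2 * T) (C := ε / 3)
      (f := fun τ => h (orbit γ τ) - g (orbit γ τ)) (fun τ _ => hdp _)
    rw [show 2 * T - T = T by ring, abs_of_pos hTp] at this
    rw [inv_mul_le_iff₀ hTp]
    linarith
  have b2 : ‖∫ ω, g ω ∂(haar r) - ∫ ω, h ω ∂(haar r)‖ ≤ ε / 3 := by
    rw [← integral_sub (hint g) (hint h)]
    have := norm_integral_le_of_norm_le_const (μ := haar r) (C := ε / 3)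
      (f := fun ω => g ω - h ω) (Eventually.of_forall fun ω => by
        rw [norm_sub_rev]; exact hdp ω)
    simpa using this
  have b3 := hT₁ T ((le_max_right _ _).trans hT)
  rw [dist_eq_norm] at b3 ⊢
  have hsum : (T : ℂ)⁻¹ * (∫ τ in T..2 * T, h (orbit γ τ)) - ∫ ω, h ω ∂(haar r) =
      ((T : ℂ)⁻¹ * (∫ τ in T..2 * T, h (orbit γ τ)) -
        (T : ℂ)⁻¹ * ∫ τ in T..2 * T, g (orbit γ τ)) +
      ((T : ℂ)⁻¹ * (∫ τ in T..2 * T, g (orbit γ τ)) - ∫ ω, g ω ∂(haar r)) +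
      (∫ ω, g ω ∂(haar r) - ∫ ω, h ω ∂(haar r)) := by ring
  rw [hsum]
  exact (norm_add₃_le).trans_lt (by linarith)

theorem tendsto_mean_orbit_real {γ : Fin r → ℝ → ℝ} (hγ : IsAdmissible γ)
    {h : (Fin r → Torus) → ℝ} (hh : Continuous h) :
    Tendsto (fun T : ℝ => T⁻¹ * ∫ τ in T..2 * T, h (orbit γ τ)) atTop
      (𝓝 (∫ ω, h ω ∂(haar r))) := by
  have := tendsto_mean_orbit hγ ⟨fun ω => (h ω : ℂ), by fun_prop⟩
  simp only [ContinuousMap.coe_mk, intervalIntegral.integral_ofReal, integral_complex_ofReal] at this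
  have h2 := (Complex.continuous_re.tendsto _).comp this
  refine h2.congr fun T => ?_
  simp only [Function.comp]
  rw [← Complex.ofReal_inv, ← Complex.ofReal_mul, Complex.ofReal_re]

/-! ### The Haar measure on the torus as a product measure -/

/-- The probability Haar measure of the circle. -/
def circleHaar : Measure Circle := Measure.haarMeasure ⊤

instance : IsProbabilityMeasure circleHaar :=
  ⟨by simpa [circleHaar] using
    Measure.haarMeasure_self (K₀ := (⊤ : TopologicalSpace.PositiveCompacts Circle))⟩

instance : circleHaar.IsMulLeftInvariant := by unfold circleHaar; infer_instance

theorem isHaarMeasure_of_isMulLeftInvariant {G : Type*} [TopologicalSpace G] [Group G]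
    [IsTopologicalGroup G] [CompactSpace G] [MeasurableSpace G] [BorelSpace G] (μ : Measure G)
    [IsProbabilityMeasure μ] [μ.IsMulLeftInvariant] : μ.IsHaarMeasure := by
  have := isOpenPosMeasure_of_mulLeftInvariant_of_compact (μ := μ) Set.univ isCompact_univ (by simp)
  exact { }

/-- Both sides are translation-invariant probability measures on the compact group, hence equal. The
product form makes the coordinates `ω(p)` independent. -/
theorem map_eval_haar {r : ℕ} (j : Fin r) :
    (haar r).map (fun ω => ω j) = Measure.infinitePi fun _ : Nat.Primes => circleHaar := by
  have hm : Measurable fun ω : Fin r → Torus => ω j := measurable_pi_apply j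
  have hp : IsProbabilityMeasure ((haar r).map (fun ω => ω j)) :=
    Measure.isProbabilityMeasure_map hm.aemeasurable
  have i1 : ((haar r).map (fun ω => ω j)).IsMulLeftInvariant := by
    have : (haar r).IsMulLeftInvariant := by unfold haar; infer_instance
    refine ⟨fun g => ?_⟩
    have h1 := map_mul_left_eq_self (haar r) (fun _ => g)
    conv_rhs => rw [← h1]
    rw [Measure.map_map (measurable_const_mul g) hm, Measure.map_map hm (measurable_const_mul _)]
    rfl
  have i2 : (Measure.infinitePi fun _ : Nat.Primes => circleHaar).IsMulLeftInvariant := by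
    refine ⟨fun g => ?_⟩
    have := Measure.infinitePi_map_pi (μ := fun _ : Nat.Primes => circleHaar)
      (f := fun p z => g p * z) (fun p => measurable_const_mul (g p))
    simp only [map_mul_left_eq_self] at this
    exact this
  have h1 := isHaarMeasure_of_isMulLeftInvariant ((haar r).map (fun ω => ω j))
  have h2 := isHaarMeasure_of_isMulLeftInvariant
    (Measure.infinitePi fun _ : Nat.Primes => circleHaar)
  exact Measure.isHaarMeasure_eq_of_isProbabilityMeasure _ _

/-- Invariance under the half-turn; it serves to centre the real and imaginary parts of `ω(p)`. -/
theorem integral_circleHaar_eq_zero {g : Circle → ℝ}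
    (hg : ∀ z, g (Circle.exp Real.pi * z) = -g z) : ∫ z, g z ∂circleHaar = 0 := by
  have := integral_mul_left_eq_self (μ := circleHaar) g (Circle.exp Real.pi)
  simp_rw [hg, integral_neg] at this
  linarith

/-! ### Almost sure convergence of random series -/

/-- Partial sums of independent centred variables form a martingale. Their variances add up to at
most `∑ c_k²`, so the martingale is bounded in `L²`, hence in `L¹`, and Doob's theorem applies. -/
theorem ae_exists_tendsto_sum_of_iIndepFun {Ω : Type*} [MeasurableSpace Ω] {μ : Measure Ω}
    [IsProbabilityMeasure μ] {X : ℕ → Ω → ℝ} (hX : ∀ k, StronglyMeasurable (X k))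
    (hind : ProbabilityTheory.iIndepFun X μ) (hmean : ∀ k, ∫ ω, X k ω ∂μ = 0) {c : ℕ → ℝ}
    (hb : ∀ k ω, |X k ω| ≤ c k) (hc : Summable fun k => c k ^ 2) :
    ∀ᵐ ω ∂μ, ∃ l, Tendsto (fun n => ∑ k ∈ Finset.range n, X k ω) atTop (𝓝 l) := by
  set ℱ := Filtration.natural X hX with hℱ
  -- The sum runs over `k ≤ n`, so that `S n` is measurable for the `σ`-algebra of `X 0, …, X n`;
  -- the index shift is undone at the end.
  set S : ℕ → Ω → ℝ := fun n => ∑ k ∈ Finset.range (n + 1), X k with hS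
  have hXi : ∀ k, Integrable (X k) μ := fun k =>
    Integrable.of_bound (hX k).aestronglyMeasurable (c k) (Eventually.of_forall (hb k))
  have hSi : ∀ n, Integrable (S n) μ := fun n => integrable_finsetSum' _ fun k _ => hXi k
  have hadp : StronglyAdapted ℱ S := fun n => by
    refine Finset.stronglyMeasurable_sum _ fun k hk => ?_
    exact ((Filtration.stronglyAdapted_natural hX) k).mono
      (ℱ.mono (Nat.lt_succ_iff.1 (Finset.mem_range.1 hk)))
  have hmart : Martingale S ℱ μ := by
    refine martingale_nat hadp hSi fun n => ?_
    have h1 : S (n + 1) = S n + X (n + 1) := by simp only [hS]; rw [Finset.sum_range_succ]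
    rw [h1]
    have h2 := condExp_add (hSi n) (hXi (n + 1)) (ℱ n)
    have h3 := ProbabilityTheory.iIndepFun.condExp_natural_ae_eq_of_lt hX hind (Nat.lt_succ_self n)
    have h4 := condExp_of_stronglyMeasurable (ℱ.le n) (hadp n) (hSi n)
    filter_upwards [h2, h3] with ω h2 h3
    rw [h2, Pi.add_apply, h4, h3, hmean, add_zero]
  have hL2 : ∀ k, MemLp (X k) 2 μ := fun k =>
    MemLp.of_bound (hX k).aestronglyMeasurable (c k) (Eventually.of_forall (hb k))
  have hsq : ∀ n, ∫ ω, S n ω ^ 2 ∂μ ≤ ∑' k, c k ^ 2 := fun n => by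
    have hm0 : ∫ ω, S n ω ∂μ = 0 := by
      simp only [hS, Finset.sum_apply]
      rw [integral_finsetSum _ fun k _ => hXi k]
      exact Finset.sum_eq_zero fun k _ => hmean k
    rw [← ProbabilityTheory.variance_of_integral_eq_zero (hSi n).aemeasurable hm0,
      ProbabilityTheory.IndepFun.variance_sum (fun k _ => hL2 k)
        (fun i _ j _ hij => hind.indepFun hij)]
    refine (Finset.sum_le_sum fun k _ => ?_).trans
      (hc.sum_le_tsum _ fun k _ => sq_nonneg _)
    rw [ProbabilityTheory.variance_of_integral_eq_zero (hX k).measurable.aemeasurable (hmean k)]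
    have := integral_mono_of_nonneg (μ := μ) (f := fun ω => X k ω ^ 2) (g := fun _ => c k ^ 2)
      (Eventually.of_forall fun ω => sq_nonneg _) (integrable_const _)
      (Eventually.of_forall fun ω => by
        simp only
        rw [← sq_abs (X k ω)]
        exact pow_le_pow_left₀ (abs_nonneg _) (hb k ω) 2)
    simpa using this
  have hbdd : ∀ n, eLpNorm (S n) 1 μ ≤ ((1 + ∑' k, c k ^ 2).toNNReal : ENNReal) := fun n => by
    rw [eLpNorm_one_eq_lintegral_enorm, ← ofReal_integral_norm_eq_lintegral_enorm (hSi n)]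
    refine ENNReal.ofReal_le_ofReal ?_
    have hS2 : Integrable (fun ω => S n ω ^ 2) μ :=
      (memLp_finsetSum' _ fun k _ => hL2 k : MemLp (S n) 2 μ).integrable_sq
    calc ∫ ω, ‖S n ω‖ ∂μ ≤ ∫ ω, (1 + S n ω ^ 2) ∂μ := by
          refine integral_mono (hSi n).norm ((integrable_const 1).add hS2) fun ω => ?_
          simp only [Real.norm_eq_abs]
          rw [← sq_abs]
          nlinarith [sq_nonneg (|S n ω| - 1), abs_nonneg (S n ω)]
      _ = 1 + ∫ ω, S n ω ^ 2 ∂μ := by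
          rw [integral_add (integrable_const 1) hS2]; simp
      _ ≤ _ := by gcongr; exact hsq n
  filter_upwards [hmart.submartingale.exists_ae_tendsto_of_bdd hbdd] with ω ⟨l, hl⟩
  refine ⟨l, (tendsto_add_atTop_iff_nat 1).1 (hl.congr fun n => ?_)⟩
  simp [hS]

theorem summable_nth_prime_rpow {β : ℝ} (hβ : 1 / 2 < β) :
    Summable fun k : ℕ => ((Nat.nth Nat.Prime k : ℝ) ^ (-β)) ^ 2 := by
  have h := (summable_sq hβ).comp_injective (Nat.nth_injective Nat.infinite_setOfPred_prime)
  refine h.congr fun k => ?_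
  simp only [Function.comp]
  rw [← Real.rpow_natCast, ← Real.rpow_mul (by positivity)]
  congr 1; push_cast; ring

/-- The terms are independent, centred and bounded by `p^(-β)`, whose squares are summable. The
convergence need not be absolute, so the primes are enumerated in increasing order. -/
theorem ae_exists_tendsto_sum_nth_prime {β : ℝ} (hβ : 1 / 2 < β) {g : Circle → ℝ}
    (hgc : Continuous g) (hg1 : ∀ z, |g z| ≤ 1) (hg : ∀ z, g (Circle.exp Real.pi * z) = -g z) :
    ∀ᵐ ω ∂(Measure.infinitePi fun _ : Nat.Primes => circleHaar), ∃ l,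
      Tendsto (fun n => ∑ k ∈ Finset.range n,
        g (ω ⟨Nat.nth Nat.Prime k, Nat.prime_nth_prime k⟩) * (Nat.nth Nat.Prime k : ℝ) ^ (-β))
        atTop (𝓝 l) := by
  set q : ℕ → Nat.Primes := fun k => ⟨Nat.nth Nat.Prime k, Nat.prime_nth_prime k⟩ with hq
  have hqi : Function.Injective q := fun i j h =>
    Nat.nth_injective Nat.infinite_setOfPred_prime (congrArg Subtype.val h)
  have hgm : ∀ p : Nat.Primes, Measurable fun z : Circle => g z * ((p : ℕ) : ℝ) ^ (-β) :=
    fun p => hgc.measurable.mul_const _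
  set μ := Measure.infinitePi fun _ : Nat.Primes => circleHaar with hμ
  have hind : ProbabilityTheory.iIndepFun
      (fun (p : Nat.Primes) (ω : Torus) => g (ω p) * ((p : ℕ) : ℝ) ^ (-β)) μ :=
    ProbabilityTheory.iIndepFun_infinitePi (P := fun _ : Nat.Primes => circleHaar)
      (X := fun p z => g z * ((p : ℕ) : ℝ) ^ (-β)) hgm
  have hind' := hind.precomp hqi
  have hmeas : ∀ k, StronglyMeasurable
      fun ω : Torus => g (ω (q k)) * ((q k : ℕ) : ℝ) ^ (-β) := fun k =>
    ((hgm (q k)).comp (measurable_pi_apply (q k))).stronglyMeasurable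
  have hmean : ∀ k, ∫ ω : Torus, g (ω (q k)) * ((q k : ℕ) : ℝ) ^ (-β) ∂μ = 0 := fun k => by
    rw [integral_mul_const]
    have h1 : ∫ ω : Torus, g (ω (q k)) ∂μ = ∫ z, g z ∂circleHaar := by
      conv_rhs => rw [← Measure.infinitePi_map_eval (fun _ : Nat.Primes => circleHaar) (q k)]
      rw [integral_map (measurable_pi_apply _).aemeasurable hgc.measurable.aestronglyMeasurable]
    rw [h1, integral_circleHaar_eq_zero hg, zero_mul]
  have hbd : ∀ k (ω : Torus), |g (ω (q k)) * ((q k : ℕ) : ℝ) ^ (-β)| ≤ ((q k : ℕ) : ℝ) ^ (-β) :=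
    fun k ω => by
      rw [abs_mul, abs_of_nonneg (Real.rpow_nonneg (Nat.cast_nonneg _) _)]
      exact mul_le_of_le_one_left (Real.rpow_nonneg (Nat.cast_nonneg _) _) (hg1 _)
  exact ae_exists_tendsto_sum_of_iIndepFun hmeas hind' hmean hbd (summable_nth_prime_rpow hβ)

/-- The coefficients of the random Dirichlet series over the primes. -/
def primeCoeff (ω : Torus) (β : ℝ) (n : ℕ) : ℂ :=
  if h : n.Prime then (ω ⟨n, h⟩ : ℂ) * ((n : ℝ) ^ (-β) : ℝ) else 0

theorem sum_primeCoeff (ω : Torus) (β : ℝ) (N : ℕ) :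
    ∑ n ∈ Finset.range N, primeCoeff ω β n = ∑ k ∈ Finset.range (Nat.primeCounting' N),
      (ω ⟨Nat.nth Nat.Prime k, Nat.prime_nth_prime k⟩ : ℂ) *
        ((Nat.nth Nat.Prime k : ℝ) ^ (-β) : ℝ) := by
  have h : ∀ k, (ω ⟨Nat.nth Nat.Prime k, Nat.prime_nth_prime k⟩ : ℂ) *
      ((Nat.nth Nat.Prime k : ℝ) ^ (-β) : ℝ) = primeCoeff ω β (Nat.nth Nat.Prime k) := fun k => by
    rw [primeCoeff, dif_pos (Nat.prime_nth_prime k)]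
  simp_rw [h]
  unfold Nat.primeCounting'
  induction N with
  | zero => simp
  | succ N ih =>
    rw [Finset.sum_range_succ, ih, Nat.count_succ]
    split_ifs with hN
    · rw [Finset.sum_range_succ, Nat.nth_count hN]
    · rw [primeCoeff, dif_neg hN, add_zero, add_zero]

theorem ae_exists_tendsto_sum_primeCoeff {β : ℝ} (hβ : 1 / 2 < β) :
    ∀ᵐ ω ∂(Measure.infinitePi fun _ : Nat.Primes => circleHaar), ∃ l,
      Tendsto (fun N => ∑ n ∈ Finset.range N, primeCoeff ω β n) atTop (𝓝 l) := by
  have hexp : ∀ z : Circle, ((Circle.exp Real.pi * z : Circle) : ℂ) = -z := fun z => by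
    rw [Circle.coe_mul, Circle.coe_exp, Complex.exp_pi_mul_I, neg_one_mul]
  filter_upwards [ae_exists_tendsto_sum_nth_prime hβ (g := fun z => (z : ℂ).re) (by fun_prop)
    (fun z => (Complex.abs_re_le_norm (z : ℂ)).trans (Circle.norm_coe z).le) (fun z => by rw [hexp]; simp),
    ae_exists_tendsto_sum_nth_prime hβ (g := fun z => (z : ℂ).im) (by fun_prop)
    (fun z => (Complex.abs_im_le_norm (z : ℂ)).trans (Circle.norm_coe z).le) (fun z => by rw [hexp]; simp)]
    with ω ⟨x, hx⟩ ⟨y, hy⟩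
  refine ⟨x + y * Complex.I, ?_⟩
  simp_rw [sum_primeCoeff]
  have h1 := ((Complex.continuous_ofReal.tendsto x).comp hx).add
    (((Complex.continuous_ofReal.tendsto y).comp hy).mul_const Complex.I)
  refine Tendsto.comp (g := fun n => ∑ k ∈ Finset.range n,
    (ω ⟨Nat.nth Nat.Prime k, Nat.prime_nth_prime k⟩ : ℂ) *
      ((Nat.nth Nat.Prime k : ℝ) ^ (-β) : ℝ)) (h1.congr fun n => ?_) Nat.tendsto_primeCounting'
  simp only [Function.comp, Complex.ofReal_sum, Finset.sum_mul]
  rw [← Finset.sum_add_distrib]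
  refine Finset.sum_congr rfl fun k _ => ?_
  rw [Complex.ofReal_mul, Complex.ofReal_mul]
  conv_rhs => rw [← Complex.re_add_im (ω ⟨Nat.nth Nat.Prime k, Nat.prime_nth_prime k⟩ : ℂ)]
  ring

/-! ### Convergence of the random Euler products -/

theorem sum_Ico_mul_eq (a b : ℕ → ℂ) {m N : ℕ} (h : m ≤ N) :
    ∑ n ∈ Finset.Ico m N, a n * b n = (∑ n ∈ Finset.Ico m N, a n) * b N +
      ∑ n ∈ Finset.Ico m N, (∑ k ∈ Finset.Ico m (n + 1), a k) * (b n - b (n + 1)) := by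
  induction N, h using Nat.le_induction with
  | base => simp
  | succ N h ih =>
    rw [Finset.sum_Ico_succ_top h, ih, Finset.sum_Ico_succ_top h, Finset.sum_Ico_succ_top h,
      Finset.sum_Ico_succ_top h]
    ring

theorem norm_sum_Ico_mul_le (a b : ℕ → ℂ) {m N : ℕ} (h : m ≤ N) {ε : ℝ}
    (ha : ∀ k, m ≤ k → ‖∑ n ∈ Finset.Ico m k, a n‖ ≤ ε) :
    ‖∑ n ∈ Finset.Ico m N, a n * b n‖ ≤
      ε * (‖b N‖ + ∑ n ∈ Finset.Ico m N, ‖b n - b (n + 1)‖) := by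
  rw [sum_Ico_mul_eq a b h, mul_add, Finset.mul_sum]
  refine (norm_add_le _ _).trans (add_le_add ?_ ((norm_sum_le _ _).trans
    (Finset.sum_le_sum fun n hn => ?_)))
  · rw [norm_mul]
    exact mul_le_mul_of_nonneg_right (ha N h) (norm_nonneg _)
  · rw [norm_mul]
    have := (Finset.mem_Ico.1 hn).1
    exact mul_le_mul_of_nonneg_right (ha (n + 1) (by omega)) (norm_nonneg _)

theorem norm_natCast_cpow_sub_le {n : ℕ} (hn : 1 ≤ n) {w : ℂ} (hw : 0 ≤ w.re) :
    ‖(n : ℂ) ^ (-w) - ((n + 1 : ℕ) : ℂ) ^ (-w)‖ ≤ ‖w‖ * (n : ℝ) ^ (-(1 + w.re)) := by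
  have hn0 : (0 : ℝ) < n := by exact_mod_cast hn
  have := (convex_Icc (n : ℝ) (n + 1 : ℕ)).norm_image_sub_le_of_norm_hasDerivWithin_le
    (f := fun v : ℝ => (v : ℂ) ^ (-w)) (f' := fun v : ℝ => -w * (v : ℂ) ^ (-w - 1))
    (C := ‖w‖ * (n : ℝ) ^ (-(1 + w.re))) (x := ((n + 1 : ℕ) : ℝ)) (y := n)
    (fun v hv => (hasDerivAt_ofReal_cpow (hn0.trans_le hv.1) _).hasDerivWithinAt)
    (fun v hv => by
      have hv0 : 0 < v := hn0.trans_le hv.1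
      rw [norm_mul, norm_neg, Complex.norm_cpow_eq_rpow_re_of_pos hv0]
      gcongr
      rw [show (-w - 1).re = -(1 + w.re) by simp; ring]
      exact Real.rpow_le_rpow_of_nonpos hn0 hv.1 (by linarith))
    (Set.right_mem_Icc.2 (by push_cast; linarith)) (Set.left_mem_Icc.2 (by push_cast; linarith))
  simpa using this

/-- Summation by parts: the total variation of `n ↦ n^(-w)` is at most `|w| ∑ n^(-1-δ)`, so the
Cauchy property of `∑ a_n` passes to the twisted series uniformly for bounded `w` with `Re w ≥ δ`.
-/
theorem norm_sum_Ico_mul_cpow_le (a : ℕ → ℂ) {m N : ℕ} (hm : 1 ≤ m) (h : m ≤ N) {ε : ℝ}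
    (ha : ∀ k, m ≤ k → ‖∑ n ∈ Finset.Ico m k, a n‖ ≤ ε) {w : ℂ} {δ R : ℝ} (hδ : 0 < δ)
    (hw : δ ≤ w.re) (hR : ‖w‖ ≤ R) :
    ‖∑ n ∈ Finset.Ico m N, a n * (n : ℂ) ^ (-w)‖ ≤
      ε * (1 + R * ∑' n : ℕ, (n : ℝ) ^ (-(1 + δ))) := by
  have hε : 0 ≤ ε := (norm_nonneg _).trans (ha m le_rfl)
  refine (norm_sum_Ico_mul_le a (fun n : ℕ => (n : ℂ) ^ (-w)) h ha).trans ?_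
  gcongr
  · rw [Complex.norm_natCast_cpow_of_pos (by omega)]
    exact Real.rpow_le_one_of_one_le_of_nonpos (by exact_mod_cast (by omega : 1 ≤ N))
      (by simp; linarith)
  · rw [← tsum_mul_left]
    refine le_trans (Finset.sum_le_sum fun n hn => ?_)
      (((Real.summable_nat_rpow.2 (by linarith)).mul_left R).sum_le_tsum (Finset.Ico m N)
        fun n _ => mul_nonneg ((norm_nonneg w).trans hR) (by positivity))
    have hn1 : 1 ≤ n := hm.trans (Finset.mem_Ico.1 hn).1
    refine (norm_natCast_cpow_sub_le hn1 (by linarith)).trans ?_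
    have hn1' : (1 : ℝ) ≤ n := by exact_mod_cast hn1
    have hR0 : 0 ≤ R := (norm_nonneg w).trans hR
    gcongr

/-! ### Logarithms of the Euler factors -/

theorem norm_coe_div_cpow (z : Circle) {n : ℕ} (hn : 0 < n) (s : ℂ) :
    ‖(z : ℂ) / (n : ℂ) ^ s‖ = (n : ℝ) ^ (-s.re) := by
  rw [norm_div, Circle.norm_coe, Complex.norm_natCast_cpow_of_pos hn, Real.rpow_neg (by positivity),
    one_div]

theorem norm_coe_div_cpow_lt_one (z : Circle) {n : ℕ} (hn : 2 ≤ n) {s : ℂ} (hs : 0 < s.re) :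
    ‖(z : ℂ) / (n : ℂ) ^ s‖ < 1 := by
  rw [norm_coe_div_cpow z (by omega)]
  exact Real.rpow_lt_one_of_one_lt_of_neg (by exact_mod_cast (by omega : 1 < n)) (by linarith)

/-- The logarithm of an Euler factor. -/
def logFactor (ω : Torus) (n : ℕ) (s : ℂ) : ℂ :=
  if h : n.Prime then Complex.log (1 - (ω ⟨n, h⟩ : ℂ) / (n : ℂ) ^ s)⁻¹ else 0

theorem exp_sum_logFactor (ω : Torus) (N : ℕ) {s : ℂ} (hs : 0 < s.re) :
    Complex.exp (∑ n ∈ Finset.range N, logFactor ω n s) = eulerFun ω N s := by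
  rw [Complex.exp_sum, eulerFun]
  refine Finset.prod_congr rfl fun n _ => ?_
  by_cases h : n.Prime
  · rw [logFactor, dif_pos h, dif_pos h,
      Complex.exp_log (inv_ne_zero (euler_factor_ne_zero _ h hs))]
  · rw [logFactor, dif_neg h, dif_neg h, Complex.exp_zero]

theorem continuousAt_logFactor (ω : Torus) (n : ℕ) {s : ℂ} (hs : 0 < s.re) :
    ContinuousAt (logFactor ω n) s := by
  unfold logFactor
  by_cases h : n.Prime
  · simp only [h, dif_pos]
    have h0 : (n : ℂ) ≠ 0 := by exact_mod_cast h.ne_zero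
    have h1 : ContinuousAt (fun z : ℂ => 1 - (ω ⟨n, h⟩ : ℂ) / (n : ℂ) ^ z) s :=
      continuousAt_const.sub (continuousAt_const.div
        (continuousAt_id.const_cpow (Or.inl h0)) (by simp [Complex.cpow_eq_zero_iff, h0]))
    refine (h1.inv₀ (euler_factor_ne_zero _ h hs)).clog ?_
    change (1 - (ω ⟨n, h⟩ : ℂ) / (n : ℂ) ^ s)⁻¹ ∈ Complex.slitPlane
    -- Since `|ω(p) / p^s| < 1`, the factor avoids the negative real axis, and so does its inverse.
    have h2 : 1 - (ω ⟨n, h⟩ : ℂ) / (n : ℂ) ^ s ∈ Complex.slitPlane := by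
      rw [sub_eq_add_neg]
      exact Complex.mem_slitPlane_of_norm_lt_one (by
        rw [norm_neg]; exact norm_coe_div_cpow_lt_one _ h.two_le hs)
    rw [Complex.mem_slitPlane_iff] at h2 ⊢
    have hpos := Complex.normSq_pos.2 (euler_factor_ne_zero (ω ⟨n, h⟩) h hs)
    rw [Complex.inv_re, Complex.inv_im]
    rcases h2 with h2 | h2
    · left; positivity
    · right; exact div_ne_zero (neg_ne_zero.2 h2) hpos.ne'
  · simp only [h, dif_neg, not_false_iff]
    exact continuousAt_const

/-- With `z = ω(p) / p^s`, the difference is `-log(1 - z) - z = O(|z|²)`, and `|z|² ≤ p^(-2β)` is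
summable. The random linear terms alone need cancellation. -/
theorem norm_logFactor_sub_le (ω : Torus) (n : ℕ) {β : ℝ} (hβ : 1 / 2 < β) {s : ℂ}
    (hs : β ≤ s.re) :
    ‖logFactor ω n s - primeCoeff ω β n * (n : ℂ) ^ (-(s - β))‖ ≤ 2 * (n : ℝ) ^ (-(2 * β)) := by
  by_cases h : n.Prime
  · have hn0 : (n : ℂ) ≠ 0 := by exact_mod_cast h.ne_zero
    have hn2 : (2 : ℝ) ≤ n := by exact_mod_cast h.two_le
    set z : ℂ := (ω ⟨n, h⟩ : ℂ) / (n : ℂ) ^ s with hz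
    have h1 : primeCoeff ω β n * (n : ℂ) ^ (-(s - β)) = z := by
      rw [primeCoeff, dif_pos h, hz, div_eq_mul_inv, ← Complex.cpow_neg, mul_assoc,
        Complex.ofReal_cpow (by positivity), Complex.ofReal_natCast, ← Complex.cpow_add _ _ hn0]
      congr 2
      push_cast
      ring
    have h2 : ‖z‖ = (n : ℝ) ^ (-s.re) := norm_coe_div_cpow _ h.pos s
    have h3 : ‖z‖ ≤ (n : ℝ) ^ (-β) := by
      rw [h2]
      exact Real.rpow_le_rpow_of_exponent_le (by linarith) (by linarith)
    -- From `|z|² ≤ 1 / n ≤ 1 / 2 < 9 / 16`. It gives `(1 - |z|)⁻¹ ≤ 4`, whence the constant `4 / 2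
    -- = 2`.
    have h4 : ‖z‖ ≤ 3 / 4 := by
      have h5 : ‖z‖ ^ 2 ≤ 1 / 2 := by
        calc ‖z‖ ^ 2 = (n : ℝ) ^ (-(2 * s.re)) := by
              rw [h2, ← Real.rpow_natCast, ← Real.rpow_mul (by positivity)]
              congr 1; push_cast; ring
          _ ≤ (n : ℝ) ^ (-1 : ℝ) :=
              Real.rpow_le_rpow_of_exponent_le (by linarith) (by linarith)
          _ ≤ 1 / 2 := by
              rw [Real.rpow_neg_one, one_div]
              gcongr
      nlinarith [norm_nonneg z]
    rw [h1, logFactor, dif_pos h]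
    refine (Complex.norm_log_one_sub_inv_sub_self_le (by linarith)).trans ?_
    have h5 : ‖z‖ ^ 2 ≤ (n : ℝ) ^ (-(2 * β)) := by
      refine (pow_le_pow_left₀ (norm_nonneg _) h3 2).trans (le_of_eq ?_)
      rw [← Real.rpow_natCast, ← Real.rpow_mul (by positivity)]
      congr 1; push_cast; ring
    have h6 : (1 - ‖z‖)⁻¹ ≤ 4 := by
      rw [inv_le_comm₀ (by linarith) (by norm_num)]
      linarith
    have h7 : 0 ≤ (1 - ‖z‖)⁻¹ := inv_nonneg.2 (by linarith)
    calc ‖z‖ ^ 2 * (1 - ‖z‖)⁻¹ / 2 ≤ (n : ℝ) ^ (-(2 * β)) * 4 / 2 := by gcongr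
      _ = _ := by ring
  · rw [logFactor, primeCoeff, dif_neg h, dif_neg h]
    simp only [zero_mul, sub_zero, norm_zero]
    positivity

/-- The partial sums of the logarithms of the Euler factors satisfy a uniform Cauchy condition. -/
theorem exists_norm_sum_logFactor_le {ω : Torus} {β : ℝ} (hβ : 1 / 2 < β) {l : ℂ}
    (hω : Tendsto (fun N => ∑ n ∈ Finset.range N, primeCoeff ω β n) atTop (𝓝 l)) {δ R : ℝ}
    (hδ : 0 < δ) {ε : ℝ} (hε : 0 < ε) :
    ∃ N₀, ∀ m, N₀ ≤ m → ∀ N, m ≤ N → ∀ s : ℂ, β + δ ≤ s.re → ‖s - β‖ ≤ R →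
      ‖∑ n ∈ Finset.Ico m N, logFactor ω n s‖ ≤ ε := by
  set C : ℝ := 1 + |R| * ∑' n : ℕ, (n : ℝ) ^ (-(1 + δ)) with hC
  have hCp : 0 < C := by
    have : 0 ≤ ∑' n : ℕ, (n : ℝ) ^ (-(1 + δ)) := tsum_nonneg fun n => by positivity
    positivity
  -- The tolerance is divided by the constant of the Abel bound, so the linear terms contribute `ε /
  -- 2`. The other half comes from the quadratic errors, twice a tail below `ε / 4`.
  obtain ⟨N₁, hN₁⟩ := Metric.cauchySeq_iff.1 hω.cauchySeq (ε / 2 / C) (by positivity)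
  have ht := (tendsto_sqTail β).eventually_lt_const (u := ε / 4) (by positivity)
  obtain ⟨N₂, hN₂⟩ := eventually_atTop.1 ht
  refine ⟨max 1 (max N₁ N₂), fun m hm N hmN s hs hsR => ?_⟩
  have hm1 : 1 ≤ m := (le_max_left _ _).trans hm
  have hm2 : N₁ ≤ m := (le_max_left _ _).trans ((le_max_right _ _).trans hm)
  have hm3 : N₂ ≤ m := (le_max_right _ _).trans ((le_max_right _ _).trans hm)
  have h1 := norm_sum_Ico_mul_cpow_le (primeCoeff ω β) hm1 hmN (ε := ε / 2 / C) (w := s - β)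
    (δ := δ) (R := |R|) (fun k hk => by
      rw [Finset.sum_Ico_eq_sub _ hk, ← dist_eq_norm]
      exact (hN₁ k (hm2.trans hk) m hm2).le) hδ (by simp; linarith) (hsR.trans (le_abs_self R))
  rw [div_mul_cancel₀ _ hCp.ne'] at h1
  have h2 : ‖∑ n ∈ Finset.Ico m N, (logFactor ω n s -
      primeCoeff ω β n * (n : ℂ) ^ (-(s - β)))‖ ≤ ε / 2 := by
    refine (norm_sum_le _ _).trans ((Finset.sum_le_sum fun n _ =>
      norm_logFactor_sub_le ω n hβ (by linarith)).trans ?_)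
    rw [← Finset.mul_sum, Finset.sum_Ico_eq_sum_range]
    have h3 : ∑ k ∈ Finset.range (N - m), ((m + k : ℕ) : ℝ) ^ (-(2 * β)) ≤ sqTail β m := by
      simp_rw [add_comm m]
      exact ((summable_nat_add_iff m).2 (summable_sq hβ)).sum_le_tsum _ fun k _ => by positivity
    linarith [hN₂ m hm3]
  have h4 : ∑ n ∈ Finset.Ico m N, logFactor ω n s =
      ∑ n ∈ Finset.Ico m N, (logFactor ω n s - primeCoeff ω β n * (n : ℂ) ^ (-(s - β))) +
      ∑ n ∈ Finset.Ico m N, primeCoeff ω β n * (n : ℂ) ^ (-(s - β)) := by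
    rw [Finset.sum_sub_distrib]; ring
  rw [h4]
  exact (norm_add_le _ _).trans (by linarith)

section Hol

variable {U : TopologicalSpace.Opens ℂ}

/-- Weierstrass: locally uniform limits of holomorphic functions are holomorphic, so a limit found
in `C(U, ℂ)` lies in `Hol U`. -/
theorem hol_of_tendsto {f : ℕ → Hol U} {G : C(U, ℂ)}
    (h : Tendsto (fun n => (f n : C(U, ℂ))) atTop (𝓝 G)) :
    ∃ g : ℂ → ℂ, DifferentiableOn ℂ g U ∧ ∀ s : U, G s = g s := by
  classical
  choose F hF hfF using fun n => (f n).2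
  set g : ℂ → ℂ := fun s => if hs : s ∈ U then G ⟨s, hs⟩ else 0 with hg
  have hgG : ∀ s : U, G s = g s := fun s => by
    simp only [hg]; rw [dif_pos s.2]
  refine ⟨g, ?_, hgG⟩
  rw [ContinuousMap.tendsto_iff_tendstoLocallyUniformly] at h
  have h2 : TendstoLocallyUniformlyOn F g atTop (U : Set ℂ) := by
    rw [tendstoLocallyUniformlyOn_iff_tendstoLocallyUniformly_comp_coe]
    refine (h.congr fun n => ?_).congr_right ?_
    · exact fun s => hfF n s
    · exact fun s => hgG s
  exact h2.differentiableOn (Eventually.of_forall hF) U.isOpen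

/-- Criterion for the convergence of the Euler products on `U`. -/
theorem tendsto_euler_randomZeta (hU : (U : Set ℂ) ⊆ strip) {ω : Torus} {β : ℝ} (hβ : 1 / 2 < β)
    (hUβ : ∀ s ∈ U, β < s.re) {l : ℂ}
    (hω : Tendsto (fun N => ∑ n ∈ Finset.range N, primeCoeff ω β n) atTop (𝓝 l)) :
    Tendsto (euler U hU ω) atTop (𝓝 (randomZeta U hU ω)) := by
  have hpos : ∀ s : U, 0 < (s : ℂ).re := fun s => by have := (hU s.2).1; linarith
  -- Convergence is proved for the sums of logarithms, which are Cauchy in the complete space `C(U,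
  -- ℂ)`, and then transported by the exponential.
  set L : ℕ → C(U, ℂ) := fun N => ⟨fun s => ∑ n ∈ Finset.range N, logFactor ω n s, by
    refine continuous_finsetSum _ fun n _ => continuous_iff_continuousAt.2 fun s => ?_
    exact ContinuousAt.comp (f := ((↑) : U → ℂ)) (continuousAt_logFactor ω n (hpos s))
      continuous_subtype_val.continuousAt⟩ with hL
  have hcauchy : CauchySeq L := by
    rw [(Metric.uniformity_basis_dist_le (α := ℂ)).compactConvergenceUniformity.cauchySeq_iff']
    rintro ⟨K, ε⟩ ⟨hK, hε⟩
    simp only at hK hε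
    -- On a compact subset of `U` the continuous function `Re s - β` has a positive minimum.
    obtain ⟨δ, hδ, hδK⟩ : ∃ δ, 0 < δ ∧ ∀ s ∈ K, β + δ ≤ (s : ℂ).re := by
      rcases K.eq_empty_or_nonempty with rfl | hne
      · exact ⟨1, one_pos, fun s hs => absurd hs (Set.notMem_empty s)⟩
      · obtain ⟨s₀, hs₀, hmin⟩ := hK.exists_isMinOn hne
          (f := fun s : U => (s : ℂ).re) (by fun_prop)
        exact ⟨(s₀ : ℂ).re - β, by have := hUβ s₀ s₀.2; linarith, fun s hs => by
          have : (s₀ : ℂ).re ≤ (s : ℂ).re := hmin hs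
          linarith⟩
    obtain ⟨R, hR⟩ := hK.exists_bound_of_continuousOn (f := fun s : U => (s : ℂ) - β)
      (by fun_prop)
    obtain ⟨N₀, hN₀⟩ := exists_norm_sum_logFactor_le hβ hω (R := R) hδ hε
    refine ⟨N₀, fun N hN s hs => ?_⟩
    have := hN₀ N₀ le_rfl N hN s (hδK s hs) (hR s hs)
    simp only [hL, ContinuousMap.coe_mk, Set.mem_ofPred_eq]
    rw [dist_eq_norm, ← Finset.sum_Ico_eq_sub _ hN]
    exact this
  obtain ⟨A, hA⟩ := cauchySeq_tendsto_of_complete hcauchy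
  set e : C(ℂ, ℂ) := ⟨Complex.exp, Complex.continuous_exp⟩
  have hlim : Tendsto (fun N => ((euler U hU ω N : Hol U) : C(U, ℂ))) atTop (𝓝 (e.comp A)) := by
    have := ((ContinuousMap.continuous_postcomp (X := U) e).tendsto A).comp hA
    refine this.congr fun N => ?_
    ext s
    exact exp_sum_logFactor ω N (hpos s)
  have hlim' : Tendsto (euler U hU ω) atTop (𝓝 (⟨e.comp A, hol_of_tendsto hlim⟩ : Hol U)) :=
    tendsto_subtype_rng.2 hlim
  exact tendsto_nhds_limUnder ⟨_, hlim'⟩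

theorem ae_tendsto_euler (r : ℕ) (hU : (U : Set ℂ) ⊆ strip) {β : ℝ} (hβ : 1 / 2 < β)
    (hUβ : ∀ s ∈ U, β < s.re) : ∀ᵐ ω ∂(haar r), ∀ j : Fin r,
      Tendsto (euler U hU (ω j)) atTop (𝓝 (randomZeta U hU (ω j))) := by
  rw [ae_all_iff]
  intro j
  have h := ae_exists_tendsto_sum_primeCoeff hβ
  rw [← map_eval_haar j] at h
  filter_upwards [ae_of_ae_map (measurable_pi_apply j).aemeasurable h] with ω ⟨l, hl⟩
  exact tendsto_euler_randomZeta hU hβ hUβ hl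

end Hol

/-! ### Bounds for holomorphic functions by means over circles -/

/-- Cauchy's formula: points of the circle are at distance at least `R / 2` from `w`, so the kernel
contributes at most `2 / (2π) ≤ 1`. -/
theorem norm_le_integral_norm_circleMap {g : ℂ → ℂ} {c w : ℂ} {R : ℝ}
    (hg : DifferentiableOn ℂ g (Metric.closedBall c R)) (hw : w ∈ Metric.ball c (R / 2)) :
    ‖g w‖ ≤ ∫ θ in (0 : ℝ)..2 * Real.pi, ‖g (circleMap c R θ)‖ := by
  have hR : 0 < R := by
    have := Metric.pos_of_mem_ball hw
    linarith
  have hw' : w ∈ Metric.ball c R := Metric.ball_subset_ball (by linarith) hw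
  have h1 := hg.circleIntegral_sub_inv_smul hw'
  have hgc : Continuous fun θ => g (circleMap c R θ) :=
    hg.continuousOn.comp_continuous (continuous_circleMap c R)
      fun θ => Metric.sphere_subset_closedBall (circleMap_mem_sphere c hR.le θ)
  have h2 : ‖∮ z in C(c, R), (z - w)⁻¹ • g z‖ ≤
      ∫ θ in (0 : ℝ)..2 * Real.pi, 2 * ‖g (circleMap c R θ)‖ := by
    rw [circleIntegral]
    refine intervalIntegral.norm_integral_le_of_norm_le (by positivity)
      (Eventually.of_forall fun θ _ => ?_) ((hgc.norm.const_mul 2).intervalIntegrable _ _)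
    have h3 : R / 2 ≤ ‖circleMap c R θ - w‖ := by
      have h4 : dist (circleMap c R θ) c = R := circleMap_mem_sphere c hR.le θ
      have h5 := dist_triangle (circleMap c R θ) w c
      have h6 : dist w c < R / 2 := hw
      rw [← dist_eq_norm]
      linarith
    rw [norm_smul, norm_smul, norm_inv, deriv_circleMap, norm_mul, Complex.norm_I, mul_one,
      norm_circleMap_zero, abs_of_pos hR, ← mul_assoc]
    refine mul_le_mul_of_nonneg_right ?_ (norm_nonneg _)
    rw [mul_inv_le_iff₀ (by linarith)]
    linarith
  have hpi := Real.pi_gt_three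
  rw [h1, norm_smul, intervalIntegral.integral_const_mul] at h2
  have h7 : ‖(2 * Real.pi * Complex.I : ℂ)‖ = 2 * Real.pi := by
    simp [abs_of_pos Real.pi_pos]
  rw [h7] at h2
  nlinarith [norm_nonneg (g w)]

/-- Cover `Q` by finitely many discs of half the admissible radius. The circles do not depend on
`g`, so a supremum over `Q` is replaced by means that can be integrated in `τ` by Fubini. -/
theorem exists_finset_norm_le_sum_integral {U Q : Set ℂ} (hU : IsOpen U) (hQ : IsCompact Q)
    (hQU : Q ⊆ U) : ∃ t : Finset (ℂ × ℝ), (∀ c ∈ t, Metric.closedBall c.1 c.2 ⊆ U) ∧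
      (∀ c ∈ t, 0 < c.2) ∧
      ∀ g : ℂ → ℂ, DifferentiableOn ℂ g U → ∀ s ∈ Q,
        ‖g s‖ ≤ ∑ c ∈ t, ∫ θ in (0 : ℝ)..2 * Real.pi, ‖g (circleMap c.1 c.2 θ)‖ := by
  classical
  have h : ∀ s ∈ Q, ∃ ρ : ℝ, 0 < ρ ∧ Metric.closedBall s ρ ⊆ U := fun s hs =>
    Metric.nhds_basis_closedBall.mem_iff.1 (hU.mem_nhds (hQU hs))
  choose! ρ hρ hρU using h
  obtain ⟨t, ht, htQ⟩ := hQ.elim_nhds_subcover (fun s => Metric.ball s (ρ s / 2))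
    fun s hs => Metric.ball_mem_nhds _ (half_pos (hρ s hs))
  refine ⟨t.image fun s => (s, ρ s), ?_, ?_, fun g hg s hs => ?_⟩
  · simp only [Finset.mem_image]
    rintro _ ⟨s, hs, rfl⟩
    exact hρU s (ht s hs)
  · simp only [Finset.mem_image]
    rintro _ ⟨s, hs, rfl⟩
    exact hρ s (ht s hs)
  · obtain ⟨c, hc, hsc⟩ := Set.mem_iUnion₂.1 (htQ hs)
    refine (norm_le_integral_norm_circleMap (hg.mono (hρU c (ht c hc))) hsc).trans ?_
    exact Finset.single_le_sum (f := fun c : ℂ × ℝ => ∫ θ in (0 : ℝ)..2 * Real.pi,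
      ‖g (circleMap c.1 c.2 θ)‖) (fun c _ => intervalIntegral.integral_nonneg
        (by positivity) fun θ _ => norm_nonneg _)
      (Finset.mem_image_of_mem (fun s => (s, ρ s)) hc)

/-! ### The mean distance of the shifted zeta-functions from their Euler products -/

/-- The mean over a circle of the approximation error, at height `t`. -/
def circleError (M : ℕ) (c : ℂ × ℝ) (t : ℝ) : ℝ :=
  ∫ θ in (0 : ℝ)..2 * Real.pi, ‖zetaDiff M (circleMap c.1 c.2 θ + Complex.I * t)‖

theorem circleError_nonneg (M : ℕ) (c : ℂ × ℝ) (t : ℝ) : 0 ≤ circleError M c t :=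
  intervalIntegral.integral_nonneg (by positivity) fun _ _ => norm_nonneg _

theorem continuous_zetaDiff_add (M : ℕ) {c : ℂ × ℝ} (hc : 0 < c.2)
    (hcs : Metric.closedBall c.1 c.2 ⊆ strip) :
    Continuous fun x : ℝ × ℝ => zetaDiff M (circleMap c.1 c.2 x.2 + Complex.I * x.1) := by
  rw [continuous_iff_continuousAt]
  intro x
  have hx : circleMap c.1 c.2 x.2 ∈ strip :=
    hcs (Metric.sphere_subset_closedBall (circleMap_mem_sphere c.1 hc.le x.2))
  have hre : (circleMap c.1 c.2 x.2 + Complex.I * x.1).re = (circleMap c.1 c.2 x.2).re := by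
    simp
  have h1 := (differentiableAt_zetaDiff M (s := circleMap c.1 c.2 x.2 + Complex.I * x.1)
    (by rw [hre]; linarith [hx.1]) (by
      intro h
      have h2 := congrArg Complex.re h
      rw [hre] at h2
      have h3 := hx.2
      rw [h2] at h3
      exact lt_irrefl _ h3)).continuousAt
  have h2 : Continuous fun x : ℝ × ℝ => circleMap c.1 c.2 x.2 + Complex.I * x.1 := by
    have := continuous_circleMap c.1 c.2
    fun_prop
  exact ContinuousAt.comp (f := fun x : ℝ × ℝ => circleMap c.1 c.2 x.2 + Complex.I * x.1)
    h1 h2.continuousAt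

theorem continuous_circleError (M : ℕ) {c : ℂ × ℝ} (hc : 0 < c.2)
    (hcs : Metric.closedBall c.1 c.2 ⊆ strip) : Continuous (circleError M c) :=
  intervalIntegral.continuous_parametric_intervalIntegral_of_continuous'
    (f := fun (t θ : ℝ) => ‖zetaDiff M (circleMap c.1 c.2 θ + Complex.I * t)‖)
    (continuous_zetaDiff_add M hc hcs).norm _ _

theorem integral_integral_le {F : ℝ → ℝ → ℝ} (hF : Continuous (Function.uncurry F)) {a b c d B : ℝ}
    (hcd : c ≤ d) (h : ∀ y, ∫ x in a..b, F x y ≤ B) :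
    ∫ x in a..b, ∫ y in c..d, F x y ≤ (d - c) * B := by
  rw [intervalIntegral_intervalIntegral_swap
    ((hF.continuousOn.integrableOn_compact (isCompact_uIcc.prod isCompact_uIcc)).mono_set
      (Set.prod_mono Set.uIoc_subset_uIcc Set.uIoc_subset_uIcc))]
  have hc : Continuous fun y => ∫ x in a..b, F x y :=
    intervalIntegral.continuous_parametric_intervalIntegral_of_continuous'
      (f := fun y x => F x y) (hF.comp continuous_swap) _ _
  calc ∫ y in c..d, ∫ x in a..b, F x y ≤ ∫ _ in c..d, B :=
        intervalIntegral.integral_mono_on hcd (hc.intervalIntegrable _ _)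
          intervalIntegrable_const fun y _ => h y
    _ = (d - c) * B := by rw [intervalIntegral.integral_const, smul_eq_mul]

theorem IsShift.eventually_integral_circleError_le {γ : ℝ → ℝ} (hγ : IsShift γ) {c : ℂ × ℝ}
    (hc : 0 < c.2) (hcs : Metric.closedBall c.1 c.2 ⊆ strip) {ε : ℝ} (hε : 0 < ε) :
    ∀ᶠ M : ℕ in atTop, ∀ᶠ T : ℝ in atTop,
      ∫ τ in T..2 * T, circleError M c (γ τ) ≤ ε * T := by
  obtain ⟨T₀, α, h⟩ := hγ.exists_shiftBounds
  have hcomp := isCompact_closedBall c.1 c.2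
  have hne : (Metric.closedBall c.1 c.2).Nonempty := ⟨c.1, Metric.mem_closedBall_self hc.le⟩
  obtain ⟨s₁, hs₁, hmin⟩ := hcomp.exists_isMinOn hne Complex.continuous_re.continuousOn
  obtain ⟨s₂, hs₂, hmax⟩ := hcomp.exists_isMaxOn hne Complex.continuous_re.continuousOn
  obtain ⟨Y, hY⟩ := hcomp.exists_bound_of_continuousOn Complex.continuous_im.continuousOn
  -- Each point of the circle will contribute at most `2ηT`, by `x ≤ η + x² / η` and the mean-square
  -- bound `η² T`; integrating over `[0, 2π]` gives `εT`.
  set η : ℝ := ε / (4 * Real.pi) with hη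
  have hη0 : 0 < η := by have := Real.pi_pos; positivity
  filter_upwards [hγ.eventually_integral_norm_sq_zetaDiff_le (hcs hs₁).1 (hcs hs₂).2 Y
    (ε := η ^ 2) (by positivity)] with M hM
  filter_upwards [hM, eventually_ge_atTop T₀] with T hT hT₀
  have hTp : 0 < T := h.T₀_pos.trans_le hT₀
  -- Freezing `γ` to the left of `T₀` gives a function continuous on the whole line, as the exchange
  -- of integrals requires, without changing it on `[T, 2T]`.
  set γ' : ℝ → ℝ := fun τ => γ (max T₀ τ) with hγ'
  have hγc : Continuous γ' := h.continuousOn.comp_continuous (by fun_prop) fun τ => Set.mem_Ici.2 (le_max_left _ _)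
  have hγe : ∀ τ ∈ Set.uIcc T (2 * T), γ' τ = γ τ := fun τ hτ => by
    rw [Set.uIcc_of_le (by linarith)] at hτ
    simp only [hγ', max_eq_right (hT₀.trans hτ.1)]
  have hF : Continuous fun x : ℝ × ℝ =>
      ‖zetaDiff M (circleMap c.1 c.2 x.2 + Complex.I * γ' x.1)‖ :=
    ((continuous_zetaDiff_add M hc hcs).comp
      (g := fun x : ℝ × ℝ => zetaDiff M (circleMap c.1 c.2 x.2 + Complex.I * x.1))
      (f := fun x : ℝ × ℝ => (γ' x.1, x.2)) (by fun_prop)).norm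
  have hin : ∀ θ : ℝ, ∫ τ in T..2 * T,
      ‖zetaDiff M (circleMap c.1 c.2 θ + Complex.I * γ' τ)‖ ≤ 2 * η * T := fun θ => by
    have hz : circleMap c.1 c.2 θ ∈ Metric.closedBall c.1 c.2 :=
      Metric.sphere_subset_closedBall (circleMap_mem_sphere c.1 hc.le θ)
    have h1 := hT _ (hmin hz) (hmax hz) (hY _ hz)
    rw [intervalIntegral.integral_congr (g := fun τ =>
      ‖zetaDiff M (circleMap c.1 c.2 θ + Complex.I * γ' τ)‖ ^ 2)
      fun τ hτ => by simp only [hγe τ hτ]] at h1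
    have hFθ : Continuous fun τ => ‖zetaDiff M (circleMap c.1 c.2 θ + Complex.I * γ' τ)‖ :=
      hF.comp (f := fun τ : ℝ => (τ, θ)) (by fun_prop)
    calc ∫ τ in T..2 * T, ‖zetaDiff M (circleMap c.1 c.2 θ + Complex.I * γ' τ)‖
        ≤ ∫ τ in T..2 * T, (η +
          η⁻¹ * ‖zetaDiff M (circleMap c.1 c.2 θ + Complex.I * γ' τ)‖ ^ 2) := by
          refine intervalIntegral.integral_mono_on (by linarith) (hFθ.intervalIntegrable _ _)
            (Continuous.intervalIntegrable (by fun_prop) _ _) fun τ _ => ?_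
          generalize ‖zetaDiff M (circleMap c.1 c.2 θ + Complex.I * γ' τ)‖ = x
          have : η + η⁻¹ * x ^ 2 - x = η⁻¹ * ((η - x / 2) ^ 2 + 3 / 4 * x ^ 2) := by
            field_simp; ring
          have h2 : 0 ≤ η⁻¹ * ((η - x / 2) ^ 2 + 3 / 4 * x ^ 2) := by positivity
          linarith
      _ = η * T + η⁻¹ * ∫ τ in T..2 * T,
          ‖zetaDiff M (circleMap c.1 c.2 θ + Complex.I * γ' τ)‖ ^ 2 := by
          rw [intervalIntegral.integral_add (Continuous.intervalIntegrable (by fun_prop) _ _)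
            (Continuous.intervalIntegrable (by fun_prop) _ _), intervalIntegral.integral_const,
            intervalIntegral.integral_const_mul, smul_eq_mul]
          ring
      _ ≤ η * T + η⁻¹ * (η ^ 2 * T) := by gcongr
      _ = 2 * η * T := by field_simp; ring
  rw [intervalIntegral.integral_congr (g := fun τ => circleError M c (γ' τ))
    fun τ hτ => by simp only [hγe τ hτ]]
  refine (integral_integral_le (F := fun τ θ =>
    ‖zetaDiff M (circleMap c.1 c.2 θ + Complex.I * γ' τ)‖) hF (by positivity) hin).trans_eq ?_
  rw [hη]
  have := Real.pi_pos.ne'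
  field_simp
  ring

/-! ### Weak convergence -/

variable {U : TopologicalSpace.Opens ℂ}

/-- This makes the space pseudometrizable, which is used for measurability of limits and for testing
weak convergence on Lipschitz functions. -/
instance (U : TopologicalSpace.Opens ℂ) : (uniformity (Hol U)).IsCountablyGenerated := by
  rw [uniformity_subtype]; infer_instance

/-- Shifting `s` by `iγ_j(τ)` multiplies `p^(-s)` by `p^(-iγ_j(τ))`, a coordinate of the orbit. This
links truncated zeta-values to the torus. -/
theorem eulerFun_orbit (γ : Fin r → ℝ → ℝ) (τ : ℝ) (j : Fin r) (M : ℕ) (s : ℂ) :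
    eulerFun (orbit γ τ j) M s = eulerFun 1 M (s + Complex.I * γ j τ) := by
  unfold eulerFun
  refine Finset.prod_congr rfl fun n _ => ?_
  by_cases h : n.Prime
  · have h0 : (n : ℂ) ≠ 0 := by exact_mod_cast h.ne_zero
    rw [dif_pos h, dif_pos h]
    congr 2
    have h1 : ((orbit γ τ j ⟨n, h⟩ : Circle) : ℂ) = (n : ℂ) ^ (-(Complex.I * γ j τ)) := by
      simp only [orbit, Circle.coe_exp]
      rw [Complex.cpow_def_of_ne_zero h0, ← Complex.natCast_log]
      congr 1
      push_cast
      ring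
    rw [h1, Complex.cpow_neg, Complex.cpow_add _ _ h0]
    change _ = ((1 : Circle) : ℂ) / _
    rw [Circle.coe_one]
    rw [one_div, mul_inv, div_eq_mul_inv, mul_comm]
  · rw [dif_neg h, dif_neg h]

theorem continuous_shiftedZeta (hU : (U : Set ℂ) ⊆ strip) : Continuous (shiftedZeta U hU) := by
  refine continuous_induced_rng.2 (ContinuousMap.continuous_of_continuous_uncurry _ ?_)
  rw [continuous_iff_continuousAt]
  intro x
  have h1 : (x.2 : ℂ) + Complex.I * x.1 ≠ 1 := by
    intro h
    have h2 := congrArg Complex.re h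
    have h3 := (hU x.2.2).2
    simp at h2
    linarith
  exact ContinuousAt.comp (g := riemannZeta) (f := fun x : ℝ × U => (x.2 : ℂ) + Complex.I * x.1)
    (differentiableAt_riemannZeta h1).continuousAt (by fun_prop)

theorem continuous_euler (hU : (U : Set ℂ) ⊆ strip) (N : ℕ) :
    Continuous fun ω : Torus => euler U hU ω N := by
  refine continuous_induced_rng.2 (ContinuousMap.continuous_of_continuous_uncurry _ ?_)
  change Continuous fun x : Torus × U => eulerFun x.1 N x.2
  unfold eulerFun
  refine continuous_finsetProd _ fun n _ => ?_
  by_cases h : n.Prime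
  · simp only [h, dif_pos]
    have h0 : (n : ℂ) ≠ 0 := by exact_mod_cast h.ne_zero
    have h1 : Continuous fun x : Torus × U => (n : ℂ) ^ (x.2 : ℂ) :=
      (continuous_subtype_val.comp continuous_snd).const_cpow (Or.inl h0)
    have h2 : Continuous fun x : Torus × U => ((x.1 ⟨n, h⟩ : Circle) : ℂ) :=
      continuous_subtype_val.comp ((continuous_apply (⟨n, h⟩ : Nat.Primes)).comp continuous_fst)
    refine (continuous_const.sub (h2.div h1 fun x => ?_)).inv₀ fun x =>
      euler_factor_ne_zero _ h (by have := (hU x.2.2).1; linarith)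
    simp [Complex.cpow_eq_zero_iff, h0]
  · simp only [h, dif_neg, not_false_iff]
    exact continuous_const

/-- The entourages of the space of tuples of holomorphic functions. -/
theorem exists_isCompact_of_mem_uniformity {V : Set ((Fin r → Hol U) × (Fin r → Hol U))}
    (hV : V ∈ uniformity (Fin r → Hol U)) :
    ∃ (Q : Fin r → Set U) (δ : Fin r → ℝ), (∀ j, IsCompact (Q j)) ∧ (∀ j, 0 < δ j) ∧
      ∀ x y : Fin r → Hol U, (∀ j, ∀ s ∈ Q j, dist ((x j : C(U, ℂ)) s) ((y j : C(U, ℂ)) s) < δ j) →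
        (x, y) ∈ V := by
  rw [Pi.uniformity, Filter.mem_iInf_of_finite] at hV
  obtain ⟨t, ht, rfl⟩ := hV
  have h : ∀ j, ∃ p : Set U × ℝ, IsCompact p.1 ∧ 0 < p.2 ∧ ∀ x y : Fin r → Hol U,
      (∀ s ∈ p.1, dist ((x j : C(U, ℂ)) s) ((y j : C(U, ℂ)) s) < p.2) → (x, y) ∈ t j := by
    intro j
    obtain ⟨W, hW, hWt⟩ := Filter.mem_comap.1 (ht j)
    rw [uniformity_subtype] at hW
    obtain ⟨W', hW', hWW⟩ := Filter.mem_comap.1 hW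
    obtain ⟨p, hp, hpW⟩ :=
      (Metric.uniformity_basis_dist (α := ℂ)).compactConvergenceUniformity.mem_iff.1 hW'
    exact ⟨p, hp.1, hp.2, fun x y hxy => hWt (hWW (hpW fun s hs => hxy s hs))⟩
  choose p hp1 hp2 hp3 using h
  exact ⟨fun j => (p j).1, fun j => (p j).2, hp1, hp2, fun x y hxy =>
    Set.mem_iInter.2 fun j => hp3 j x y (hxy j)⟩

/-- Markov's inequality in pointwise form. Either the two tuples are so close that `f` varies by
less than `ε`, or some component differs by at least `δ_j` at a point of `Q_j`. In the latter case
the circle errors add up to at least `δ_j`, and `C / δ_j` times them exceeds the oscillation of `f`.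
-/
theorem exists_dist_le_add_sum_circleError (hU : (U : Set ℂ) ⊆ strip) {f : (Fin r → Hol U) → ℝ}
    (hf : UniformContinuous f) {C : ℝ} (hC : ∀ x y, dist (f x) (f y) ≤ C) {ε : ℝ} (hε : 0 < ε) :
    ∃ (t : Fin r → Finset (ℂ × ℝ)) (A : Fin r → ℝ),
      (∀ j, ∀ c ∈ t j, 0 < c.2 ∧ Metric.closedBall c.1 c.2 ⊆ strip) ∧
      ∀ (γ : Fin r → ℝ → ℝ) (M : ℕ) (τ : ℝ),
        |f (fun j => shiftedZeta U hU (γ j τ)) - f (fun j => euler U hU (orbit γ τ j) M)| ≤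
          ε + ∑ j, A j * ∑ c ∈ t j, circleError M c (γ j τ) := by
  have hC0 : 0 ≤ C := dist_nonneg.trans (hC default default)
  obtain ⟨Q, δ, hQ, hδ, hV⟩ :=
    exists_isCompact_of_mem_uniformity (hf (Metric.dist_mem_uniformity hε))
  have h := fun j => exists_finset_norm_le_sum_integral U.isOpen
    ((hQ j).image continuous_subtype_val) (by rintro _ ⟨s, -, rfl⟩; exact s.2)
  choose t htU ht0 htb using h
  refine ⟨t, fun j => C / δ j, fun j c hc => ⟨ht0 j c hc, (htU j c hc).trans hU⟩,
    fun γ M τ => ?_⟩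
  have hnn : ∀ j, 0 ≤ ∑ c ∈ t j, circleError M c (γ j τ) := fun j =>
    Finset.sum_nonneg fun c _ => circleError_nonneg M c _
  have hnn' : ∀ j ∈ Finset.univ, 0 ≤ C / δ j * ∑ c ∈ t j, circleError M c (γ j τ) := fun j _ =>
    mul_nonneg (div_nonneg hC0 (hδ j).le) (hnn j)
  by_cases hall : ∀ j, ∀ s ∈ Q j, dist ((shiftedZeta U hU (γ j τ) : C(U, ℂ)) s)
      ((euler U hU (orbit γ τ j) M : C(U, ℂ)) s) < δ j
  · have h1 := hV (fun j => shiftedZeta U hU (γ j τ)) (fun j => euler U hU (orbit γ τ j) M) hall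
    have h2 : dist (f (fun j => shiftedZeta U hU (γ j τ)))
      (f (fun j => euler U hU (orbit γ τ j) M)) < ε := h1
    rw [Real.dist_eq] at h2
    linarith [Finset.sum_nonneg hnn']
  · push Not at hall
    obtain ⟨j, s, hs, hd⟩ := hall
    have h1 := hC (fun j => shiftedZeta U hU (γ j τ)) (fun j => euler U hU (orbit γ τ j) M)
    rw [Real.dist_eq] at h1
    have h2 := htb j (fun z => zetaDiff M (z + Complex.I * γ j τ)) (fun z hz => by
      have hre : (z + Complex.I * γ j τ).re = z.re := by simp
      have h3 : z + Complex.I * γ j τ ≠ 1 := fun h => by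
        have h4 := congrArg Complex.re h
        rw [hre, Complex.one_re] at h4
        exact (hU hz).2.ne h4
      have h4 := differentiableAt_zetaDiff M (by rw [hre]; linarith [(hU hz).1]) h3
      have h5 : DifferentiableAt ℂ (fun z : ℂ => z + Complex.I * γ j τ) z := by fun_prop
      exact (DifferentiableAt.comp z h4 h5).differentiableWithinAt)
      s (Set.mem_image_of_mem _ hs)
    have h5 : zetaDiff M ((s : ℂ) + Complex.I * γ j τ) =
        (shiftedZeta U hU (γ j τ) : C(U, ℂ)) s - (euler U hU (orbit γ τ j) M : C(U, ℂ)) s := by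
      change _ = riemannZeta (s + Complex.I * γ j τ) - eulerFun (orbit γ τ j) M s
      rw [eulerFun_orbit, zetaDiff]
    rw [dist_eq_norm, ← h5] at hd
    have h6 : δ j ≤ ∑ c ∈ t j, circleError M c (γ j τ) := hd.trans h2
    have h7 : C ≤ C / δ j * ∑ c ∈ t j, circleError M c (γ j τ) := by
      calc C = C / δ j * δ j := by rw [div_mul_cancel₀ _ (hδ j).ne']
        _ ≤ _ := mul_le_mul_of_nonneg_left h6 (div_nonneg hC0 (hδ j).le)
    have h8 := Finset.single_le_sum hnn' (Finset.mem_univ j)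
    linarith

/-- The error terms, as means over `[T, 2T]`, tend to zero as first `T` and then `M` tends to
infinity. -/
theorem IsShift.tendsto_mean_circleError {γ : ℝ → ℝ} (hγ : IsShift γ) {c : ℂ × ℝ}
    (hc : 0 < c.2) (hcs : Metric.closedBall c.1 c.2 ⊆ strip) :
    Tendsto (fun p : ℕ × ℝ => p.2⁻¹ * ∫ τ in p.2..2 * p.2, circleError p.1 c (γ τ))
      ((atTop : Filter ℕ).curry atTop) (𝓝 0) := by
  rw [Metric.tendsto_nhds]
  intro ε hε
  rw [Filter.eventually_curry_iff]
  filter_upwards [hγ.eventually_integral_circleError_le hc hcs (half_pos hε)] with M hM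
  filter_upwards [hM, eventually_gt_atTop 0] with T hT hT0
  have h1 : 0 ≤ ∫ τ in T..2 * T, circleError M c (γ τ) :=
    intervalIntegral.integral_nonneg (by linarith) fun τ _ => circleError_nonneg M c _
  rw [Real.dist_0_eq_abs, abs_of_nonneg (by positivity), inv_mul_lt_iff₀ hT0]
  nlinarith

theorem eventually_dist_mean_le (hU : (U : Set ℂ) ⊆ strip) {γ : Fin r → ℝ → ℝ}
    (hγ : ∀ j, IsShift (γ j)) {f : (Fin r → Hol U) → ℝ} (hf : UniformContinuous f) {C : ℝ}
    (hC : ∀ x y, dist (f x) (f y) ≤ C) {ε : ℝ} (hε : 0 < ε) :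
    ∀ᶠ M : ℕ in atTop, ∀ᶠ T : ℝ in atTop,
      |T⁻¹ * (∫ τ in T..2 * T, f fun j => shiftedZeta U hU (γ j τ)) -
        T⁻¹ * ∫ τ in T..2 * T, f fun j => euler U hU (orbit γ τ j) M| ≤ ε := by
  obtain ⟨T₀, hT₀, hγc, hoc⟩ := exists_continuousOn_orbit hγ
  obtain ⟨t, A, ht, hb⟩ := exists_dist_le_add_sum_circleError hU hf hC (half_pos hε)
  -- The curried filter encodes "for all large `M`, for all `T` large in terms of `M`", and finitely
  -- many such limits can be added.
  have h1 : Tendsto (fun p : ℕ × ℝ => ∑ j, A j * ∑ c ∈ t j,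
      p.2⁻¹ * ∫ τ in p.2..2 * p.2, circleError p.1 c (γ j τ))
      ((atTop : Filter ℕ).curry atTop) (𝓝 (∑ j : Fin r, A j * ∑ c ∈ t j, 0)) :=
    tendsto_finsetSum _ fun j _ => (tendsto_finsetSum _ fun c hc =>
      (hγ j).tendsto_mean_circleError (ht j c hc).1 (ht j c hc).2).const_mul (A j)
  simp only [Finset.sum_const_zero, mul_zero] at h1
  have h2 := Filter.eventually_curry_iff.1 (h1.eventually_lt_const (half_pos hε))
  filter_upwards [h2] with M hM
  filter_upwards [hM, eventually_ge_atTop T₀] with T hT hTT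
  have hTp : 0 < T := hT₀.trans_le hTT
  have hsub : Set.uIcc T (2 * T) ⊆ Set.Ici T₀ := by
    rw [Set.uIcc_of_le (by linarith)]
    exact fun x hx => hTT.trans hx.1
  have i1 : IntervalIntegrable (fun τ => f fun j => shiftedZeta U hU (γ j τ)) volume T (2 * T) := by
    refine ContinuousOn.intervalIntegrable (hf.continuous.comp_continuousOn
      (continuousOn_pi.2 fun j => ?_))
    exact (continuous_shiftedZeta hU).comp_continuousOn ((hγc j).mono hsub)
  have i2 : IntervalIntegrable (fun τ => f fun j => euler U hU (orbit γ τ j) M) volume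
      T (2 * T) := by
    refine ContinuousOn.intervalIntegrable (hf.continuous.comp_continuousOn
      (continuousOn_pi.2 fun j => ?_))
    exact (continuous_euler hU M).comp_continuousOn
      ((continuous_apply j).comp_continuousOn (hoc.mono hsub))
  have i3 : ∀ j, ∀ c ∈ t j, IntervalIntegrable (fun τ => circleError M c (γ j τ)) volume
      T (2 * T) := fun j c hc =>
    ((continuous_circleError M (ht j c hc).1 (ht j c hc).2).comp_continuousOn
      ((hγc j).mono hsub)).intervalIntegrable
  have i4 : ∀ j, IntervalIntegrable (fun τ => A j * ∑ c ∈ t j, circleError M c (γ j τ)) volume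
      T (2 * T) := fun j => by
    have := IntervalIntegrable.sum (t j) (fun c hc => i3 j c hc)
    rw [Finset.sum_fn] at this
    exact this.const_mul (A j)
  have i5 : IntervalIntegrable (fun τ => ∑ j, A j * ∑ c ∈ t j, circleError M c (γ j τ)) volume
      T (2 * T) := by
    have := IntervalIntegrable.sum Finset.univ (fun j _ => i4 j)
    rwa [Finset.sum_fn] at this
  rw [← mul_sub, ← intervalIntegral.integral_sub i1 i2, abs_mul, abs_of_pos (inv_pos.2 hTp)]
  have h3 : |∫ τ in T..2 * T, (f (fun j => shiftedZeta U hU (γ j τ)) -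
      f fun j => euler U hU (orbit γ τ j) M)| ≤
      ∫ τ in T..2 * T, (ε / 2 + ∑ j, A j * ∑ c ∈ t j, circleError M c (γ j τ)) := by
    rw [← Real.norm_eq_abs]
    exact intervalIntegral.norm_integral_le_of_norm_le (by linarith)
      (Eventually.of_forall fun τ _ => hb γ M τ) (intervalIntegrable_const.add i5)
  have h4 : ∫ τ in T..2 * T, (ε / 2 + ∑ j, A j * ∑ c ∈ t j, circleError M c (γ j τ)) =
      ε / 2 * T + ∑ j, A j * ∑ c ∈ t j, ∫ τ in T..2 * T, circleError M c (γ j τ) := by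
    rw [intervalIntegral.integral_add intervalIntegrable_const i5, intervalIntegral.integral_const,
      intervalIntegral.integral_finsetSum fun j _ => i4 j]
    congr 1
    · rw [smul_eq_mul]; ring
    · refine Finset.sum_congr rfl fun j _ => ?_
      rw [intervalIntegral.integral_const_mul, intervalIntegral.integral_finsetSum (i3 j)]
  rw [h4] at h3
  have h5 : T⁻¹ * (ε / 2 * T + ∑ j, A j * ∑ c ∈ t j, ∫ τ in T..2 * T, circleError M c (γ j τ)) =
      ε / 2 + ∑ j, A j * ∑ c ∈ t j, T⁻¹ * ∫ τ in T..2 * T, circleError M c (γ j τ) := by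
    rw [mul_add, Finset.mul_sum]
    congr 1
    · field_simp
    · refine Finset.sum_congr rfl fun j _ => ?_
      rw [mul_left_comm, Finset.mul_sum]
  calc _ ≤ _ := mul_le_mul_of_nonneg_left h3 (inv_pos.2 hTp).le
    _ ≤ ε := by rw [h5]; linarith

/-! ### Limits of the means and of the laws -/

theorem tendsto_integral_euler (hU : (U : Set ℂ) ⊆ strip)
    (hae : ∀ᵐ ω ∂(haar r), ∀ j : Fin r,
      Tendsto (euler U hU (ω j)) atTop (𝓝 (randomZeta U hU (ω j))))
    {f : (Fin r → Hol U) → ℝ} (hf : Continuous f) {C : ℝ} (hC : ∀ x, ‖f x‖ ≤ C) :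
    Tendsto (fun M : ℕ => ∫ ω, f (fun j => euler U hU (ω j) M) ∂(haar r)) atTop
      (𝓝 (∫ ω, f (fun j => randomZeta U hU (ω j)) ∂(haar r))) := by
  refine tendsto_integral_of_dominated_convergence (fun _ => C) (fun M => ?_)
    (integrable_const C) (fun M => Eventually.of_forall fun ω => hC _) ?_
  · refine (hf.comp (continuous_pi fun j => ?_)).aestronglyMeasurable
    exact (continuous_euler hU M).comp (continuous_apply j)
  · filter_upwards [hae] with ω hω
    exact (hf.tendsto _).comp (tendsto_pi_nhds.2 hω)

theorem tendsto_mean_shiftedZeta (hU : (U : Set ℂ) ⊆ strip) {γ : Fin r → ℝ → ℝ}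
    (hγ : IsAdmissible γ)
    (hae : ∀ᵐ ω ∂(haar r), ∀ j : Fin r,
      Tendsto (euler U hU (ω j)) atTop (𝓝 (randomZeta U hU (ω j))))
    {f : (Fin r → Hol U) → ℝ} (hf : UniformContinuous f) {C : ℝ}
    (hC : ∀ x y, dist (f x) (f y) ≤ C) :
    Tendsto (fun T : ℝ => T⁻¹ * ∫ τ in T..2 * T, f fun j => shiftedZeta U hU (γ j τ)) atTop
      (𝓝 (∫ ω, f (fun j => randomZeta U hU (ω j)) ∂(haar r))) := by
  have hC' : ∀ x, ‖f x‖ ≤ C + ‖f default‖ := fun x => by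
    have h1 := hC x default
    rw [dist_eq_norm] at h1
    have h2 := norm_add_le (f x - f default) (f default)
    rw [sub_add_cancel] at h2
    linarith
  rw [Metric.tendsto_nhds]
  intro ε hε
  have e1 := eventually_dist_mean_le hU hγ.1 hf hC (ε := ε / 3) (by positivity)
  have e2 := (Metric.tendsto_nhds.1 (tendsto_integral_euler hU hae hf.continuous hC')) (ε / 3)
    (by positivity)
  -- One `M` serves both purposes: the truncation error is small for all large `T`, and the
  -- truncated random expectation is close to its limit. Equidistribution is needed for this `M`
  -- only.
  obtain ⟨M, hM1, hM2⟩ := (e1.and e2).exists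
  have hcont : Continuous fun ω : Fin r → Torus => f fun j => euler U hU (ω j) M :=
    hf.continuous.comp (continuous_pi fun j => (continuous_euler hU M).comp (continuous_apply j))
  have e3 := (Metric.tendsto_nhds.1 (tendsto_mean_orbit_real hγ hcont)) (ε / 3) (by positivity)
  filter_upwards [hM1, e3] with T h1 h2
  rw [Real.dist_eq] at hM2 h2 ⊢
  rw [abs_lt] at hM2 h2 ⊢
  rw [abs_le] at h1
  constructor <;> linarith [h1.1, h1.2, h2.1, h2.2, hM2.1, hM2.2]

theorem aemeasurable_shiftedZeta (hU : (U : Set ℂ) ⊆ strip) {γ : Fin r → ℝ → ℝ} {T : ℝ}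
    (hγ : ∀ j, ContinuousOn (γ j) (Set.Icc T (2 * T))) :
    AEMeasurable (fun τ j => shiftedZeta U hU (γ j τ)) (volume.restrict (Set.Icc T (2 * T))) :=
  (continuousOn_pi.2 fun j =>
    (continuous_shiftedZeta hU).comp_continuousOn (hγ j)).aemeasurable measurableSet_Icc

theorem isProbabilityMeasure_shiftedLaw (hU : (U : Set ℂ) ⊆ strip) {γ : Fin r → ℝ → ℝ} {T : ℝ}
    (hT : 0 < T) (hγ : ∀ j, ContinuousOn (γ j) (Set.Icc T (2 * T))) :
    IsProbabilityMeasure (shiftedLaw U hU γ T) := by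
  refine ⟨?_⟩
  rw [shiftedLaw, Measure.smul_apply, Measure.map_apply_of_aemeasurable
    (aemeasurable_shiftedZeta hU hγ) MeasurableSet.univ, Set.preimage_univ,
    Measure.restrict_apply_univ, Real.volume_Icc, show 2 * T - T = T by ring, smul_eq_mul]
  exact ENNReal.inv_mul_cancel (by simpa using hT) ENNReal.ofReal_ne_top

theorem integral_shiftedLaw (hU : (U : Set ℂ) ⊆ strip) {γ : Fin r → ℝ → ℝ} {T : ℝ}
    (hT : 0 < T) (hγ : ∀ j, ContinuousOn (γ j) (Set.Icc T (2 * T))) {f : (Fin r → Hol U) → ℝ}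
    (hf : Continuous f) :
    ∫ g, f g ∂(shiftedLaw U hU γ T) =
      T⁻¹ * ∫ τ in T..2 * T, f fun j => shiftedZeta U hU (γ j τ) := by
  rw [shiftedLaw, integral_smul_measure, integral_map (aemeasurable_shiftedZeta hU hγ)
    hf.aestronglyMeasurable, intervalIntegral.integral_of_le (by linarith),
    integral_Icc_eq_integral_Ioc, ENNReal.toReal_inv, ENNReal.toReal_ofReal hT.le, smul_eq_mul]

theorem aemeasurable_randomZeta (hU : (U : Set ℂ) ⊆ strip)
    (hae : ∀ᵐ ω ∂(haar r), ∀ j : Fin r,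
      Tendsto (euler U hU (ω j)) atTop (𝓝 (randomZeta U hU (ω j)))) :
    AEMeasurable (fun ω j => randomZeta U hU (ω j)) (haar r) := by
  let _ : PseudoMetricSpace (Hol U) := UniformSpace.pseudoMetricSpace (Hol U)
  refine aemeasurable_pi_iff.2 fun j => ?_
  refine aemeasurable_of_tendsto_metrizable_ae atTop
    (f := fun (M : ℕ) (ω : Fin r → Torus) => euler U hU (ω j) M) (fun M => ?_) ?_
  · exact ((continuous_euler hU M).comp (continuous_apply j)).measurable.aemeasurable
  · filter_upwards [hae] with ω hω using hω j

/-- Weak convergence of the shifted laws, given the almost sure convergence of the Euler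
products. -/
theorem tendsto_integral_shiftedLaw (hU : (U : Set ℂ) ⊆ strip) {γ : Fin r → ℝ → ℝ}
    (hγ : IsAdmissible γ)
    (hae : ∀ᵐ ω ∂(haar r), ∀ j : Fin r,
      Tendsto (euler U hU (ω j)) atTop (𝓝 (randomZeta U hU (ω j))))
    (hev : ∀ᶠ T : ℝ in atTop, 0 < T ∧ ∀ j, ContinuousOn (γ j) (Set.Icc T (2 * T)))
    (f : BoundedContinuousFunction (Fin r → Hol U) ℝ) :
    Tendsto (fun T : ℝ => ∫ g, f g ∂(shiftedLaw U hU γ T)) atTop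
      (𝓝 (∫ g, f g ∂(randomLaw r U hU))) := by
  classical
  let _ : PseudoMetricSpace (Fin r → Hol U) := UniformSpace.pseudoMetricSpace (Fin r → Hol U)
  have hmeas := aemeasurable_randomZeta hU hae
  have hP : IsProbabilityMeasure (randomLaw r U hU) := Measure.isProbabilityMeasure_map hmeas
  set P : ProbabilityMeasure (Fin r → Hol U) := ⟨randomLaw r U hU, hP⟩ with hPdef
  set μs : ℝ → ProbabilityMeasure (Fin r → Hol U) := fun T =>
    if h : IsProbabilityMeasure (shiftedLaw U hU γ T) then ⟨_, h⟩ else P with hμs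
  have hμ : ∀ᶠ T in atTop, (μs T : Measure (Fin r → Hol U)) = shiftedLaw U hU γ T := by
    filter_upwards [hev] with T hT
    have h : μs T = ⟨_, isProbabilityMeasure_shiftedLaw hU hT.1 hT.2⟩ := dif_pos _
    rw [h]
    rfl
  have hlim : Tendsto μs atTop (𝓝 P) := by
    -- Bounded Lipschitz functions suffice, and these are uniformly continuous, as the comparison of
    -- means requires.
    rw [tendsto_iff_forall_lipschitz_integral_tendsto]
    rintro f ⟨C, hC⟩ ⟨L, hL⟩
    have h1 := tendsto_mean_shiftedZeta hU hγ hae hL.uniformContinuous hC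
    have h2 : ∫ ω, f ω ∂(P : Measure (Fin r → Hol U)) =
        ∫ ω, f (fun j => randomZeta U hU (ω j)) ∂(haar r) :=
      integral_map hmeas hL.continuous.aestronglyMeasurable
    rw [h2]
    refine h1.congr' ?_
    filter_upwards [hev, hμ] with T hT hT'
    rw [hT', integral_shiftedLaw hU hT.1 hT.2 hL.continuous]
  refine (ProbabilityMeasure.tendsto_iff_forall_integral_tendsto.1 hlim f).congr' ?_
  filter_upwards [hμ] with T hT
  rw [hT]

theorem exists_abscissa_rectangle {K : Set ℂ} (hK : IsCompact K) (hne : K.Nonempty)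
    (hs : K ⊆ strip) : ∃ β : ℝ, 1 / 2 < β ∧ ∀ s ∈ rectangle K, β < s.re := by
  obtain ⟨a, ha, ha'⟩ := (hK.image Complex.continuous_re).sInf_mem (hne.image _)
  have h1 := (hs ha).1
  refine ⟨sigma1 K, ?_, fun s hs => hs.1.1⟩
  simp only [sigma0, sigma1]
  rw [← ha']
  linarith

end JointZeta

end

/-- Joint limit theorem: the distribution `shiftedLaw` of the shifted zeta-functions converges
weakly to the distribution `randomLaw` of the random Euler products. The first three conjuncts say
that the objects are well defined: the Euler products converge almost surely in the space of
holomorphic functions, the shifted laws are probability measures for large `T`, and so is the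
limit. -/
theorem proposition3p7 (r : ℕ) (γ : Fin r → ℝ → ℝ) (hγ : JointZeta.IsAdmissible γ)
    (K : Set ℂ) (hK : IsCompact K) (hne : K.Nonempty) (hs : K ⊆ JointZeta.strip)
    (hc : IsConnected Kᶜ) :
    let U : TopologicalSpace.Opens ℂ := JointZeta.rectangle K
    let hU : (U : Set ℂ) ⊆ JointZeta.strip := JointZeta.rectangle_subset_strip hK hne hs
    (∀ᵐ ω ∂(JointZeta.haar r), ∀ j : Fin r,
      Tendsto (JointZeta.euler U hU (ω j)) atTop (𝓝 (JointZeta.randomZeta U hU (ω j)))) ∧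
    (∀ᶠ T : ℝ in atTop, IsProbabilityMeasure (JointZeta.shiftedLaw U hU γ T)) ∧
    IsProbabilityMeasure (JointZeta.randomLaw r U hU) ∧
    ∀ f : BoundedContinuousFunction (Fin r → JointZeta.Hol U) ℝ,
      Tendsto (fun T : ℝ => ∫ g, f g ∂(JointZeta.shiftedLaw U hU γ T)) atTop
        (𝓝 (∫ g, f g ∂(JointZeta.randomLaw r U hU))) := by
  intro U hU
  obtain ⟨β, hβ, hUβ⟩ := JointZeta.exists_abscissa_rectangle hK hne hs
  have hae := JointZeta.ae_tendsto_euler r hU hβ hUβ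
  obtain ⟨T₀, hT₀, hγc, -⟩ := JointZeta.exists_continuousOn_orbit hγ.1
  have hev : ∀ᶠ T : ℝ in atTop, 0 < T ∧ ∀ j, ContinuousOn (γ j) (Set.Icc T (2 * T)) := by
    filter_upwards [eventually_ge_atTop T₀] with T hT
    exact ⟨hT₀.trans_le hT, fun j => (hγc j).mono fun x hx => hT.trans hx.1⟩
  refine ⟨hae, ?_, Measure.isProbabilityMeasure_map (JointZeta.aemeasurable_randomZeta hU hae),
    fun f => JointZeta.tendsto_integral_shiftedLaw hU hγ hae hev f⟩
  filter_upwards [hev] with T hT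
  exact JointZeta.isProbabilityMeasure_shiftedLaw hU hT.1 hT.2
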